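/- Setting. Let $(M,g)$ be a smooth, connected, complete, finite-dimensional Riemannian manifold (without boundary, Hausdorff, second countable) with intrinsic distance $d$, let $\mathcal U\subset M$ be open, $T\in(0,\infty]$, and let $K(x,y)=\tfrac12 d(x,y)^2$. $\mathcal P(\mathcal U)$ is the set of Borel probability measures on $\mathcal U$ and $\mathcal P_1(\mathcal U)$ the subset of those with finite first moment. For a curve $\rho:[0,T)\to\mathcal P_1(\mathcal U)$ put $$v[\rho](x,t)=-\int_{\mathcal U}\nabla K_y(x)\,\mathrm d\rho_t(y),\qquad K_y=K(\cdot,y),$$ where $\nabla$ is the Riemannian gradient. A flow map of $v[\rho]$ on $\operatorname{supp}(\rho_0)\times[0,T)$ is a map $\Psi:\operatorname{supp}(\rho_0)\times[0,T)\to\mathcal U$ with $\Psi(x,0)=x$ and $\frac{\mathrm d}{\mathrm dt}\Psi(x,t)=v[\rho](\Psi(x,t),t)$ for all $x\in\operatorname{supp}(\rho_0)$, $t\in[0,T)$. The curve $\rho$ is a weak solution of the aggregation equation $\partial_t\rho-\nabla\cdot(\rho\,\nabla K*\rho)=0$ if there is exactly one flow map $\Psi$ of $v[\rho]$ on $\operatorname{supp}(\rho_0)\times[0,T)$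 and $\rho_t=\Psi(\cdot,t)_\#\rho_0$ for all $t\in[0,T)$. A curve $\rho\in C([0,T);\mathcal P_1(\mathcal U))$ is called the unique weak solution if it is a weak solution and every weak solution $\sigma\in C([0,T);\mathcal P_1(\mathcal U))$ with $\sigma_0=\rho_0$ satisfies $\sigma_t=\rho_t$ for all $t\in[0,T)$. The set $\mathcal U$ is geodesically convex if any two of its points are joined by a minimizing geodesic of $M$ that lies in $\mathcal U$, and by only one such geodesic. Proposition (Well-posedness in continuum product model). Let $(M_1,g_1)$ and $(M_2,g_2)$ be two such Riemannian manifolds, let $\mathcal U_i\subset M_i$ be open and geodesically convex, and equip $M_1\times M_2$ with the product metric $g_1+g_2$; on each of the three manifolds $K$ is half the squared intrinsic distance. Suppose that $\rho^1\in C([0,T);\mathcal P_1(\mathcal U_1))$ and $\rho^2\in C([0,T);\mathcal P_1(\mathcal U_2))$ are the unique weak solutions, with their initial data $\rho^1_0$ and $\rho^2_0$, on $\mathcal U_1$ and $\mathcal U_2$. Then $\mu:=\rho^1\otimes\rho^2$, that is $\mu_t=\rho^1_t\otimes\rho^2_t$, belongs to $C([0,T);\mathcal P_1(\mathcal U_1\times\mathcal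 U_2))$ and is the unique weak solution, with initial datum $\rho^1_0\otimes\rho^2_0$, on $\mathcal U_1\times\mathcal U_2$ among curves in that space. This holds both when all the spaces $C([0,T);\mathcal P_1)$ consist of the curves in $\mathcal P_1$ that are narrowly continuous and when they consist of those that are continuous for the intrinsic $1$-Wasserstein distance $W_1$. -/

import Mathlib

open Set Filter Topology MeasureTheory Bundle Manifold
open scoped ENNReal ContDiff

noncomputable section

namespace Aggregation

/-! ### Riemannian manifolds with an explicit metric tensor -/

section Riemannian

variable {E : Type*} [NormedAddCommGroup E] [NormedSpace ℝ E]
  {H : Type*} [TopologicalSpace H] {I : ModelWithCorners ℝ E H}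
  {M : Type*} [TopologicalSpace M] [ChartedSpace H M]

/-- The intrinsic (Riemannian) distance of the metric tensor `g`: the infimum of the `g`-lengths of
`C^1` paths, as a real number (it is finite when `M` is connected). -/
def rdist (g : RiemannianMetric (fun x : M ↦ TangentSpace I x)) (x y : M) : ℝ :=
  letI : RiemannianBundle (fun x : M ↦ TangentSpace I x) := ⟨g⟩
  (riemannianEDist I x y).toReal

/-- Metric completeness for the intrinsic distance: every Cauchy sequence converges. -/
def IsCompleteMetric (g : RiemannianMetric (fun x : M ↦ TangentSpace I x)) : Prop :=
  ∀ u : ℕ → M,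
    (∀ ε : ℝ, 0 < ε → ∃ N, ∀ m n, N ≤ m → N ≤ n → rdist g (u m) (u n) < ε) →
    ∃ x, Tendsto u atTop (𝓝 x)

/-- `γ`, restricted to `[0,1]`, is a minimizing geodesic from `x` to `y`, parametrized
proportionally to arc length. -/
def IsMinimizingGeodesic (g : RiemannianMetric (fun x : M ↦ TangentSpace I x))
    (γ : ℝ → M) (x y : M) : Prop :=
  γ 0 = x ∧ γ 1 = y ∧
    ∀ s ∈ Icc (0 : ℝ) 1, ∀ t ∈ Icc (0 : ℝ) 1, rdist g (γ s) (γ t) = |s - t| * rdist g x y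

/-- `U` is geodesically convex: any two points of `U` are joined by a minimizing geodesic of `M`
that is contained in `U`, and there is only one such geodesic. -/
def GeodesicallyConvex (g : RiemannianMetric (fun x : M ↦ TangentSpace I x)) (U : Set M) : Prop :=
  ∀ x ∈ U, ∀ y ∈ U, ∃ γ : ℝ → M,
    (IsMinimizingGeodesic g γ x y ∧ ∀ t ∈ Icc (0 : ℝ) 1, γ t ∈ U) ∧
    ∀ γ' : ℝ → M, (IsMinimizingGeodesic g γ' x y ∧ ∀ t ∈ Icc (0 : ℝ) 1, γ' t ∈ U) →
      EqOn γ' γ (Icc 0 1)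

/-- The Riemannian gradient of `f` at `x`: the tangent vector `u` with `g_x(u, w) = df_x(w)` for
all `w` (it exists and is unique, see `riemGrad_spec` and `eq_riemGrad`). -/
def riemGrad (g : RiemannianMetric (fun x : M ↦ TangentSpace I x)) (f : M → ℝ) (x : M) :
    TangentSpace I x :=
  Classical.epsilon fun u : TangentSpace I x ↦
    ∀ w : TangentSpace I x, g.inner x u w = mfderiv I 𝓘(ℝ, ℝ) f x w

theorem exists_riemGrad [FiniteDimensional ℝ E]
    (g : RiemannianMetric (fun x : M ↦ TangentSpace I x)) (f : M → ℝ) (x : M) :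
    ∃ u : TangentSpace I x, ∀ w : TangentSpace I x,
      g.inner x u w = mfderiv I 𝓘(ℝ, ℝ) f x w := by
  have key : ∀ (A : E →L[ℝ] E →L[ℝ] ℝ) (L : E →L[ℝ] ℝ), (∀ v, v ≠ 0 → 0 < A v v) →
      ∃ u, ∀ w, A u w = L w := by
    intro A L hA
    let B : E →ₗ[ℝ] Module.Dual ℝ E := (ContinuousLinearMap.coeLM ℝ).comp A.toLinearMap
    have hB : ∀ u w, B u w = A u w := fun u w ↦ rfl
    have hinj : Function.Injective B := by
      rw [injective_iff_map_eq_zero]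
      intro u hu
      by_contra hne
      have h1 := hA u hne
      rw [← hB, hu] at h1
      simp at h1
    have hsurj : Function.Surjective B :=
      (LinearMap.injective_iff_surjective_of_finrank_eq_finrank
        (Subspace.dual_finrank_eq (K := ℝ) (V := E)).symm).1 hinj
    obtain ⟨u, hu⟩ := hsurj L.toLinearMap
    exact ⟨u, fun w ↦ by rw [← hB, hu]; rfl⟩
  exact key (g.inner x) (mfderiv I 𝓘(ℝ, ℝ) f x) (g.pos x)

theorem riemGrad_spec [FiniteDimensional ℝ E]
    (g : RiemannianMetric (fun x : M ↦ TangentSpace I x)) (f : M → ℝ) (x : M)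
    (w : TangentSpace I x) :
    g.inner x (riemGrad g f x) w = mfderiv I 𝓘(ℝ, ℝ) f x w :=
  Classical.epsilon_spec (exists_riemGrad g f x) w

theorem eq_riemGrad [FiniteDimensional ℝ E]
    (g : RiemannianMetric (fun x : M ↦ TangentSpace I x)) (f : M → ℝ) (x : M)
    (u : TangentSpace I x)
    (hu : ∀ w : TangentSpace I x, g.inner x u w = mfderiv I 𝓘(ℝ, ℝ) f x w) :
    u = riemGrad g f x := by
  by_contra hne
  have h := g.pos x (u - riemGrad g f x) (sub_ne_zero.2 hne)
  have h0 : g.inner x (u - riemGrad g f x) (u - riemGrad g f x) = 0 := by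
    have key : ∀ (A : E →L[ℝ] E →L[ℝ] ℝ) (a b w : E), A a w = A b w → A (a - b) w = 0 := by
      intro A a b w h
      simp [h]
    exact key (g.inner x) _ _ _ ((hu _).trans (riemGrad_spec g f x _).symm)
  exact absurd h0 h.ne'

end Riemannian

/-! ### The product metric `g₁ + g₂` -/

section Product

variable {E₁ : Type*} [NormedAddCommGroup E₁] [NormedSpace ℝ E₁]
  {H₁ : Type*} [TopologicalSpace H₁] {I₁ : ModelWithCorners ℝ E₁ H₁}
  {M₁ : Type*} [TopologicalSpace M₁] [ChartedSpace H₁ M₁]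
  {E₂ : Type*} [NormedAddCommGroup E₂] [NormedSpace ℝ E₂]
  {H₂ : Type*} [TopologicalSpace H₂] {I₂ : ModelWithCorners ℝ E₂ H₂}
  {M₂ : Type*} [TopologicalSpace M₂] [ChartedSpace H₂ M₂]

/-- The product metric on `M₁ × M₂`: for `v = (v₁, v₂)` and `w = (w₁, w₂)` tangent at `(x₁, x₂)`,
`(g₁ + g₂)(v, w) = g₁(v₁, w₁) + g₂(v₂, w₂)`. -/
def prodMetric (g₁ : RiemannianMetric (fun x : M₁ ↦ TangentSpace I₁ x))
    (g₂ : RiemannianMetric (fun x : M₂ ↦ TangentSpace I₂ x)) :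
    RiemannianMetric (fun p : M₁ × M₂ ↦ TangentSpace (I₁.prod I₂) p) where
  inner p :=
    let A₁ : E₁ →L[ℝ] E₁ →L[ℝ] ℝ := g₁.inner p.1
    let A₂ : E₂ →L[ℝ] E₂ →L[ℝ] ℝ := g₂.inner p.2
    (A₁.bilinearComp
        (ContinuousLinearMap.fst ℝ E₁ E₂) (ContinuousLinearMap.fst ℝ E₁ E₂) +
      A₂.bilinearComp
        (ContinuousLinearMap.snd ℝ E₁ E₂) (ContinuousLinearMap.snd ℝ E₁ E₂) :
      (E₁ × E₂) →L[ℝ] (E₁ × E₂) →L[ℝ] ℝ)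
  symm p v w := congrArg₂ (· + ·) (g₁.symm p.1 v.1 w.1) (g₂.symm p.2 v.2 w.2)
  pos p v hv := by
    change 0 < g₁.inner p.1 v.1 v.1 + g₂.inner p.2 v.2 v.2
    have nn₁ : ∀ u : TangentSpace I₁ p.1, 0 ≤ g₁.inner p.1 u u := fun u ↦ by
      rcases eq_or_ne u 0 with rfl | h
      · simp
      · exact (g₁.pos _ u h).le
    have nn₂ : ∀ u : TangentSpace I₂ p.2, 0 ≤ g₂.inner p.2 u u := fun u ↦ by
      rcases eq_or_ne u 0 with rfl | h
      · simp
      · exact (g₂.pos _ u h).le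
    by_cases h1 : v.1 = 0
    · have h2 : v.2 ≠ 0 := fun h2 ↦ hv (Prod.ext h1 h2)
      exact add_pos_of_nonneg_of_pos (nn₁ v.1) (g₂.pos p.2 v.2 h2)
    · exact add_pos_of_pos_of_nonneg (g₁.pos p.1 v.1 h1) (nn₂ v.2)
  continuousAt p := by
    have h1 : ContinuousAt (fun v : E₁ × E₂ ↦ g₁.inner p.1 v.1 v.1) 0 :=
      ContinuousAt.comp (x := (0 : E₁ × E₂)) (f := Prod.fst)
        (g := fun u : E₁ ↦ g₁.inner p.1 u u) (g₁.continuousAt p.1) continuousAt_fst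
    have h2 : ContinuousAt (fun v : E₁ × E₂ ↦ g₂.inner p.2 v.2 v.2) 0 :=
      ContinuousAt.comp (x := (0 : E₁ × E₂)) (f := Prod.snd)
        (g := fun u : E₂ ↦ g₂.inner p.2 u u) (g₂.continuousAt p.2) continuousAt_snd
    exact h1.add h2
  isVonNBounded p := by
    have nn₁ : ∀ u : TangentSpace I₁ p.1, 0 ≤ g₁.inner p.1 u u := fun u ↦ by
      rcases eq_or_ne u 0 with rfl | h
      · simp
      · exact (g₁.pos _ u h).le
    have nn₂ : ∀ u : TangentSpace I₂ p.2, 0 ≤ g₂.inner p.2 u u := fun u ↦ by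
      rcases eq_or_ne u 0 with rfl | h
      · simp
      · exact (g₂.pos _ u h).le
    have b₁ := (NormedSpace.isVonNBounded_iff (𝕜 := ℝ) (E := E₁)).1 (g₁.isVonNBounded p.1)
    have b₂ := (NormedSpace.isVonNBounded_iff (𝕜 := ℝ) (E := E₂)).1 (g₂.isVonNBounded p.2)
    refine (NormedSpace.isVonNBounded_iff (𝕜 := ℝ) (E := E₁ × E₂)).2 ((b₁.prod b₂).subset ?_)
    intro v hv
    have hv' : g₁.inner p.1 v.1 v.1 + g₂.inner p.2 v.2 v.2 < 1 := hv
    exact ⟨lt_of_le_of_lt (le_add_of_nonneg_right (nn₂ v.2)) hv',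
      lt_of_le_of_lt (le_add_of_nonneg_left (nn₁ v.1)) hv'⟩

/-- The product measure `ρ₁ ⊗ ρ₂` of `ρ₁ ∈ P(U₁)` and `ρ₂ ∈ P(U₂)`, as an element of
`P(U₁ × U₂)`, where `U₁ × U₂` is a subset of `M₁ × M₂`. -/
def tensor [MeasurableSpace M₁] [MeasurableSpace M₂] {U₁ : Set M₁} {U₂ : Set M₂}
    (ρ₁ : ProbabilityMeasure U₁) (ρ₂ : ProbabilityMeasure U₂) :
    ProbabilityMeasure (U₁ ×ˢ U₂ : Set (M₁ × M₂)) :=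
  (ρ₁.prod ρ₂).map (f := fun p ↦ ⟨(p.1.1, p.2.1), p.1.2, p.2.2⟩)
    (Measurable.aemeasurable (by fun_prop))

end Product

/-! ### The aggregation model with quadratic potential -/

section Model

variable {E : Type*} [NormedAddCommGroup E] [NormedSpace ℝ E]
  {H : Type*} [TopologicalSpace H] {I : ModelWithCorners ℝ E H}
  {M : Type*} [TopologicalSpace M] [ChartedSpace H M] [MeasurableSpace M]

/-- The time interval `[0, T)`, with `T ∈ (0, ∞]`. -/
def timeInterval (T : EReal) : Set ℝ := {t : ℝ | 0 ≤ t ∧ (t : EReal) < T}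

/-- The quadratic interaction potential `K(x, y) = d(x, y)² / 2`. -/
def quadPotential (g : RiemannianMetric (fun x : M ↦ TangentSpace I x)) (x y : M) : ℝ :=
  rdist g x y ^ 2 / 2

/-- The interaction velocity at `x` of the measure `ρ ∈ P(U)`:
`- (∇K * ρ)(x) = - ∫_U ∇K_y(x) dρ(y)`, where `K_y = K(·, y)`. The integrand takes its values in the
fixed finite-dimensional vector space `T_x M`, whose underlying space is `E`. -/
def velocity (g : RiemannianMetric (fun x : M ↦ TangentSpace I x)) {U : Set M}
    (ρ : ProbabilityMeasure U) (x : M) : TangentSpace I x :=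
  let F : U → E := fun y ↦ riemGrad g (fun z ↦ quadPotential g z y) x
  let V : E := ∫ y, F y ∂(ρ : Measure U)
  (-V : E)

/-- `Ψ` (restricted to `S × [0,T)`) is a flow map on `S × [0,T)`, with values in `U`, generated by
the velocity field `v[ρ]`: `Ψ(x,0) = x` and `d/dt Ψ(x,t) = v[ρ](Ψ(x,t), t)` for `x ∈ S` and
`t ∈ [0,T)` (a one-sided derivative at `t = 0`). -/
def IsFlowMap (g : RiemannianMetric (fun x : M ↦ TangentSpace I x)) {U : Set M} (T : EReal)
    (ρ : ℝ → ProbabilityMeasure U) (S : Set U) (Ψ : U → ℝ → U) : Prop :=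
  ∀ x ∈ S, Ψ x 0 = x ∧ ∀ t ∈ timeInterval T,
    HasMFDerivWithinAt 𝓘(ℝ, ℝ) I (fun s ↦ (Ψ x s : M)) (timeInterval T) t
      ((1 : ℝ →L[ℝ] ℝ).smulRight (velocity g (ρ t) (Ψ x t : M)))

/-- `(ρ_t)_{t ∈ [0,T)}` is a weak solution: `v[ρ]` generates a unique flow map `Ψ` defined on
`supp(ρ_0) × [0,T)`, and `ρ_t = Ψ^t # ρ_0` for all `t ∈ [0,T)`. Only the values of `ρ` on `[0,T)`
and those of `Ψ` on `supp(ρ_0) × [0,T)` are relevant. -/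
def IsWeakSolution (g : RiemannianMetric (fun x : M ↦ TangentSpace I x)) {U : Set M} (T : EReal)
    (ρ : ℝ → ProbabilityMeasure U) : Prop :=
  ∃ Ψ : U → ℝ → U,
    IsFlowMap g T ρ (ρ 0 : Measure U).support Ψ ∧
    (∀ Ψ' : U → ℝ → U, IsFlowMap g T ρ (ρ 0 : Measure U).support Ψ' →
      ∀ x ∈ (ρ 0 : Measure U).support, ∀ t ∈ timeInterval T, Ψ' x t = Ψ x t) ∧
    ∀ t ∈ timeInterval T,
      AEMeasurable (fun x ↦ Ψ x t) (ρ 0 : Measure U) ∧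
      (ρ t : Measure U) = (ρ 0 : Measure U).map fun x ↦ Ψ x t

/-- `ρ ∈ P₁(U)`: the measure `ρ` has finite first moment. -/
def HasFiniteFirstMoment (g : RiemannianMetric (fun x : M ↦ TangentSpace I x)) {U : Set M}
    (ρ : ProbabilityMeasure U) : Prop :=
  ∀ x₀ : U, Integrable (fun x : U ↦ rdist g (x₀ : M) x) (ρ : Measure U)

/-- The intrinsic `1`-Wasserstein distance
`W₁(ρ, σ) = inf_π ∫ d(x, y) dπ(x, y)`, over the transport plans `π` between `ρ` and `σ`. -/
def W1 (g : RiemannianMetric (fun x : M ↦ TangentSpace I x)) {U : Set M}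
    (ρ σ : ProbabilityMeasure U) : ℝ≥0∞ :=
  ⨅ (plan : Measure (U × U)) (_ : plan.map Prod.fst = ρ ∧ plan.map Prod.snd = σ),
    ∫⁻ p, ENNReal.ofReal (rdist g (p.1 : M) p.2) ∂plan

/-- Narrowly continuous curves `[0,T) → P₁(U)`. -/
def narrowCurves [OpensMeasurableSpace M] (g : RiemannianMetric (fun x : M ↦ TangentSpace I x))
    (U : Set M) (T : EReal) : Set (ℝ → ProbabilityMeasure U) :=
  {ρ | (∀ t ∈ timeInterval T, HasFiniteFirstMoment g (ρ t)) ∧ ContinuousOn ρ (timeInterval T)}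

/-- Curves `[0,T) → P₁(U)` that are continuous for the Wasserstein distance `W₁`. -/
def wassersteinCurves (g : RiemannianMetric (fun x : M ↦ TangentSpace I x))
    (U : Set M) (T : EReal) : Set (ℝ → ProbabilityMeasure U) :=
  {ρ | (∀ t ∈ timeInterval T, HasFiniteFirstMoment g (ρ t)) ∧
    ∀ t ∈ timeInterval T, Tendsto (fun s ↦ W1 g (ρ s) (ρ t)) (𝓝[timeInterval T] t) (𝓝 0)}

/-- `ρ` is the unique weak solution on `[0,T)`, with its initial datum `ρ_0`, among the curves of
the class `C`. -/
def IsUniqueWeakSolution (g : RiemannianMetric (fun x : M ↦ TangentSpace I x)) {U : Set M}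
    (T : EReal) (C : Set (ℝ → ProbabilityMeasure U)) (ρ : ℝ → ProbabilityMeasure U) : Prop :=
  ρ ∈ C ∧ IsWeakSolution g T ρ ∧
    ∀ σ ∈ C, IsWeakSolution g T σ → σ 0 = ρ 0 → EqOn σ ρ (timeInterval T)

end Model

end Aggregation

end

/-! The distance of a Riemannian product obeys Pythagoras' formula (`rdist_prod_sq`), so the
potential is the sum of the potentials of the factors and its gradient is a pair. Integrated against
any `σ` on `U₁ × U₂`, of product form or not, the velocity is the pair of velocities generated by
the two marginals of `σ` (`velocity_prod`). Hence a curve is a trajectory for `σ` exactly when its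
components are trajectories for the marginals (`isTrajectory_prod_iff`).

Existence follows, the flow map being the product of the two flow maps. For uniqueness, let `σ` be a
weak solution with product datum. Splicing the first component of one trajectory with the second
component of another gives a trajectory again, so by uniqueness of the flow the first component does
not depend on where the second one starts. Each marginal of `σ` is therefore a weak solution on its
factor, equal to the given one. Now `σ` and the tensor product have the same marginals, hence the
same velocity and the same flow, hence they agree. The two classes of curves enter only through
finite first moments and stability under tensor products and marginals
(`isUniqueWeakSolution_tensor`).

The analytic core is the differentiability of `d(·, y)²` on an open geodesically convex set
(`mdifferentiableAt_quadPotential`), without which neither the gradient nor the integral would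
split. The argument is metric. In a chart the squared distance is a constant quadratic form up to a
relative error linear in the scale (`exists_rdist_chart_compare`). Minimizing geodesics to `y`,
being unique, depend continuously on their starting point (`tendsto_minimizingGeodesic`). Their mean
velocities over dyadic times converge because metric midpoints are almost Euclidean ones, and a
first-variation inequality used from both endpoints pinches the increment of `d(·, y)²`
(`differentiableAt_of_minimizers`). The differential grows at most linearly in `d(x, y)`, so a
finite first moment makes the gradient integrable (`integrable_riemGrad`). -/

noncomputable section

namespace Aggregation

/-! ### The metric tensor in a chart. -/

section LocalMetric

variable {E : Type*} [NormedAddCommGroup E] [NormedSpace ℝ E]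
  {H : Type*} [TopologicalSpace H] {I : ModelWithCorners ℝ E H}
  {M : Type*} [TopologicalSpace M] [ChartedSpace H M] [IsManifold I ∞ M]

set_option synthInstance.maxHeartbeats 200000 in
/-- Near `x`, the metric read in the chart at `x` is Lipschitz close to its value at `x`. -/
theorem exists_bilin_chart [I.Boundaryless]
    (g : ContMDiffRiemannianMetric I ∞ E (fun x : M ↦ TangentSpace I x)) (x : M) :
    ∃ B : E →L[ℝ] E →L[ℝ] ℝ, (∀ v w, B v w = B w v) ∧ (∀ v, v ≠ 0 → 0 < B v v) ∧
      ∃ C > 0, ∀ᶠ z in 𝓝 x, ∀ (w : TangentSpace I z) (e : E),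
        e = mfderiv I 𝓘(ℝ, E) (extChartAt I x) z w →
        |g.inner z w w - B e e| ≤ C * ‖extChartAt I x z - extChartAt I x x‖ * ‖e‖ ^ 2 := by
  have h'x : x ∈ (trivializationAt E (TangentSpace I : M → Type _) x).baseSet :=
    FiberBundle.mem_baseSet_trivializationAt' x
  let g' : M → E →L[ℝ] E →L[ℝ] ℝ := fun y ↦
    ContinuousLinearMap.inCoordinates E (TangentSpace I : M → Type _) (E →L[ℝ] ℝ)
      (fun x ↦ TangentSpace I x →L[ℝ] ℝ) x y x y (g.inner y)
  have hg' : ContMDiffAt I 𝓘(ℝ, E →L[ℝ] E →L[ℝ] ℝ) ∞ g' x := by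
    have W := g.contMDiff x
    rw [contMDiffAt_hom_bundle] at W
    exact W.2
  have g'_apply : ∀ y ∈ (trivializationAt E (TangentSpace I : M → Type _) x).baseSet,
      ∀ v w, g' y v w = g.inner y ((trivializationAt E (TangentSpace I : M → Type _) x).symm y v)
        ((trivializationAt E (TangentSpace I : M → Type _) x).symm y w) := by
    intro y hy v w
    simp only [g']
    rw [inCoordinates_apply_eq₂ hy hy (Set.mem_univ _)]
    simp
  -- Only a comparison with the base point is needed, and differentiability of the coefficients at
  -- that single point supplies it.
  have hdiff : DifferentiableAt ℝ (g' ∘ (extChartAt I x).symm) (extChartAt I x x) := by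
    have h1 := ((mdifferentiableAt_iff _ _).1 (hg'.mdifferentiableAt (by simp))).2
    rw [I.range_eq_univ, differentiableWithinAt_univ] at h1
    exact h1
  obtain ⟨C, hC⟩ := (DifferentiableAt.isBigO_sub (𝕜 := ℝ) (F := E →L[ℝ] E →L[ℝ] ℝ) hdiff).bound
  refine ⟨g' x, ?_, ?_, max C 1, by positivity, ?_⟩
  · intro v w
    rw [g'_apply x h'x, g'_apply x h'x]
    exact g.symm _ _ _
  · intro v hv
    rw [g'_apply x h'x]
    apply g.pos
    intro h0
    apply hv
    let e := (trivializationAt E (TangentSpace I : M → Type _) x).continuousLinearEquivAt ℝ x h'x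
    have h1 : e.symm v = 0 := h0
    exact (map_eq_zero_iff e.symm e.symm.injective).1 h1
  · have hcont := (continuousAt_extChartAt (I := I) x).eventually hC
    filter_upwards [hcont, chart_source_mem_nhds H x] with z hz h'z w e he
    have hzb : z ∈ (trivializationAt E (TangentSpace I : M → Type _) x).baseSet := by
      simpa using h'z
    have hleft : (extChartAt I x).symm (extChartAt I x z) = z :=
      (extChartAt I x).left_inv (by simpa using h'z)
    have hleft' : (extChartAt I x).symm (extChartAt I x x) = x := extChartAt_to_inv x
    simp only [Function.comp_apply, hleft, hleft'] at hz
    have hw : (trivializationAt E (TangentSpace I : M → Type _) x).symm z e = w := by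
      let L := (trivializationAt E (TangentSpace I : M → Type _) x).continuousLinearEquivAt ℝ z hzb
      have h1 : (trivializationAt E (TangentSpace I : M → Type _) x).continuousLinearMapAt ℝ z w
          = L w := by
        simp [L, Trivialization.coe_continuousLinearEquivAt_eq _ hzb]
      have h2 := TangentBundle.continuousLinearMapAt_trivializationAt (I := I) (𝕜 := ℝ) h'z
      have h3 : e = L w := he.trans ((DFunLike.congr_fun h2.symm w).trans h1)
      rw [h3]
      exact L.symm_apply_apply w
    have hgz : g.inner z w w = g' z e e := by rw [g'_apply z hzb, hw]
    rw [hgz]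
    calc |g' z e e - g' x e e| = ‖(g' z - g' x) e e‖ := by simp
      _ ≤ ‖g' z - g' x‖ * ‖e‖ * ‖e‖ := ContinuousLinearMap.le_opNorm₂ _ _ _
      _ ≤ (max C 1 * ‖extChartAt I x z - extChartAt I x x‖) * ‖e‖ * ‖e‖ := by
        gcongr
        exact hz.trans (by gcongr; exact le_max_left _ _)
      _ = _ := by ring

end LocalMetric

/-! ### Extended distance, speed and length of paths for an explicit metric tensor. -/

section Length

variable {E : Type*} [NormedAddCommGroup E] [NormedSpace ℝ E]
  {H : Type*} [TopologicalSpace H] {I : ModelWithCorners ℝ E H}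
  {M : Type*} [TopologicalSpace M] [ChartedSpace H M]

/-- The intrinsic distance with values in `[0, ∞]`. -/
def redist (g : RiemannianMetric (fun x : M ↦ TangentSpace I x)) (x y : M) : ℝ≥0∞ :=
  letI : RiemannianBundle (fun x : M ↦ TangentSpace I x) := ⟨g⟩
  riemannianEDist I x y

/-- The norm of a tangent vector for the metric tensor `g`. -/
def gnorm (g : RiemannianMetric (fun x : M ↦ TangentSpace I x)) (x : M) (w : TangentSpace I x) :
    ℝ :=
  √(g.inner x w w)

/-- The `g`-speed of a path. -/
def speed (g : RiemannianMetric (fun x : M ↦ TangentSpace I x)) (γ : ℝ → M) (t : ℝ) : ℝ :=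
  gnorm g (γ t) (mfderiv 𝓘(ℝ, ℝ) I γ t (1 : ℝ))

/-- The `g`-length of a path. -/
def glength (g : RiemannianMetric (fun x : M ↦ TangentSpace I x)) (γ : ℝ → M) (a b : ℝ) : ℝ≥0∞ :=
  ∫⁻ t in Icc a b, ENNReal.ofReal (speed g γ t)

theorem speed_nonneg (g : RiemannianMetric (fun x : M ↦ TangentSpace I x)) (γ : ℝ → M) (t : ℝ) :
    0 ≤ speed g γ t :=
  Real.sqrt_nonneg _

theorem inner_self_nonneg (g : RiemannianMetric (fun x : M ↦ TangentSpace I x)) (x : M)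
    (w : TangentSpace I x) : 0 ≤ g.inner x w w := by
  rcases eq_or_ne w 0 with rfl | h
  · simp
  · exact (g.pos _ w h).le

theorem gnorm_sq (g : RiemannianMetric (fun x : M ↦ TangentSpace I x)) (x : M)
    (w : TangentSpace I x) : gnorm g x w ^ 2 = g.inner x w w :=
  Real.sq_sqrt (inner_self_nonneg g x w)

theorem gnorm_smul (g : RiemannianMetric (fun x : M ↦ TangentSpace I x)) (x : M) (c : ℝ)
    (w : TangentSpace I x) : gnorm g x (c • w) = |c| * gnorm g x w := by
  have h : g.inner x (c • w) (c • w) = c ^ 2 * g.inner x w w := by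
    simp only [map_smul, smul_apply, smul_eq_mul]
    ring
  rw [gnorm, h, Real.sqrt_mul (sq_nonneg c), Real.sqrt_sq_eq_abs]
  rfl

theorem enorm_eq_ofReal_gnorm (g : RiemannianMetric (fun x : M ↦ TangentSpace I x)) (x : M)
    (w : TangentSpace I x) :
    letI : RiemannianBundle (fun x : M ↦ TangentSpace I x) := ⟨g⟩
    ‖w‖ₑ = ENNReal.ofReal (gnorm g x w) := by
  let _ : RiemannianBundle (fun x : M ↦ TangentSpace I x) := ⟨g⟩
  rw [← ofReal_norm]
  rfl

theorem glength_eq_pathELength (g : RiemannianMetric (fun x : M ↦ TangentSpace I x)) (γ : ℝ → M)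
    (a b : ℝ) :
    letI : RiemannianBundle (fun x : M ↦ TangentSpace I x) := ⟨g⟩
    glength g γ a b = pathELength I γ a b := by
  let _ : RiemannianBundle (fun x : M ↦ TangentSpace I x) := ⟨g⟩
  rw [pathELength_eq_lintegral_mfderiv_Icc, glength]
  refine lintegral_congr fun t ↦ ?_
  rw [enorm_eq_ofReal_gnorm]
  rfl

variable (g : RiemannianMetric (fun x : M ↦ TangentSpace I x))

theorem rdist_eq_toReal (x y : M) : rdist g x y = (redist g x y).toReal := rfl

theorem redist_le_glength {γ : ℝ → M} {a b : ℝ} (hγ : ContMDiffOn 𝓘(ℝ, ℝ) I 1 γ (Icc a b))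
    (hab : a ≤ b) : redist g (γ a) (γ b) ≤ glength g γ a b := by
  let _ : RiemannianBundle (fun x : M ↦ TangentSpace I x) := ⟨g⟩
  rw [glength_eq_pathELength]
  exact riemannianEDist_le_pathELength hγ rfl rfl hab

theorem exists_glength_lt {x y : M} {r : ℝ≥0∞} (h : redist g x y < r) :
    ∃ γ : ℝ → M, γ 0 = x ∧ γ 1 = y ∧ ContMDiff 𝓘(ℝ, ℝ) I 1 γ ∧ glength g γ 0 1 < r := by
  let _ : RiemannianBundle (fun x : M ↦ TangentSpace I x) := ⟨g⟩
  obtain ⟨γ, h0, h1, h2, h3, -⟩ := exists_lt_locally_constant_of_riemannianEDist_lt h zero_lt_one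
  exact ⟨γ, h0, h1, h2, by rwa [glength_eq_pathELength]⟩

theorem glength_mono {γ : ℝ → M} {a b a' b' : ℝ} (h : a' ≤ a) (h' : b ≤ b') :
    glength g γ a b ≤ glength g γ a' b' :=
  lintegral_mono_set (Icc_subset_Icc h h')

theorem redist_self (x : M) : redist g x x = 0 := by
  let _ : RiemannianBundle (fun x : M ↦ TangentSpace I x) := ⟨g⟩
  exact riemannianEDist_self

theorem redist_comm (x y : M) : redist g x y = redist g y x := by
  let _ : RiemannianBundle (fun x : M ↦ TangentSpace I x) := ⟨g⟩
  exact riemannianEDist_comm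

theorem redist_triangle (x y z : M) : redist g x z ≤ redist g x y + redist g y z := by
  let _ : RiemannianBundle (fun x : M ↦ TangentSpace I x) := ⟨g⟩
  exact riemannianEDist_triangle

theorem rdist_nonneg (x y : M) : 0 ≤ rdist g x y := ENNReal.toReal_nonneg

theorem rdist_self (x : M) : rdist g x x = 0 := by simp [rdist_eq_toReal, redist_self]

theorem rdist_comm (x y : M) : rdist g x y = rdist g y x := by
  rw [rdist_eq_toReal, redist_comm, ← rdist_eq_toReal]

end Length

/-! ### Finiteness and continuity of the intrinsic distance. -/

section Topology

variable {E : Type*} [NormedAddCommGroup E] [NormedSpace ℝ E]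
  {H : Type*} [TopologicalSpace H] {I : ModelWithCorners ℝ E H}
  {M : Type*} [TopologicalSpace M] [ChartedSpace H M] [IsManifold I ∞ M]
  (g : ContMDiffRiemannianMetric I ∞ E (fun x : M ↦ TangentSpace I x))

theorem eventually_redist_lt (x : M) {c : ℝ≥0∞} (hc : 0 < c) :
    ∀ᶠ y in 𝓝 x, redist g.toRiemannianMetric x y < c := by
  let _ : RiemannianBundle (fun x : M ↦ TangentSpace I x) := ⟨g.toRiemannianMetric⟩
  have : IsManifold I 1 M := .of_le (n := ∞) (by simp)
  have : IsContinuousRiemannianBundle E (fun x : M ↦ TangentSpace I x) :=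
    ⟨g.inner, g.contMDiff.continuous, fun _ _ _ ↦ rfl⟩
  exact eventually_riemannianEDist_lt I x hc

/-- Together with `eventually_redist_lt` this identifies the metric topology with that of the
manifold. It later confines short paths to a chart. -/
theorem exists_redist_lt_subset [RegularSpace M] {x : M} {s : Set M} (hs : s ∈ 𝓝 x) :
    ∃ c > (0 : ℝ), ∀ y, redist g.toRiemannianMetric x y < ENNReal.ofReal c → y ∈ s := by
  let _ : RiemannianBundle (fun x : M ↦ TangentSpace I x) := ⟨g.toRiemannianMetric⟩
  have : IsManifold I 1 M := .of_le (n := ∞) (by simp)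
  have : IsContinuousRiemannianBundle E (fun x : M ↦ TangentSpace I x) :=
    ⟨g.inner, g.contMDiff.continuous, fun _ _ _ ↦ rfl⟩
  obtain ⟨c, c0, hc⟩ := setOfPred_riemannianEDist_lt_subset_nhds I hs
  refine ⟨c, c0, fun y hy ↦ ?_⟩
  rw [ENNReal.ofReal_coe_nnreal] at hy
  exact hc hy

/-- Nearby points are at finite distance, so by the triangle inequality the set of points at finite
distance from `x` is clopen, and connectedness concludes. -/
theorem redist_ne_top [ConnectedSpace M] (x y : M) : redist g.toRiemannianMetric x y ≠ ⊤ := by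
  have hloc : ∀ z, ∀ᶠ w in 𝓝 z, redist g.toRiemannianMetric z w ≠ ⊤ := fun z ↦
    (eventually_redist_lt g z zero_lt_one).mono fun w hw ↦ (hw.trans ENNReal.one_lt_top).ne
  have hclopen : IsClopen {z | redist g.toRiemannianMetric x z ≠ ⊤} := by
    constructor
    · rw [← isOpen_compl_iff, isOpen_iff_mem_nhds]
      intro z hz
      filter_upwards [hloc z] with w hw
      simp only [mem_compl_iff, mem_ofPred_eq, not_not] at hz ⊢
      by_contra hxw
      have := redist_triangle g.toRiemannianMetric x w z
      rw [hz, redist_comm _ w z, top_le_iff, ENNReal.add_eq_top] at this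
      tauto
    · rw [isOpen_iff_mem_nhds]
      intro z hz
      filter_upwards [hloc z] with w hw
      exact ne_top_of_le_ne_top (ENNReal.add_ne_top.2 ⟨hz, hw⟩) (redist_triangle _ x z w)
  have := hclopen.eq_univ ⟨x, by simp [redist_self]⟩
  exact this.ge (mem_univ y)

theorem ofReal_rdist [ConnectedSpace M] (x y : M) :
    ENNReal.ofReal (rdist g.toRiemannianMetric x y) = redist g.toRiemannianMetric x y :=
  ENNReal.ofReal_toReal (redist_ne_top g x y)

theorem rdist_triangle [ConnectedSpace M] (x y z : M) :
    rdist g.toRiemannianMetric x z ≤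
      rdist g.toRiemannianMetric x y + rdist g.toRiemannianMetric y z := by
  simp only [rdist_eq_toReal]
  rw [← ENNReal.toReal_add (redist_ne_top g x y) (redist_ne_top g y z)]
  exact ENNReal.toReal_mono (ENNReal.add_ne_top.2 ⟨redist_ne_top g x y, redist_ne_top g y z⟩)
    (redist_triangle _ x y z)

theorem eventually_rdist_lt [ConnectedSpace M] (x : M) {c : ℝ} (hc : 0 < c) :
    ∀ᶠ y in 𝓝 x, rdist g.toRiemannianMetric x y < c := by
  filter_upwards [eventually_redist_lt g x (ENNReal.ofReal_pos.2 hc)] with y hy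
  rw [← ofReal_rdist] at hy
  exact (ENNReal.ofReal_lt_ofReal_iff hc).1 hy

theorem exists_rdist_lt_subset [ConnectedSpace M] [RegularSpace M] {x : M} {s : Set M}
    (hs : s ∈ 𝓝 x) : ∃ c > (0 : ℝ), ∀ y, rdist g.toRiemannianMetric x y < c → y ∈ s := by
  obtain ⟨c, c0, hc⟩ := exists_redist_lt_subset g hs
  refine ⟨c, c0, fun y hy ↦ hc y ?_⟩
  rw [← ofReal_rdist]
  exact (ENNReal.ofReal_lt_ofReal_iff c0).2 hy

theorem continuous_rdist [ConnectedSpace M] :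
    Continuous fun p : M × M ↦ rdist g.toRiemannianMetric p.1 p.2 := by
  rw [continuous_iff_continuousAt]
  rintro ⟨x, y⟩
  rw [ContinuousAt, Metric.tendsto_nhds]
  intro ε hε
  rw [nhds_prod_eq]
  filter_upwards [(eventually_rdist_lt g x (half_pos hε)).prod_mk
    (eventually_rdist_lt g y (half_pos hε))] with p hp
  have h1 := rdist_triangle g x p.1 y
  have h2 := rdist_triangle g p.1 p.2 y
  have h3 := rdist_triangle g p.1 x p.2
  have h4 := rdist_triangle g x y p.2
  rw [Real.dist_eq, abs_lt]
  rw [rdist_comm _ p.1 x] at h3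
  rw [rdist_comm _ p.2 y] at h2
  obtain ⟨h5, h6⟩ := hp
  constructor <;> linarith

end Topology

/-! ### Positive definite bilinear forms. -/

section Bilin

variable {E : Type*} [NormedAddCommGroup E] [NormedSpace ℝ E] {B : E →L[ℝ] E →L[ℝ] ℝ}

theorem bilin_nonneg (hpos : ∀ v, v ≠ 0 → 0 < B v v) (v : E) : 0 ≤ B v v := by
  rcases eq_or_ne v 0 with rfl | h
  · simp
  · exact (hpos v h).le

/-- Cauchy–Schwarz, from positivity of the form at `B w w • v - B v w • w`. -/
theorem bilin_sq_le (hsymm : ∀ v w, B v w = B w v) (hpos : ∀ v, v ≠ 0 → 0 < B v v) (v w : E) :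
    B v w ^ 2 ≤ B v v * B w w := by
  rcases eq_or_ne w 0 with rfl | hw
  · simp
  have hw' := hpos w hw
  have h := bilin_nonneg hpos (B w w • v - B v w • w)
  simp only [map_sub, map_smul, sub_apply, smul_apply, smul_eq_mul] at h
  rw [hsymm w v] at h
  have h2 : 0 ≤ B w w * (B v v * B w w - B v w ^ 2) := by nlinarith [h]
  linarith [nonneg_of_mul_nonneg_right h2 hw']

theorem bilin_le_opNorm (v : E) : B v v ≤ ‖B‖ * ‖v‖ ^ 2 := by
  have := (le_abs_self _).trans (B.le_opNorm₂ v v)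
  rw [pow_two]
  linarith

/-- The constant is the minimum of the quadratic form on the compact unit sphere. The empty sphere,
which occurs in dimension zero, is treated apart. -/
theorem exists_coercive [FiniteDimensional ℝ E] (hpos : ∀ v, v ≠ 0 → 0 < B v v) :
    ∃ b > 0, ∀ v, b * ‖v‖ ^ 2 ≤ B v v := by
  have : ProperSpace E := FiniteDimensional.proper ℝ E
  rcases (Metric.sphere (0 : E) 1).eq_empty_or_nonempty with h | h
  · refine ⟨1, one_pos, fun v ↦ ?_⟩
    rcases eq_or_ne v 0 with rfl | hv
    · simp
    · exfalso
      have : ‖v‖⁻¹ • v ∈ Metric.sphere (0 : E) 1 := by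
        simp [norm_smul, hv]
      simp [h] at this
  · obtain ⟨w, hw, hmin⟩ := (isCompact_sphere (0 : E) 1).exists_isMinOn h
      (f := fun v ↦ B v v) (B.continuous.clm_apply continuous_id).continuousOn
    have hw0 : w ≠ 0 := by
      rintro rfl
      simp at hw
    refine ⟨B w w, hpos w hw0, fun v ↦ ?_⟩
    rcases eq_or_ne v 0 with rfl | hv
    · simp
    · have h1 : ‖v‖⁻¹ • v ∈ Metric.sphere (0 : E) 1 := by
        simp [norm_smul, hv]
      have h2 : B w w ≤ B (‖v‖⁻¹ • v) (‖v‖⁻¹ • v) := hmin h1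
      simp only [map_smul, smul_apply, smul_eq_mul] at h2
      have hv' : 0 < ‖v‖ := norm_pos_iff.2 hv
      calc B w w * ‖v‖ ^ 2 ≤ (‖v‖⁻¹ * (‖v‖⁻¹ * B v v)) * ‖v‖ ^ 2 := by gcongr
        _ = B v v := by field_simp

end Bilin

/-! ### Lengths of paths against quadratic forms in a chart. -/

section Chart

variable {E : Type*} [NormedAddCommGroup E] [NormedSpace ℝ E]
  {H : Type*} [TopologicalSpace H] {I : ModelWithCorners ℝ E H}
  {M : Type*} [TopologicalSpace M] [ChartedSpace H M] [IsManifold I ∞ M]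

theorem hasDerivAt_extChartAt_comp {x : M} {γ : ℝ → M} {t : ℝ} {e : E}
    (hγ : MDifferentiableAt 𝓘(ℝ, ℝ) I γ t) (ht : γ t ∈ (chartAt H x).source)
    (he : e = mfderiv I 𝓘(ℝ, E) (extChartAt I x) (γ t) (mfderiv 𝓘(ℝ, ℝ) I γ t (1 : ℝ))) :
    HasDerivAt (fun s ↦ extChartAt I x (γ s)) e t := by
  have : IsManifold I 1 M := .of_le (n := ∞) (by simp)
  have h1 := (mdifferentiableAt_extChartAt (I := I) ht).hasMFDerivAt.comp t hγ.hasMFDerivAt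
  let L : ℝ →L[ℝ] E :=
    (mfderiv I 𝓘(ℝ, E) (extChartAt I x) (γ t)).comp (mfderiv 𝓘(ℝ, ℝ) I γ t)
  have h2 : HasFDerivAt (fun s ↦ extChartAt I x (γ s)) L t := hasMFDerivAt_iff_hasFDerivAt.1 h1
  have h3 : e = L 1 := he
  rw [h3]
  exact h2.hasDerivAt

variable (g : ContMDiffRiemannianMetric I ∞ E (fun x : M ↦ TangentSpace I x))
  {B : E →L[ℝ] E →L[ℝ] ℝ}

/-- A path along which the metric is at least `(1 - κ) B` in the chart at `x` is at least as long
as `√(1 - κ)` times the `B`-distance between its endpoints. -/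
theorem bilin_le_of_glength_le (hsymm : ∀ v w, B v w = B w v) (hpos : ∀ v, v ≠ 0 → 0 < B v v)
    {x : M} {κ : ℝ} (hκ : κ < 1) {γ : ℝ → M} (hγ : ContMDiff 𝓘(ℝ, ℝ) I 1 γ)
    (hsrc : ∀ t ∈ Icc (0 : ℝ) 1, γ t ∈ (chartAt H x).source)
    (hB : ∀ t ∈ Icc (0 : ℝ) 1, ∀ (w : TangentSpace I (γ t)) (e : E),
      e = mfderiv I 𝓘(ℝ, E) (extChartAt I x) (γ t) w → (1 - κ) * B e e ≤ g.inner (γ t) w w)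
    {r : ℝ} (hr : 0 ≤ r) (hlen : glength g.toRiemannianMetric γ 0 1 ≤ ENNReal.ofReal r) :
    (1 - κ) * B (extChartAt I x (γ 1) - extChartAt I x (γ 0))
      (extChartAt I x (γ 1) - extChartAt I x (γ 0)) ≤ r ^ 2 := by
  have : IsManifold I 1 M := .of_le (n := ∞) (by simp)
  set w₀ := extChartAt I x (γ 1) - extChartAt I x (γ 0) with hw₀
  have hκ' : 0 < 1 - κ := by linarith
  have hq : 0 ≤ B w₀ w₀ := bilin_nonneg hpos w₀
  let e : ℝ → E := fun t ↦
    mfderiv I 𝓘(ℝ, E) (extChartAt I x) (γ t) (mfderiv 𝓘(ℝ, ℝ) I γ t (1 : ℝ))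
  have hder : ∀ t ∈ Icc (0 : ℝ) 1, HasDerivAt (fun s ↦ extChartAt I x (γ s)) (e t) t :=
    fun t ht ↦ hasDerivAt_extChartAt_comp (hγ.mdifferentiableAt one_ne_zero) (hsrc t ht) rfl
  have hC1 : ContDiffOn ℝ 1 (fun s ↦ extChartAt I x (γ s)) (Icc 0 1) := by
    rw [← contMDiffOn_iff_contDiffOn]
    exact contMDiffOn_extChartAt.comp (I' := I) (t := (chartAt H x).source) hγ.contMDiffOn hsrc
  -- The path is tested against the functional `B w₀`: the increment of `β` is then exactly `B w₀
  -- w₀`, and only a scalar function has to be integrated.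
  let β : ℝ → ℝ := fun s ↦ B w₀ (extChartAt I x (γ s))
  have hβC1 : ContDiffOn ℝ 1 β (Icc 0 1) := (B w₀).contDiff.comp_contDiffOn hC1
  have hβder : ∀ t ∈ Icc (0 : ℝ) 1, derivWithin β (Icc 0 1) t = B w₀ (e t) := fun t ht ↦
    (((B w₀).hasFDerivAt.comp_hasDerivAt t (hder t ht)).hasDerivWithinAt).derivWithin
      (uniqueDiffOn_Icc zero_lt_one t ht)
  have h1 := enorm_sub_le_lintegral_derivWithin_Icc_of_contDiffOn_Icc hβC1 zero_le_one
  have hβ : β 1 - β 0 = B w₀ w₀ := by simp only [β, ← map_sub, hw₀]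
  -- Cauchy–Schwarz together with `hB` bounds the derivative of `β` by `c` times the speed.
  set c := √(B w₀ w₀ / (1 - κ)) with hc
  have h2 : ∫⁻ t in Icc (0 : ℝ) 1, ‖derivWithin β (Icc 0 1) t‖ₑ ≤
      ∫⁻ t in Icc (0 : ℝ) 1,
        ENNReal.ofReal c * ENNReal.ofReal (speed g.toRiemannianMetric γ t) := by
    refine setLIntegral_mono' measurableSet_Icc fun t ht ↦ ?_
    rw [hβder t ht, ← ENNReal.ofReal_mul (Real.sqrt_nonneg _), Real.enorm_eq_ofReal_abs]
    refine ENNReal.ofReal_le_ofReal ?_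
    have hle := hB t ht (mfderiv 𝓘(ℝ, ℝ) I γ t (1 : ℝ)) (e t) rfl
    rw [speed, gnorm, ← Real.sqrt_mul (div_nonneg hq hκ'.le)]
    refine Real.le_sqrt_of_sq_le ?_
    rw [sq_abs]
    refine (bilin_sq_le hsymm hpos _ _).trans ?_
    rw [div_mul_eq_mul_div, le_div_iff₀ hκ', mul_assoc]
    refine mul_le_mul_of_nonneg_left ?_ hq
    rw [mul_comm]
    exact hle
  rw [lintegral_const_mul' _ _ ENNReal.ofReal_ne_top] at h2
  have h3 : ENNReal.ofReal (B w₀ w₀) ≤ ENNReal.ofReal (c * r) := by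
    rw [ENNReal.ofReal_mul (Real.sqrt_nonneg _)]
    calc ENNReal.ofReal (B w₀ w₀) = ‖β 1 - β 0‖ₑ := by rw [hβ, Real.enorm_of_nonneg hq]
      _ ≤ _ := h1
      _ ≤ _ := h2
      _ ≤ _ := by gcongr; exact hlen
  have h4 : B w₀ w₀ ≤ c * r :=
    (ENNReal.ofReal_le_ofReal_iff (mul_nonneg (Real.sqrt_nonneg _) hr)).1 h3
  -- Squaring `h4` leaves a common factor `B w₀ w₀`, which can be cancelled only if it is positive.
  rcases hq.eq_or_lt with h0 | h0
  · rw [← h0]; simp [sq_nonneg]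
  have h5 : (B w₀ w₀) ^ 2 ≤ (c * r) ^ 2 := pow_le_pow_left₀ hq h4 2
  rw [mul_pow, hc, Real.sq_sqrt (div_nonneg hq hκ'.le), div_mul_eq_mul_div,
    le_div_iff₀ hκ'] at h5
  nlinarith [h5]

/-- If the metric is at most `(1 + κ) B` in the chart at `x` along the segment joining two points
in the chart, then their distance is at most `√(1 + κ)` times their `B`-distance. -/
theorem rdist_sq_le_bilin [I.Boundaryless] (hpos : ∀ v, v ≠ 0 → 0 < B v v)
    {x : M} {κ : ℝ} (hκ : 0 ≤ κ) {s : Set E} (hs : Convex ℝ s) (hst : s ⊆ (extChartAt I x).target)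
    (hB : ∀ z ∈ (chartAt H x).source, extChartAt I x z ∈ s → ∀ (w : TangentSpace I z) (e : E),
      e = mfderiv I 𝓘(ℝ, E) (extChartAt I x) z w → g.inner z w w ≤ (1 + κ) * B e e)
    {u v : M} (hu : u ∈ (chartAt H x).source) (hv : v ∈ (chartAt H x).source)
    (hus : extChartAt I x u ∈ s) (hvs : extChartAt I x v ∈ s) :
    rdist g.toRiemannianMetric u v ^ 2 ≤ (1 + κ) *
      B (extChartAt I x v - extChartAt I x u) (extChartAt I x v - extChartAt I x u) := by
  have : IsManifold I 1 M := .of_le (n := ∞) (by simp)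
  set w₀ := extChartAt I x v - extChartAt I x u with hw₀
  have hq : 0 ≤ B w₀ w₀ := bilin_nonneg hpos w₀
  let η : ℝ → E := fun t ↦ extChartAt I x u + t • w₀
  have hηs : ∀ t ∈ Icc (0 : ℝ) 1, η t ∈ s := fun t ht ↦ hs.add_smul_sub_mem hus hvs ht
  have hηd : ∀ t, HasDerivAt η w₀ t := fun t ↦ by
    have := ((hasDerivAt_id t).smul_const w₀).const_add (extChartAt I x u)
    rwa [one_smul] at this
  have hηC : ContDiff ℝ 1 η := by fun_prop
  -- The competitor is the pullback of the straight segment; its chart velocity is constantly `w₀`.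
  let γ : ℝ → M := fun t ↦ (extChartAt I x).symm (η t)
  have hγC : ContMDiffOn 𝓘(ℝ, ℝ) I 1 γ (Icc 0 1) :=
    (contMDiffOn_extChartAt_symm x).comp (contMDiff_iff_contDiff.2 hηC).contMDiffOn
      fun t ht ↦ hst (hηs t ht)
  have h0 : γ 0 = u := by
    simp only [γ, η, zero_smul, add_zero]
    exact (extChartAt I x).left_inv (by simpa using hu)
  have h1 : γ 1 = v := by
    simp only [γ, η, one_smul, hw₀, add_sub_cancel]
    exact (extChartAt I x).left_inv (by simpa using hv)
  have hlen : glength g.toRiemannianMetric γ 0 1 ≤ ENNReal.ofReal √((1 + κ) * B w₀ w₀) := by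
    have : ∀ t ∈ Icc (0 : ℝ) 1, ENNReal.ofReal (speed g.toRiemannianMetric γ t) ≤
        ENNReal.ofReal √((1 + κ) * B w₀ w₀) := by
      intro t ht
      refine ENNReal.ofReal_le_ofReal (Real.sqrt_le_sqrt ?_)
      have htt : η t ∈ (extChartAt I x).target := hst (hηs t ht)
      have hsrc : γ t ∈ (chartAt H x).source := by
        have := (extChartAt I x).map_target htt
        rwa [extChartAt_source] at this
      have hφ : extChartAt I x (γ t) = η t := (extChartAt I x).right_inv htt
      have hmd : MDifferentiableAt 𝓘(ℝ, ℝ) I γ t := by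
        have h2 : ContMDiffAt 𝓘(ℝ, E) I 1 (extChartAt I x).symm (η t) :=
          (contMDiffOn_extChartAt_symm x).contMDiffAt
            ((isOpen_extChartAt_target x).mem_nhds htt)
        exact (h2.mdifferentiableAt one_ne_zero).comp t
          ((contMDiff_iff_contDiff.2 hηC).mdifferentiableAt one_ne_zero)
      have hd := hasDerivAt_extChartAt_comp hmd hsrc rfl
      have hd' : HasDerivAt (fun s ↦ extChartAt I x (γ s)) w₀ t := by
        refine (hηd t).congr_of_eventuallyEq ?_
        have : ∀ᶠ τ in 𝓝 t, η τ ∈ (extChartAt I x).target :=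
          hηC.continuous.continuousAt ((isOpen_extChartAt_target x).mem_nhds htt)
        filter_upwards [this] with τ hτ using (extChartAt I x).right_inv hτ
      have := hB (γ t) hsrc (by rw [hφ]; exact hηs t ht) (mfderiv 𝓘(ℝ, ℝ) I γ t (1 : ℝ)) w₀
        (hd'.unique hd)
      exact this
    calc _ ≤ ∫⁻ t in Icc (0 : ℝ) 1, ENNReal.ofReal √((1 + κ) * B w₀ w₀) :=
          setLIntegral_mono' measurableSet_Icc this
      _ = _ := by simp
  have h2 := (redist_le_glength g.toRiemannianMetric hγC zero_le_one).trans hlen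
  rw [h0, h1] at h2
  have h3 : rdist g.toRiemannianMetric u v ≤ √((1 + κ) * B w₀ w₀) :=
    ENNReal.toReal_le_of_le_ofReal (Real.sqrt_nonneg _) h2
  calc _ ≤ √((1 + κ) * B w₀ w₀) ^ 2 := pow_le_pow_left₀ (rdist_nonneg _ _ _) h3 2
    _ = _ := Real.sq_sqrt (by positivity)

end Chart

/-! ### The squared distance is close to a constant quadratic form in a chart. -/

section Compare

variable {E : Type*} [NormedAddCommGroup E] [NormedSpace ℝ E] [FiniteDimensional ℝ E]
  {H : Type*} [TopologicalSpace H] {I : ModelWithCorners ℝ E H} [I.Boundaryless]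
  {M : Type*} [TopologicalSpace M] [T2Space M] [ConnectedSpace M] [ChartedSpace H M]
  [IsManifold I ∞ M]
  (g : ContMDiffRiemannianMetric I ∞ E (fun x : M ↦ TangentSpace I x))

/-- The infimum defining the distance need not be known to be attained: one works with paths of
length below `r > d` and lets `r` decrease to `d`. -/
theorem le_sq_of_forall_lt {a d c : ℝ} (hc : d < c)
    (h : ∀ r, d < r → r < c → a ≤ r ^ 2) : a ≤ d ^ 2 := by
  have ht : Tendsto (fun r : ℝ ↦ r ^ 2) (𝓝[>] d) (𝓝 (d ^ 2)) :=
    ((continuous_pow 2).tendsto d).mono_left nhdsWithin_le_nhds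
  refine ge_of_tendsto ht ?_
  filter_upwards [Ioo_mem_nhdsGT hc] with r hr using h r hr.1 hr.2

/-- In the chart at `x`, the squared Riemannian distance of two points differs from the squared norm
for the metric at `x` by a relative error controlled by the distance of the points to `x`. -/
theorem exists_rdist_chart_compare (x : M) :
    ∃ B : E →L[ℝ] E →L[ℝ] ℝ, (∀ v w, B v w = B w v) ∧ (∀ v, v ≠ 0 → 0 < B v v) ∧
      ∃ C > 0, ∃ s ∈ 𝓝 x, ∀ u ∈ s, ∀ v ∈ s,
        |rdist g.toRiemannianMetric u v ^ 2 -
            B (extChartAt I x v - extChartAt I x u) (extChartAt I x v - extChartAt I x u)| ≤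
          C * (‖extChartAt I x u - extChartAt I x x‖ + ‖extChartAt I x v - extChartAt I x x‖) *
            B (extChartAt I x v - extChartAt I x u) (extChartAt I x v - extChartAt I x u) := by
  have : LocallyCompactSpace M := Manifold.locallyCompact_of_finiteDimensional I
  obtain ⟨B, hsymm, hpos, C, hC, hBC⟩ := exists_bilin_chart g x
  obtain ⟨b, hb, hbB⟩ := exists_coercive hpos
  refine ⟨B, hsymm, hpos, ?_⟩
  set φ := extChartAt I x with hφ
  set q : E → ℝ := fun v ↦ B v v with hqdef
  have hq : ∀ v, 0 ≤ q v := bilin_nonneg hpos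
  have hqle : ∀ v, q v ≤ ‖B‖ * ‖v‖ ^ 2 := bilin_le_opNorm
  set K := C / b with hK
  have hK0 : 0 < K := div_pos hC hb
  have hcont : ContinuousAt (fun z ↦ ‖φ z - φ x‖) x :=
    ((continuousAt_extChartAt x).sub continuousAt_const).norm
  -- a neighborhood where the metric is close to the constant one
  have hs₀ : {z | z ∈ (chartAt H x).source ∧ K * ‖φ z - φ x‖ ≤ 1 / 2 ∧
      ∀ (w : TangentSpace I z) (e : E), e = mfderiv I 𝓘(ℝ, E) φ z w →
        |g.inner z w w - q e| ≤ K * ‖φ z - φ x‖ * q e} ∈ 𝓝 x := by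
    have h1 : ∀ᶠ z in 𝓝 x, K * ‖φ z - φ x‖ < 1 / 2 := by
      have := (continuousAt_const (y := K)).mul hcont
      refine this.eventually (Iio_mem_nhds ?_)
      simp
    filter_upwards [chart_source_mem_nhds H x, h1, hBC] with z hz hz1 hz2
    refine ⟨hz, hz1.le, fun w e he ↦ (hz2 w e he).trans ?_⟩
    rw [hK, div_mul_eq_mul_div, div_mul_eq_mul_div, le_div_iff₀ hb]
    calc C * ‖φ z - φ x‖ * ‖e‖ ^ 2 * b = C * ‖φ z - φ x‖ * (b * ‖e‖ ^ 2) := by ring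
      _ ≤ _ := by gcongr; exact hbB e
  set s₀ := {z | z ∈ (chartAt H x).source ∧ K * ‖φ z - φ x‖ ≤ 1 / 2 ∧
      ∀ (w : TangentSpace I z) (e : E), e = mfderiv I 𝓘(ℝ, E) φ z w →
        |g.inner z w w - q e| ≤ K * ‖φ z - φ x‖ * q e} with hs₀def
  -- Two notions of smallness are needed: a metric ball of radius `c₁` to trap almost minimizing
  -- paths, and a chart ball of radius `r₁` to contain straight segments.
  obtain ⟨c₁, hc₁, hball⟩ := exists_rdist_lt_subset g hs₀
  obtain ⟨r₁, hr₁, hr₁s⟩ : ∃ r > 0, Metric.ball (φ x) r ⊆ φ.target ∩ φ.symm ⁻¹' s₀ := by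
    refine Metric.mem_nhds_iff.1 (inter_mem (extChartAt_target_mem_nhds x) ?_)
    exact extChartAt_preimage_mem_nhds hs₀
  have hr₁t : Metric.ball (φ x) r₁ ⊆ φ.target := fun z hz ↦ (hr₁s hz).1
  have hmem : ∀ z ∈ (chartAt H x).source, φ z ∈ Metric.ball (φ x) r₁ → z ∈ s₀ := by
    intro z hz hz'
    have := (hr₁s hz').2
    rwa [mem_preimage, hφ, (extChartAt I x).left_inv (by simpa using hz)] at this
  -- upper bound
  have hupper : ∀ R < r₁, ∀ u ∈ s₀, ∀ v ∈ s₀, ‖φ u - φ x‖ ≤ R → ‖φ v - φ x‖ ≤ R →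
      rdist g.toRiemannianMetric u v ^ 2 ≤ (1 + K * R) * q (φ v - φ u) := by
    intro R hR u hu v hv hu' hv'
    have hR0 : 0 ≤ R := (norm_nonneg _).trans hu'
    refine rdist_sq_le_bilin g hpos (by positivity) (convex_closedBall (φ x) R)
      ((Metric.closedBall_subset_ball hR).trans hr₁t) ?_ hu.1 hv.1
      (mem_closedBall_iff_norm.2 hu') (mem_closedBall_iff_norm.2 hv')
    intro z hz hzR w e he
    have h1 := (hmem z hz (Metric.closedBall_subset_ball hR hzR)).2.2 w e he
    have h2 : ‖φ z - φ x‖ ≤ R := by rwa [← dist_eq_norm]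
    have h3 : K * ‖φ z - φ x‖ * q e ≤ K * R * q e := by
      gcongr; exact hq e
    have h4 := (abs_le.1 h1).2
    have : g.inner z w w ≤ (1 + K * R) * q e := by linarith
    exact this
  -- a path all of whose points are close to `x`
  have hpath : ∀ u v : M, ∀ r ρ : ℝ, rdist g.toRiemannianMetric u v < r →
      rdist g.toRiemannianMetric x u + r ≤ ρ → ∃ γ : ℝ → M, γ 0 = u ∧ γ 1 = v ∧
        ContMDiff 𝓘(ℝ, ℝ) I 1 γ ∧ glength g.toRiemannianMetric γ 0 1 ≤ ENNReal.ofReal r ∧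
        ∀ t ∈ Icc (0 : ℝ) 1, rdist g.toRiemannianMetric x (γ t) ≤ ρ := by
    intro u v r ρ hr hρ
    have hr0 : 0 < r := (rdist_nonneg _ _ _).trans_lt hr
    have h1 : redist g.toRiemannianMetric u v < ENNReal.ofReal r := by
      rw [← ofReal_rdist]
      exact (ENNReal.ofReal_lt_ofReal_iff hr0).2 hr
    obtain ⟨γ, h0, h1, hγ, hlen⟩ := exists_glength_lt _ h1
    refine ⟨γ, h0, h1, hγ, hlen.le, fun t ht ↦ ?_⟩
    have h2 : redist g.toRiemannianMetric u (γ t) ≤ ENNReal.ofReal r := by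
      rw [← h0]
      exact ((redist_le_glength _ hγ.contMDiffOn ht.1).trans (glength_mono _ le_rfl ht.2)).trans
        hlen.le
    have h3 : rdist g.toRiemannianMetric u (γ t) ≤ r := ENNReal.toReal_le_of_le_ofReal hr0.le h2
    linarith [rdist_triangle g x u (γ t)]
  -- lower bound along paths staying close to `x`
  have hlow : ∀ (γ : ℝ → M), ContMDiff 𝓘(ℝ, ℝ) I 1 γ → ∀ R r : ℝ, K * R < 1 → 0 ≤ r →
      (∀ t ∈ Icc (0 : ℝ) 1, γ t ∈ s₀ ∧ K * ‖φ (γ t) - φ x‖ ≤ K * R) →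
      glength g.toRiemannianMetric γ 0 1 ≤ ENNReal.ofReal r →
      (1 - K * R) * q (φ (γ 1) - φ (γ 0)) ≤ r ^ 2 := by
    intro γ hγ R r hR hr hs hlen
    refine bilin_le_of_glength_le g hsymm hpos hR hγ (fun t ht ↦ (hs t ht).1.1) ?_ hr hlen
    intro t ht w e he
    have h1 := (hs t ht).1.2.2 w e he
    have h3 : K * ‖φ (γ t) - φ x‖ * q e ≤ K * R * q e :=
      mul_le_mul_of_nonneg_right (hs t ht).2 (hq e)
    have h4 := (abs_le.1 h1).1
    have : (1 - K * R) * q e ≤ g.inner (γ t) w w := by linarith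
    exact this
  -- coarse lower bound
  have hcoarse : ∀ z, rdist g.toRiemannianMetric x z < c₁ →
      b * ‖φ z - φ x‖ ^ 2 ≤ 2 * rdist g.toRiemannianMetric x z ^ 2 := by
    intro z hz
    suffices h : (1 / 2) * q (φ z - φ x) ≤ rdist g.toRiemannianMetric x z ^ 2 by
      linarith [hbB (φ z - φ x)]
    refine le_sq_of_forall_lt hz fun r hr hrc ↦ ?_
    obtain ⟨γ, h0, h1, hγ, hlen, hγx⟩ := hpath x z r r hr (by simp [rdist_self])
    have hr0 : 0 ≤ r := (rdist_nonneg _ _ _).trans hr.le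
    -- With this radius the relative error is `1 / 2`, the bound built into `s₀`. No smaller one is
    -- available before the chart norm along the path is controlled.
    have h2 := hlow γ hγ (1 / (2 * K)) r (by field_simp; norm_num) hr0 (fun t ht ↦ by
      have h3 := hball _ ((hγx t ht).trans_lt hrc)
      refine ⟨h3, h3.2.1.trans (by field_simp; norm_num)⟩) hlen
    rw [h0, h1] at h2
    have : K * (1 / (2 * K)) = 1 / 2 := by field_simp
    rw [this] at h2
    linarith
  -- conclusion
  set A := √(2 * ‖B‖) with hA
  -- Points of chart norm at most `R` are within `A * R` of `x`. A path from `u` to `v` of length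
  -- below `d(u, v) + R` thus stays within `(3 * A + 1) * R` of `x`, which the coarse bound converts
  -- into chart norm at most `D * R`.
  set D := √(2 / b) * (3 * A + 1) with hD
  have hA0 : 0 ≤ A := Real.sqrt_nonneg _
  have hD0 : 0 ≤ D := by positivity
  have hsmall : ∀ᶠ z in 𝓝 x, 2 * ‖φ z - φ x‖ < min r₁ 1 ∧
      2 * ((3 * A + 1) * ‖φ z - φ x‖) < c₁ ∧ 2 * (K * (D * ‖φ z - φ x‖)) < 1 := by
    have key : ∀ (a c : ℝ), 0 < c → ∀ᶠ z in 𝓝 x, a * ‖φ z - φ x‖ < c := fun a c hc ↦ by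
      have := (continuousAt_const (y := a)).mul hcont
      refine this.eventually (Iio_mem_nhds ?_)
      simpa using hc
    filter_upwards [key 2 (min r₁ 1) (lt_min hr₁ one_pos), key (2 * (3 * A + 1)) c₁ hc₁,
      key (2 * (K * D)) 1 one_pos] with z h1 h2 h3
    refine ⟨h1, by linarith, by linarith⟩
  refine ⟨K * (1 + D), by positivity, _, inter_mem hs₀ hsmall, ?_⟩
  rintro u ⟨hu, hu1, hu2, hu3⟩ v ⟨hv, hv1, hv2, hv3⟩
  set R := ‖φ u - φ x‖ + ‖φ v - φ x‖ with hR
  have hRu : ‖φ u - φ x‖ ≤ R := le_add_of_nonneg_right (norm_nonneg _)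
  have hRv : ‖φ v - φ x‖ ≤ R := le_add_of_nonneg_left (norm_nonneg _)
  have hR0 : 0 ≤ R := (norm_nonneg _).trans hRu
  have hRr : R < r₁ := by
    have := min_le_left r₁ 1
    linarith
  have hKR : K * R ≤ 1 := by
    have h1 := hu.2.1
    have h2 := hv.2.1
    rw [hR, mul_add]; linarith
  have hx : x ∈ s₀ := mem_of_mem_nhds hs₀
  have hup := hupper R hRr u hu v hv hRu hRv
  rw [abs_le]
  have hqn := hq (φ v - φ u)
  refine ⟨?_, ?_⟩
  swap
  · have : 0 ≤ K * D * R * q (φ v - φ u) := by positivity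
    change _ - q (φ v - φ u) ≤ K * (1 + D) * R * q (φ v - φ u)
    linarith
  -- lower bound
  have hdx : ∀ z ∈ s₀, ‖φ z - φ x‖ ≤ R → rdist g.toRiemannianMetric x z ≤ A * R := by
    intro z hz hzR
    have h1 := hupper R hRr x hx z hz (by simpa using hR0) hzR
    refine le_of_sq_le_sq ?_ (by positivity)
    calc _ ≤ (1 + K * R) * q (φ z - φ x) := h1
      _ ≤ 2 * (‖B‖ * R ^ 2) := by
        have := hqle (φ z - φ x)
        have h5 : ‖B‖ * ‖φ z - φ x‖ ^ 2 ≤ ‖B‖ * R ^ 2 := by gcongr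
        have h6 : K * R * q (φ z - φ x) ≤ 1 * q (φ z - φ x) :=
          mul_le_mul_of_nonneg_right hKR (hq _)
        linarith
      _ = (A * R) ^ 2 := by
        rw [mul_pow, hA, Real.sq_sqrt (by positivity)]; ring
  -- For `R = 0` the window `d < r < d + R` used below is empty, but then both points have the chart
  -- coordinate of `x` and the form vanishes.
  rcases hR0.eq_or_lt with hR00 | hRpos
  · have h1 : φ u - φ x = 0 := norm_le_zero_iff.1 (hRu.trans hR00.ge)
    have h2 : φ v - φ x = 0 := norm_le_zero_iff.1 (hRv.trans hR00.ge)
    have h3 : φ v - φ u = 0 := by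
      rw [← sub_sub_sub_cancel_right (φ v) (φ u) (φ x), h1, h2, sub_zero]
    rw [← hR00, h3]
    simp [sq_nonneg]
  suffices h : (1 - K * (D * R)) * q (φ v - φ u) ≤ rdist g.toRiemannianMetric u v ^ 2 by
    have : 0 ≤ K * R * q (φ v - φ u) := by positivity
    change -(K * (1 + D) * R * q (φ v - φ u)) ≤ _ - q (φ v - φ u)
    linarith
  have hduv : rdist g.toRiemannianMetric u v ≤ 2 * A * R := by
    have h1 := rdist_triangle g u x v
    rw [rdist_comm _ u x] at h1
    linarith [hdx u hu hRu, hdx v hv hRv]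
  refine le_sq_of_forall_lt
    (lt_add_of_pos_right (rdist g.toRiemannianMetric u v) hRpos) fun r hr hrc ↦ ?_
  have hr0 : 0 ≤ r := (rdist_nonneg _ _ _).trans hr.le
  obtain ⟨γ, h0, h1, hγ, hlen, hγx⟩ := hpath u v r ((3 * A + 1) * R) hr (by
    linarith [hdx u hu hRu])
  have hc : (3 * A + 1) * R < c₁ := by rw [hR, mul_add]; linarith
  have hKD : K * (D * R) < 1 := by rw [hR, mul_add, mul_add]; linarith
  have h2 := hlow γ hγ (D * R) r hKD hr0 (fun t ht ↦ by
    have h3 : rdist g.toRiemannianMetric x (γ t) < c₁ := (hγx t ht).trans_lt hc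
    refine ⟨hball _ h3, mul_le_mul_of_nonneg_left ?_ hK0.le⟩
    have h4 := hcoarse _ h3
    refine le_of_sq_le_sq ?_ (by positivity)
    have h5 : rdist g.toRiemannianMetric x (γ t) ^ 2 ≤ ((3 * A + 1) * R) ^ 2 :=
      pow_le_pow_left₀ (rdist_nonneg _ _ _) (hγx t ht) 2
    rw [hD, mul_assoc, mul_pow, Real.sq_sqrt (by positivity), div_mul_eq_mul_div, le_div_iff₀ hb]
    linarith) hlen
  rwa [h0, h1] at h2

end Compare

/-! ### A Euclidean differentiability criterion for squared distances. -/

section Differentiability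

variable {E : Type*} [NormedAddCommGroup E] [NormedSpace ℝ E] {B : E →L[ℝ] E →L[ℝ] ℝ}

theorem bilin_add_self (hsymm : ∀ v w, B v w = B w v) (a b : E) :
    B (a + b) (a + b) = B a a + 2 * B a b + B b b := by
  simp only [map_add, add_apply]
  rw [hsymm b a]; ring

theorem bilin_sub_self (hsymm : ∀ v w, B v w = B w v) (a b : E) :
    B (a - b) (a - b) = B a a - 2 * B a b + B b b := by
  simp only [map_sub, sub_apply]
  rw [hsymm b a]; ring

/-- The midpoint of an almost minimizing pair of segments is almost the Euclidean midpoint. -/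
theorem bilin_sub_le_of_almost_midpoint (hsymm : ∀ v w, B v w = B w v)
    (hpos : ∀ v, v ≠ 0 → 0 < B v v) {a b : E} {κ d : ℝ} (hκ : κ ≤ 1 / 2) (hκ0 : 0 ≤ κ)
    (ha : |d - B a a| ≤ κ * B a a) (hb : |d - B b b| ≤ κ * B b b)
    (hab : |4 * d - B (a + b) (a + b)| ≤ κ * B (a + b) (a + b)) :
    B (b - a) (b - a) ≤ 12 * κ * d := by
  have qa := bilin_nonneg hpos a
  have qb := bilin_nonneg hpos b
  have qab := bilin_nonneg hpos (a + b)
  rw [bilin_sub_self hsymm, hsymm b a]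
  rw [bilin_add_self hsymm] at hab qab
  have h1 := (abs_le.1 ha).1
  have h2 := (abs_le.1 hb).1
  have h3 := (abs_le.1 hab).2
  -- The parallelogram law writes the left side as `2 B a a + 2 B b b - B (a + b) (a + b)`. The
  -- bounds `h4`, `h5` and `h6` then give `4 (1 + 2κ) d - 4 (1 - κ) d = 12 κ d`.
  have h4 : B a a ≤ (1 + 2 * κ) * d := by
    nlinarith [mul_nonneg (mul_nonneg hκ0 (by linarith : 0 ≤ 1 - 2 * κ)) qa,
      mul_le_mul_of_nonneg_left h1 (by linarith : 0 ≤ 1 + 2 * κ)]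
  have h5 : B b b ≤ (1 + 2 * κ) * d := by
    nlinarith [mul_nonneg (mul_nonneg hκ0 (by linarith : 0 ≤ 1 - 2 * κ)) qb,
      mul_le_mul_of_nonneg_left h2 (by linarith : 0 ≤ 1 + 2 * κ)]
  have h6 : (1 - κ) * (4 * d) ≤ B a a + 2 * B a b + B b b := by
    nlinarith [mul_nonneg (mul_nonneg hκ0 hκ0) qab,
      mul_le_mul_of_nonneg_left h3 (by linarith : 0 ≤ 1 - κ)]
  linarith

/-- A function `F`, to be thought of as the squared distance to a point `y`, is differentiable at
`x₀` if the squared distance `d2` is close to a constant metric near `x₀`, and if the points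
`P u k` at time `s k = s₀ / 2 ^ k` of minimizing curves from `u` to `y` depend continuously on `u`
at `x₀`. -/
theorem differentiableAt_of_minimizers [FiniteDimensional ℝ E]
    (hsymm : ∀ v w, B v w = B w v) (hpos : ∀ v, v ≠ 0 → 0 < B v v)
    {x₀ : E} {F : E → ℝ} {d2 : E → E → ℝ} {P : E → ℕ → E} {s : ℕ → ℝ} {s₀ C C' D : ℝ} {S S' : Set E}
    (hs₀ : 0 < s₀) (hs : ∀ k, s k = s₀ * (1 / 2) ^ k) (hC : 0 ≤ C) (hC' : 0 ≤ C')
    (hS' : S' ∈ 𝓝 x₀) (hSS' : S' ⊆ S)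
    (hd2 : ∀ u ∈ S, ∀ v ∈ S,
      |d2 u v - B (v - u) (v - u)| ≤ C * (‖u - x₀‖ + ‖v - x₀‖) * B (v - u) (v - u))
    (hPS : ∀ u ∈ S', ∀ k, P u k ∈ S)
    (hP : ∀ u ∈ S', ∀ k, ‖P u k - x₀‖ ≤ C' * (‖u - x₀‖ + s k))
    (hF0 : ∀ u ∈ S', 0 ≤ F u) (hFD : ∀ u ∈ S', F u ≤ D)
    (hd0 : ∀ u ∈ S', ∀ k, d2 u (P u k) = s k ^ 2 * F u)
    (hd1 : ∀ u ∈ S', ∀ k, d2 (P u (k + 1)) (P u k) = s (k + 1) ^ 2 * F u)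
    (hF : ∀ u ∈ S', ∀ z ∈ S', ∀ k, F z ≤ d2 z (P u k) / s k + (1 - s k) * F u)
    (hcont : ∀ k, Tendsto (fun u ↦ P u k) (𝓝 x₀) (𝓝 (P x₀ k))) :
    DifferentiableAt ℝ F x₀ := by
  have : ProperSpace E := FiniteDimensional.proper ℝ E
  obtain ⟨b, hb, hbB⟩ := exists_coercive hpos
  have hx₀ : x₀ ∈ S' := mem_of_mem_nhds hS'
  have hD : 0 ≤ D := (hF0 x₀ hx₀).trans (hFD x₀ hx₀)
  have hspos : ∀ k, 0 < s k := fun k ↦ by rw [hs]; positivity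
  have hs_succ : ∀ k, s k = 2 * s (k + 1) := fun k ↦ by rw [hs, hs, pow_succ]; ring
  have hs_tendsto : Tendsto s atTop (𝓝 0) := by
    have h1 : Tendsto (fun k : ℕ ↦ s₀ * (1 / 2 : ℝ) ^ k) atTop (𝓝 (s₀ * 0)) :=
      (tendsto_pow_atTop_nhds_zero_of_lt_one (by norm_num) (by norm_num)).const_mul s₀
    rw [mul_zero] at h1
    exact h1.congr fun k ↦ (hs k).symm
  have hs_anti : Antitone s := antitone_nat_of_succ_le fun k ↦ by
    rw [hs_succ k]; linarith [hspos (k + 1)]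
  -- The mean velocity in the chart of the minimizing curve over `[0, s k]`. Its limit `ws` at `x₀`
  -- gives the derivative `-2 B ws`.
  let w : E → ℕ → E := fun u k ↦ (s k)⁻¹ • (P u k - u)
  have hw : ∀ u k, P u k = u + s k • w u k := fun u k ↦ by
    simp only [w, smul_smul, mul_inv_cancel₀ (hspos k).ne', one_smul, add_sub_cancel]
  -- bound on the relative error at scale `s k`
  set C₂ := C * (4 * C' + 2) with hC₂
  have hC₂0 : 0 ≤ C₂ := by positivity
  obtain ⟨k₁, hk₁⟩ : ∃ k₁, ∀ k ≥ k₁, C₂ * s k ≤ 1 / 2 := by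
    have h1 : Tendsto (fun k ↦ C₂ * s k) atTop (𝓝 (C₂ * 0)) := hs_tendsto.const_mul _
    rw [mul_zero] at h1
    exact eventually_atTop.1 (h1.eventually (Iic_mem_nhds (by norm_num)))
  have hclose : ∀ u ∈ S', ∀ k, ‖u - x₀‖ ≤ s k → ‖P u k - x₀‖ ≤ 2 * C' * s k := fun u hu k hk ↦ by
    refine (hP u hu k).trans ?_
    have : C' * (‖u - x₀‖ + s k) ≤ C' * (s k + s k) := by gcongr
    linarith
  have herr : ∀ k, ∀ u ∈ S, ∀ v ∈ S, ‖u - x₀‖ ≤ (2 * C' + 1) * s k →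
      ‖v - x₀‖ ≤ (2 * C' + 1) * s k →
      |d2 u v - B (v - u) (v - u)| ≤ C₂ * s k * B (v - u) (v - u) := by
    intro k u hu v hv hu' hv'
    refine (hd2 u hu v hv).trans (mul_le_mul_of_nonneg_right ?_ (bilin_nonneg hpos _))
    calc C * (‖u - x₀‖ + ‖v - x₀‖) ≤ C * ((2 * C' + 1) * s k + (2 * C' + 1) * s k) := by gcongr
      _ = _ := by rw [hC₂]; ring
  -- consecutive directions are close
  set θ := √(1 / 2 : ℝ) with hθ
  have hθ0 : 0 < θ := by positivity
  have hθ1 : θ < 1 := by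
    rw [hθ, Real.sqrt_lt' one_pos]; norm_num
  have hθsq : θ ^ 2 = 1 / 2 := Real.sq_sqrt (by norm_num)
  -- Dividing the midpoint bound `12 (C₂ s_k) (s_{k+1}² D)` by `b s_k²` leaves `3 C₂ s_k D / b = A²
  -- / 2 ^ k`. Hence the ratio `θ = √(1 / 2)` and the summability of the steps.
  set A := √(3 * C₂ * s₀ * D / b) with hA
  have hA0 : 0 ≤ A := Real.sqrt_nonneg _
  have hstep : ∀ u ∈ S', ∀ k ≥ k₁, ‖u - x₀‖ ≤ s (k + 1) → ‖w u k - w u (k + 1)‖ ≤ A * θ ^ k := by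
    intro u hu k hk huk
    have huk' : ‖u - x₀‖ ≤ s k := huk.trans (hs_anti (Nat.le_succ k))
    have hPk : ‖P u k - x₀‖ ≤ (2 * C' + 1) * s k := by
      linarith [hclose u hu k huk', hspos k]
    have hPk1 : ‖P u (k + 1) - x₀‖ ≤ (2 * C' + 1) * s k := by
      have h1 := hclose u hu (k + 1) huk
      have h2 := hs_succ k
      have h3 : 0 ≤ C' * s (k + 1) := mul_nonneg hC' (hspos _).le
      rw [h2]; nlinarith [hspos (k + 1)]
    have hu' : ‖u - x₀‖ ≤ (2 * C' + 1) * s k := by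
      have : 0 ≤ C' * s k := mul_nonneg hC' (hspos _).le
      linarith
    have huS := hSS' hu
    have e1 := herr k u huS (P u (k + 1)) (hPS u hu _) hu' hPk1
    have e2 := herr k (P u (k + 1)) (hPS u hu _) (P u k) (hPS u hu _) hPk1 hPk
    have e3 := herr k u huS (P u k) (hPS u hu _) hu' hPk
    rw [hd0 u hu] at e1 e3
    rw [hd1 u hu] at e2
    -- `P u (k + 1)` is a metric midpoint of `u` and `P u k`, because the times halve. All three
    -- points lie at scale `s k` from `x₀`, where the distance is almost Euclidean.
    have hadd : P u k - u = (P u (k + 1) - u) + (P u k - P u (k + 1)) := by abel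
    have h4 : s k ^ 2 * F u = 4 * (s (k + 1) ^ 2 * F u) := by rw [hs_succ k]; ring
    rw [h4, hadd] at e3
    have h5 := bilin_sub_le_of_almost_midpoint hsymm hpos (hk₁ k hk)
      (mul_nonneg hC₂0 (hspos k).le) e1 e2 e3
    have h6 : w u k - w u (k + 1) =
        (s k)⁻¹ • ((P u k - P u (k + 1)) - (P u (k + 1) - u)) := by
      simp only [w]
      have : (s (k + 1))⁻¹ = (s k)⁻¹ * 2 := by
        rw [hs_succ k]; have := (hspos (k + 1)).ne'; field_simp
      rw [this, ← smul_smul, ← smul_sub]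
      congr 1
      rw [two_smul]; abel
    have h7 : ‖w u k - w u (k + 1)‖ ^ 2 ≤ (A * θ ^ k) ^ 2 := by
      have hsk := hspos k
      rw [mul_pow, hA, Real.sq_sqrt (by positivity), ← pow_mul, mul_comm k 2, pow_mul, hθsq,
        div_mul_eq_mul_div, le_div_iff₀ hb, h6, norm_smul, mul_pow, norm_inv, inv_pow,
        Real.norm_of_nonneg hsk.le, mul_comm, ← mul_assoc, mul_comm b, mul_assoc]
      rw [inv_mul_le_iff₀ (by positivity)]
      refine (hbB _).trans (h5.trans ?_)
      have h8 : C₂ * s k * (s (k + 1) ^ 2 * F u) ≤ C₂ * s k * (s (k + 1) ^ 2 * D) := by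
        gcongr; exact hFD u hu
      have h9 : s₀ * (1 / 2) ^ k = s k := (hs k).symm
      calc 12 * (C₂ * s k) * (s (k + 1) ^ 2 * F u)
          = 12 * (C₂ * s k * (s (k + 1) ^ 2 * F u)) := by ring
        _ ≤ 12 * (C₂ * s k * (s (k + 1) ^ 2 * D)) := by linarith
        _ = (2 * s (k + 1)) ^ 2 * (3 * C₂ * s k * D) := by ring
        _ = s k ^ 2 * (3 * C₂ * (s₀ * (1 / 2) ^ k) * D) := by rw [← hs_succ, h9]
        _ = _ := by ring
    exact le_of_sq_le_sq h7 (by positivity)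
  set A' := A / (1 - θ) with hA'
  have hθ1' : 0 < 1 - θ := by linarith
  have hA'0 : 0 ≤ A' := by positivity
  have hsum : ∀ u ∈ S', ∀ j ≥ k₁, ∀ k ≥ j, ‖u - x₀‖ ≤ s k →
      ‖w u j - w u k‖ ≤ A' * (θ ^ j - θ ^ k) := by
    intro u hu j hj k hk
    induction k, hk using Nat.le_induction with
    | base => intro; simp
    | succ k hk ih =>
      intro huk
      have h1 := ih (huk.trans (hs_anti (Nat.le_succ k)))
      have h2 := hstep u hu k (hj.trans hk) huk
      -- The geometric term is written as a difference so that the sum telescopes.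
      have h3 : A * θ ^ k = A' * (θ ^ k - θ ^ (k + 1)) := by
        rw [hA', pow_succ]; field_simp
      calc ‖w u j - w u (k + 1)‖ = ‖(w u j - w u k) + (w u k - w u (k + 1))‖ := by
            rw [sub_add_sub_cancel]
        _ ≤ _ := norm_add_le _ _
        _ ≤ _ := add_le_add h1 (h2.trans_eq h3)
        _ = _ := by ring
  have hsum' : ∀ u ∈ S', ∀ j ≥ k₁, ∀ k ≥ j, ‖u - x₀‖ ≤ s k → ‖w u j - w u k‖ ≤ A' * θ ^ j :=
    fun u hu j hj k hk huk ↦ (hsum u hu j hj k hk huk).trans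
      (mul_le_mul_of_nonneg_left (sub_le_self _ (by positivity)) hA'0)
  have hθlim : Tendsto (fun j : ℕ ↦ A' * θ ^ j) atTop (𝓝 0) := by
    simpa using (tendsto_pow_atTop_nhds_zero_of_lt_one hθ0.le hθ1).const_mul A'
  -- the limit direction
  obtain ⟨ws, hws⟩ : ∃ ws, ∀ j ≥ k₁, ‖w x₀ j - ws‖ ≤ A' * θ ^ j := by
    have h0 : ∀ k, ‖x₀ - x₀‖ ≤ s k := fun k ↦ by simpa using (hspos k).le
    have hcauchy : CauchySeq fun j ↦ w x₀ (j + k₁) := by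
      refine cauchySeq_of_le_tendsto_0' (fun j ↦ A' * θ ^ (j + k₁)) (fun n m hnm ↦ ?_)
        ((tendsto_add_atTop_iff_nat k₁).2 hθlim)
      rw [dist_eq_norm]
      exact hsum' x₀ hx₀ _ (Nat.le_add_left _ _) _ (by omega) (h0 _)
    obtain ⟨ws, hlim⟩ := cauchySeq_tendsto_of_complete hcauchy
    rw [tendsto_add_atTop_iff_nat (f := fun j ↦ w x₀ j)] at hlim
    refine ⟨ws, fun j hj ↦ ?_⟩
    refine le_of_tendsto ((tendsto_const_nhds.sub hlim).norm) ?_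
    filter_upwards [eventually_ge_atTop j] with k hk using hsum' x₀ hx₀ j hj k hk (h0 _)
  -- one-sided estimates at scale `s k`
  set C₅ := C₂ * (2 * ‖B‖ * (2 * C' + 2) ^ 2) with hC₅
  have hC₅0 : 0 ≤ C₅ := by positivity
  have hone : ∀ u ∈ S', ∀ z ∈ S', ∀ k, ‖u - x₀‖ ≤ s k → ‖z - x₀‖ ≤ s k →
      F z - F u ≤ -(2 * B (w u k) (z - u)) + ‖B‖ * ‖z - u‖ ^ 2 / s k + C₅ * s k ^ 2 := by
    intro u hu z hz k huk hzk
    have hsk := hspos k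
    have hC's : 0 ≤ C' * s k := mul_nonneg hC' hsk.le
    have hPk := hclose u hu k huk
    have hPk' : ‖P u k - x₀‖ ≤ (2 * C' + 1) * s k := by linarith
    have e1 := herr k z (hSS' hz) (P u k) (hPS u hu k) (by linarith) hPk'
    have e2 := herr k u (hSS' hu) (P u k) (hPS u hu k) (by linarith) hPk'
    have hq : ∀ z : E, ‖z - x₀‖ ≤ s k → B (P u k - z) (P u k - z) ≤
        ‖B‖ * (2 * C' + 2) ^ 2 * s k ^ 2 := by
      intro z hz
      have h1 : ‖P u k - z‖ ≤ (2 * C' + 2) * s k := by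
        calc ‖P u k - z‖ = ‖(P u k - x₀) - (z - x₀)‖ := by rw [sub_sub_sub_cancel_right]
          _ ≤ _ := norm_sub_le _ _
          _ ≤ _ := by linarith
      calc _ ≤ ‖B‖ * ‖P u k - z‖ ^ 2 := bilin_le_opNorm _
        _ ≤ ‖B‖ * ((2 * C' + 2) * s k) ^ 2 := by gcongr
        _ = _ := by ring
    rw [hd0 u hu] at e2
    -- First variation: reach the target from `z` through `P u k`, expand the form at `P u k - z`
    -- around `P u k - u`, and divide by `s k`. The two chart errors, at `z` and at `u`, add up to
    -- `C₅ * s k ^ 3`.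
    have h1 := hF u hu z hz k
    have h2 : d2 z (P u k) ≤ B (P u k - z) (P u k - z) +
        C₂ * s k * (‖B‖ * (2 * C' + 2) ^ 2 * s k ^ 2) := by
      have := mul_le_mul_of_nonneg_left (hq z hzk) (mul_nonneg hC₂0 hsk.le)
      linarith [(abs_le.1 e1).2]
    have h3 : B (P u k - u) (P u k - u) ≤ s k ^ 2 * F u +
        C₂ * s k * (‖B‖ * (2 * C' + 2) ^ 2 * s k ^ 2) := by
      have := mul_le_mul_of_nonneg_left (hq u huk) (mul_nonneg hC₂0 hsk.le)
      linarith [(abs_le.1 e2).1]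
    have h4 : B (P u k - z) (P u k - z) = B (P u k - u) (P u k - u) -
        2 * (s k * B (w u k) (z - u)) + B (z - u) (z - u) := by
      have : P u k - z = (P u k - u) - (z - u) := by abel
      rw [this, bilin_sub_self hsymm]
      congr 3
      rw [hw u k, add_sub_cancel_left, map_smul, smul_apply, smul_eq_mul]
    have h5 : B (z - u) (z - u) ≤ ‖B‖ * ‖z - u‖ ^ 2 := bilin_le_opNorm _
    have h6 : d2 z (P u k) ≤ s k ^ 2 * F u - 2 * (s k * B (w u k) (z - u)) + ‖B‖ * ‖z - u‖ ^ 2 +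
        C₅ * s k ^ 3 := by
      rw [hC₅]
      linarith
    have h7 : d2 z (P u k) / s k ≤ s k * F u - 2 * B (w u k) (z - u) +
        ‖B‖ * ‖z - u‖ ^ 2 / s k + C₅ * s k ^ 2 := by
      rw [div_le_iff₀ hsk]
      refine h6.trans (le_of_eq ?_)
      field_simp
    linarith
  -- conclusion
  refine HasFDerivAt.differentiableAt (f' := -(2 : ℝ) • B ws) ?_
  rw [hasFDerivAt_iff_isLittleO, Asymptotics.isLittleO_iff]
  intro ε hε
  set N := ‖B‖ + 1 with hN
  have hN0 : 0 < N := by positivity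
  have hBN : ‖B‖ ≤ N := by linarith
  -- The index `j` controls the directions and `m` the ratio of `s k` to `‖z - x₀‖`. Both are fixed
  -- before `z` approaches `x₀`.
  obtain ⟨j, hj, hjε⟩ : ∃ j ≥ k₁, 2 * N * (2 * (A' * θ ^ j)) ≤ ε / 4 := by
    have h1 : Tendsto (fun j : ℕ ↦ 2 * N * (2 * (A' * θ ^ j))) atTop (𝓝 0) := by
      simpa using (hθlim.const_mul 2).const_mul (2 * N)
    obtain ⟨j, h2, h3⟩ := ((eventually_ge_atTop k₁).and
      (h1.eventually (Iic_mem_nhds (by positivity : (0 : ℝ) < ε / 4)))).exists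
    exact ⟨j, h2, h3⟩
  obtain ⟨m, hm⟩ : ∃ m : ℕ, N * (1 / 2) ^ m ≤ ε / 4 := by
    have h1 : Tendsto (fun j : ℕ ↦ N * (1 / 2 : ℝ) ^ j) atTop (𝓝 0) := by
      simpa using (tendsto_pow_atTop_nhds_zero_of_lt_one (r := (1 / 2 : ℝ)) (by norm_num)
        (by norm_num)).const_mul N
    exact (h1.eventually (Iic_mem_nhds (by positivity : (0 : ℝ) < ε / 4))).exists
  -- Continuity of the minimizers in their starting point is used at the single index `j`; finer
  -- scales are reached by `hsum'`, uniformly in the starting point.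
  have hwcont : Tendsto (fun u ↦ 2 * N * ‖w u j - w x₀ j‖) (𝓝 x₀) (𝓝 0) := by
    have h1 : Tendsto (fun u ↦ w u j) (𝓝 x₀) (𝓝 (w x₀ j)) :=
      ((hcont j).sub tendsto_id).const_smul _
    have h2 := (((h1.sub_const (w x₀ j)).norm).const_mul (2 * N))
    simpa using h2
  have hnorm : Tendsto (fun u : E ↦ ‖u - x₀‖) (𝓝 x₀) (𝓝 0) := by
    simpa using ((tendsto_id (α := E) (x := 𝓝 x₀)).sub_const x₀).norm
  have hC₅lim : Tendsto (fun u ↦ C₅ * 4 ^ (m + 1) * ‖u - x₀‖) (𝓝 x₀) (𝓝 0) := by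
    simpa using hnorm.const_mul (C₅ * 4 ^ (m + 1))
  filter_upwards [hS', hwcont.eventually (Iic_mem_nhds (by positivity : (0 : ℝ) < ε / 4)),
    hC₅lim.eventually (Iic_mem_nhds (by positivity : (0 : ℝ) < ε / 4)),
    hnorm.eventually (Iio_mem_nhds (hspos (j + m)))] with z hz hz1 hz2 hz3
  rcases eq_or_ne z x₀ with rfl | hne
  · simp
  have hh : 0 < ‖z - x₀‖ := norm_pos_iff.2 (sub_ne_zero.2 hne)
  obtain ⟨n, hn1, hn2⟩ : ∃ n, s (n + 1) < ‖z - x₀‖ ∧ ‖z - x₀‖ ≤ s n := by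
    have hz4 : ‖z - x₀‖ ≤ s₀ := by
      have h1 : s (j + m) ≤ s 0 := hs_anti (Nat.zero_le _)
      have h2 : s 0 = s₀ := by rw [hs]; simp
      have h3 : ‖z - x₀‖ < s (j + m) := hz3
      linarith
    obtain ⟨n, h1, h2⟩ := exists_nat_pow_near_of_lt_one (x := ‖z - x₀‖ / s₀) (y := 1 / 2)
      (by positivity) ((div_le_one hs₀).2 hz4) (by norm_num) (by norm_num)
    rw [lt_div_iff₀ hs₀] at h1
    rw [div_le_iff₀ hs₀] at h2
    exact ⟨n, by rw [hs]; linarith, by rw [hs]; linarith⟩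
  have hjn : j + m ≤ n := by
    by_contra! hlt
    have h1 := hs_anti (show n + 1 ≤ j + m by omega)
    have h3 : ‖z - x₀‖ < s (j + m) := hz3
    linarith
  -- At the scale `s k`, roughly `2 ^ m * ‖z - x₀‖`, the quadratic term costs about `2 ^ (-m) * ‖z -
  -- x₀‖`. The chart error is of order `4 ^ m * ‖z - x₀‖ ^ 2`, which is negligible once `m` is
  -- fixed.
  obtain ⟨k, rfl⟩ : ∃ k, n = k + m := ⟨n - m, by omega⟩
  have hjk : j ≤ k := by omega
  have hsm : ∀ i, s (k + i) = s k * (1 / 2) ^ i := fun i ↦ by rw [hs, hs, pow_add]; ring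
  have hzk : ‖z - x₀‖ ≤ s k := hn2.trans (hs_anti (Nat.le_add_right _ _))
  have hx₀k : ‖x₀ - x₀‖ ≤ s k := by simpa using (hspos k).le
  have hsk := hspos k
  have e1 : ‖B‖ * ‖z - x₀‖ ^ 2 / s k ≤ ε / 4 * ‖z - x₀‖ := by
    rw [div_le_iff₀ hsk]
    rw [hsm] at hn2
    calc ‖B‖ * ‖z - x₀‖ ^ 2 ≤ N * ((s k * (1 / 2) ^ m) * ‖z - x₀‖) := by
          rw [pow_two]; gcongr
      _ = (N * (1 / 2) ^ m) * (‖z - x₀‖ * s k) := by ring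
      _ ≤ ε / 4 * (‖z - x₀‖ * s k) := by gcongr
      _ = _ := by ring
  have e2 : C₅ * s k ^ 2 ≤ ε / 4 * ‖z - x₀‖ := by
    have h1 : s k ≤ 2 ^ (m + 1) * ‖z - x₀‖ := by
      rw [add_assoc, hsm, one_div, inv_pow] at hn1
      have h2 : (0 : ℝ) < 2 ^ (m + 1) := by positivity
      have := mul_le_mul_of_nonneg_left hn1.le h2.le
      field_simp at this
      linarith
    calc C₅ * s k ^ 2 ≤ C₅ * (2 ^ (m + 1) * ‖z - x₀‖) ^ 2 := by gcongr
      _ = (C₅ * 4 ^ (m + 1) * ‖z - x₀‖) * ‖z - x₀‖ := by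
        have : (4 : ℝ) ^ (m + 1) = (2 ^ (m + 1)) ^ 2 := by
          rw [← pow_mul, mul_comm, pow_mul]; norm_num
        rw [this]; ring
      _ ≤ _ := by gcongr
  have hdir : ∀ v : E, ‖v - ws‖ ≤ 2 * (A' * θ ^ j) + ‖w z j - w x₀ j‖ →
      |2 * B (v - ws) (z - x₀)| ≤ ε / 2 * ‖z - x₀‖ := by
    intro v hv
    rw [abs_mul, abs_two]
    have h1 : |B (v - ws) (z - x₀)| ≤ ‖B‖ * ‖v - ws‖ * ‖z - x₀‖ := B.le_opNorm₂ _ _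
    have hz1' : 2 * N * ‖w z j - w x₀ j‖ ≤ ε / 4 := hz1
    calc 2 * |B (v - ws) (z - x₀)| ≤ 2 * (N * ‖v - ws‖ * ‖z - x₀‖) := by
          have : ‖B‖ * ‖v - ws‖ * ‖z - x₀‖ ≤ N * ‖v - ws‖ * ‖z - x₀‖ := by gcongr
          linarith
      _ = (2 * N * ‖v - ws‖) * ‖z - x₀‖ := by ring
      _ ≤ (ε / 2) * ‖z - x₀‖ := by
        gcongr
        have := mul_le_mul_of_nonneg_left hv (by positivity : 0 ≤ 2 * N)
        linarith
  have hd1' : ‖w x₀ k - ws‖ ≤ 2 * (A' * θ ^ j) + ‖w z j - w x₀ j‖ := by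
    have h1 := hws k (hj.trans hjk)
    have h2 : A' * θ ^ k ≤ A' * θ ^ j :=
      mul_le_mul_of_nonneg_left (pow_le_pow_of_le_one hθ0.le hθ1.le hjk) hA'0
    have h3 : 0 ≤ A' * θ ^ j := by positivity
    linarith [norm_nonneg (w z j - w x₀ j)]
  have hd2' : ‖w z k - ws‖ ≤ 2 * (A' * θ ^ j) + ‖w z j - w x₀ j‖ := by
    have h1 := hws j hj
    have h2 := hsum' z hz j hj k hjk hzk
    have h3 : w z k - ws = -(w z j - w z k) + (w z j - w x₀ j) + (w x₀ j - ws) := by abel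
    rw [h3]
    have h4 := norm_add_le (-(w z j - w z k) + (w z j - w x₀ j)) (w x₀ j - ws)
    have h5 := norm_add_le (-(w z j - w z k)) (w z j - w x₀ j)
    rw [norm_neg] at h5
    linarith
  -- The upper estimate based at `x₀` and the one based at `z` bound the same increment from above
  -- and from below.
  have f1 := hone x₀ hx₀ z hz k hx₀k hzk
  have f2 := hone z hz x₀ hx₀ k hzk hx₀k
  have g1 := abs_le.1 (hdir _ hd1')
  have g2 := abs_le.1 (hdir _ hd2')
  rw [← neg_sub z x₀, norm_neg, map_neg] at f2
  simp only [map_sub B, sub_apply] at g1 g2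
  rw [Real.norm_eq_abs, abs_le]
  simp only [smul_apply, smul_eq_mul]
  constructor <;> linarith [g1.1, g1.2, g2.1, g2.2]

end Differentiability

/-! ### Continuity of minimizing geodesics and differentiability of `d(·, y)²`. -/

section Geodesic

variable {E : Type*} [NormedAddCommGroup E] [NormedSpace ℝ E] [FiniteDimensional ℝ E]
  {H : Type*} [TopologicalSpace H] {I : ModelWithCorners ℝ E H} [I.Boundaryless]
  {M : Type*} [TopologicalSpace M] [T2Space M] [ConnectedSpace M] [ChartedSpace H M]
  [IsManifold I ∞ M]
  {g : ContMDiffRiemannianMetric I ∞ E (fun x : M ↦ TangentSpace I x)}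

variable (g) in
/-- The chart at `x` is bi-Lipschitz at `x`. -/
theorem exists_rdist_bilipschitz (x : M) :
    ∃ C > 0, ∀ᶠ v in 𝓝 x,
      ‖extChartAt I x v - extChartAt I x x‖ ≤ C * rdist g.toRiemannianMetric x v ∧
      rdist g.toRiemannianMetric x v ≤ C * ‖extChartAt I x v - extChartAt I x x‖ := by
  obtain ⟨B, hsymm, hpos, C, hC, s, hs, h⟩ := exists_rdist_chart_compare g x
  obtain ⟨b, hb, hbB⟩ := exists_coercive hpos
  have hsmall : ∀ᶠ v in 𝓝 x, C * ‖extChartAt I x v - extChartAt I x x‖ < 1 / 2 := by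
    have h1 : ContinuousAt (fun v ↦ C * ‖extChartAt I x v - extChartAt I x x‖) x :=
      continuousAt_const.mul ((continuousAt_extChartAt x).sub continuousAt_const).norm
    exact h1.eventually (Iio_mem_nhds (by simp))
  refine ⟨√(2 / b) + √(2 * ‖B‖) + 1, by positivity, ?_⟩
  filter_upwards [hs, hsmall] with v hv hv'
  have h1 := h x (mem_of_mem_nhds hs) v hv
  set q := B (extChartAt I x v - extChartAt I x x) (extChartAt I x v - extChartAt I x x)
  set η := ‖extChartAt I x v - extChartAt I x x‖
  set d := rdist g.toRiemannianMetric x v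
  have hd : 0 ≤ d := rdist_nonneg _ _ _
  have hη : 0 ≤ η := norm_nonneg _
  have hq : 0 ≤ q := bilin_nonneg hpos _
  rw [sub_self, norm_zero, zero_add] at h1
  have h2 : C * η * q ≤ 1 / 2 * q := mul_le_mul_of_nonneg_right hv'.le hq
  have h3 := abs_le.1 h1
  have h4 : b * η ^ 2 ≤ q := hbB _
  have h5 : q ≤ ‖B‖ * η ^ 2 := bilin_le_opNorm _
  have a1 : 0 ≤ √(2 / b) := Real.sqrt_nonneg _
  have a2 : 0 ≤ √(2 * ‖B‖) := Real.sqrt_nonneg _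
  constructor
  · have : η ≤ √(2 / b) * d := by
      refine le_of_sq_le_sq ?_ (by positivity)
      rw [mul_pow, Real.sq_sqrt (by positivity), div_mul_eq_mul_div, le_div_iff₀ hb]
      linarith [h3.1]
    have : 0 ≤ (√(2 * ‖B‖) + 1) * d := by positivity
    linarith
  · have : d ≤ √(2 * ‖B‖) * η := by
      refine le_of_sq_le_sq ?_ (by positivity)
      rw [mul_pow, Real.sq_sqrt (by positivity)]
      linarith [h3.2]
    have : 0 ≤ (√(2 / b) + 1) * η := by positivity
    linarith

omit [FiniteDimensional ℝ E] [I.Boundaryless] [T2Space M] in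
/-- In a geodesically convex set, a point dividing the distance between `x` and `y` in the ratio
`s : 1 - s` lies on the minimizing geodesic from `x` to `y`. -/
theorem eq_of_rdist_eq {U : Set M} (hconv : GeodesicallyConvex g.toRiemannianMetric U) {x p y : M}
    (hx : x ∈ U) (hp : p ∈ U) (hy : y ∈ U) {s : ℝ} (hs0 : 0 < s) (hs1 : s < 1)
    (h1 : rdist g.toRiemannianMetric x p = s * rdist g.toRiemannianMetric x y)
    (h2 : rdist g.toRiemannianMetric p y = (1 - s) * rdist g.toRiemannianMetric x y)
    {γ : ℝ → M}
    (hγ : ∀ γ' : ℝ → M, (IsMinimizingGeodesic g.toRiemannianMetric γ' x y ∧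
      ∀ t ∈ Icc (0 : ℝ) 1, γ' t ∈ U) → EqOn γ' γ (Icc 0 1)) : γ s = p := by
  obtain ⟨α, ⟨⟨α0, α1, hα⟩, hαU⟩, -⟩ := hconv x hx p hp
  obtain ⟨β, ⟨⟨β0, β1, hβ⟩, hβU⟩, -⟩ := hconv p hp y hy
  set D := rdist g.toRiemannianMetric x y with hD
  have hs1' : 0 < 1 - s := by linarith
  have hl : ∀ t, t ∈ Icc 0 s → t / s ∈ Icc (0 : ℝ) 1 := fun t ht ↦
    ⟨div_nonneg ht.1 hs0.le, (div_le_one hs0).2 ht.2⟩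
  have hr : ∀ t, t ∈ Icc s 1 → (t - s) / (1 - s) ∈ Icc (0 : ℝ) 1 := fun t ht ↦
    ⟨div_nonneg (by linarith [ht.1]) hs1'.le, (div_le_one hs1').2 (by linarith [ht.2])⟩
  -- The concatenation of geodesics `x` to `p` and `p` to `y`, joined at time `s`. The two ratios
  -- make it minimizing, so uniqueness identifies it with `γ`.
  let c : ℝ → M := fun t ↦ if t ≤ s then α (t / s) else β ((t - s) / (1 - s))
  have cl : ∀ t, t ≤ s → c t = α (t / s) := fun t ht ↦ if_pos ht
  have cr : ∀ t, s < t → c t = β ((t - s) / (1 - s)) := fun t ht ↦ if_neg ht.not_ge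
  have c0 : c 0 = x := by rw [cl 0 hs0.le, zero_div, α0]
  have c1 : c 1 = y := by rw [cr 1 hs1, div_self hs1'.ne', β1]
  have cs : c s = p := by rw [cl s le_rfl, div_self hs0.ne', α1]
  have hll : ∀ t ∈ Icc 0 s, ∀ t' ∈ Icc 0 s,
      rdist g.toRiemannianMetric (c t) (c t') = |t - t'| * D := by
    intro t ht t' ht'
    rw [cl t ht.2, cl t' ht'.2, hα _ (hl t ht) _ (hl t' ht'), h1, ← sub_div, abs_div,
      abs_of_pos hs0]
    field_simp
  have hrr : ∀ t ∈ Ioc s 1, ∀ t' ∈ Ioc s 1,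
      rdist g.toRiemannianMetric (c t) (c t') = |t - t'| * D := by
    intro t ht t' ht'
    rw [cr t ht.1, cr t' ht'.1, hβ _ (hr t ⟨ht.1.le, ht.2⟩) _ (hr t' ⟨ht'.1.le, ht'.2⟩), h2,
      ← sub_div, abs_div, abs_of_pos hs1', sub_sub_sub_cancel_right]
    field_simp
  have hsr : ∀ t ∈ Ioc s 1, rdist g.toRiemannianMetric p (c t) = (t - s) * D := by
    intro t ht
    have h3 := hβ 0 (by simp) _ (hr t ⟨ht.1.le, ht.2⟩)
    rw [β0, ← cr t ht.1, h2, zero_sub, abs_neg,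
      abs_of_nonneg (hr t ⟨ht.1.le, ht.2⟩).1] at h3
    rw [h3]
    field_simp
  -- The upper bound goes through `p`. For the lower bound, anything shorter between `c t` and `c
  -- t'` would make `x` and `y` closer than `D`.
  have hlr : ∀ t ∈ Icc 0 s, ∀ t' ∈ Ioc s 1,
      rdist g.toRiemannianMetric (c t) (c t') = (t' - t) * D := by
    intro t ht t' ht'
    have e1 := hll t ht s ⟨hs0.le, le_rfl⟩
    rw [cs, abs_of_nonpos (by linarith [ht.2])] at e1
    have e2 := hsr t' ht'
    have e3 := hll 0 ⟨le_rfl, hs0.le⟩ t ht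
    rw [c0, abs_of_nonpos (by linarith [ht.1])] at e3
    have e4 := hrr t' ht' 1 ⟨hs1, le_rfl⟩
    rw [c1, abs_of_nonpos (by linarith [ht'.2])] at e4
    have t1 := rdist_triangle g (c t) p (c t')
    have t2 := rdist_triangle g x (c t) y
    have t3 := rdist_triangle g (c t) (c t') y
    apply le_antisymm <;> linarith
  have hc : IsMinimizingGeodesic g.toRiemannianMetric c x y := by
    refine ⟨c0, c1, fun t ht t' ht' ↦ ?_⟩
    rcases le_or_gt t s with hts | hts <;> rcases le_or_gt t' s with hts' | hts'
    · exact hll t ⟨ht.1, hts⟩ t' ⟨ht'.1, hts'⟩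
    · rw [hlr t ⟨ht.1, hts⟩ t' ⟨hts', ht'.2⟩, abs_of_nonpos (by linarith)]; ring
    · rw [rdist_comm, hlr t' ⟨ht'.1, hts'⟩ t ⟨hts, ht.2⟩, abs_of_pos (by linarith)]
    · exact hrr t ⟨hts, ht.2⟩ t' ⟨hts', ht'.2⟩
  have hcU : ∀ t ∈ Icc (0 : ℝ) 1, c t ∈ U := by
    intro t ht
    rcases le_or_gt t s with hts | hts
    · rw [cl t hts]; exact hαU _ (hl t ⟨ht.1, hts⟩)
    · rw [cr t hts]; exact hβU _ (hr t ⟨hts.le, ht.2⟩)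
  rw [← hγ c ⟨hc, hcU⟩ ⟨hs0.le, hs1.le⟩, cs]

omit [FiniteDimensional ℝ E] [I.Boundaryless] [T2Space M] in
/-- Minimizing geodesics to `y` in a geodesically convex set depend continuously on their starting
point, as long as they stay in a compact subset. -/
theorem tendsto_minimizingGeodesic {U K : Set M}
    (hconv : GeodesicallyConvex g.toRiemannianMetric U) (hK : IsCompact K) (hKU : K ⊆ U) {x y : M}
    (hx : x ∈ U) (hy : y ∈ U) {s : ℝ} (hs0 : 0 < s) (hs1 : s < 1) {γ : M → ℝ → M}
    (hγ : ∀ᶠ z in 𝓝 x, IsMinimizingGeodesic g.toRiemannianMetric (γ z) z y)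
    (hγK : ∀ᶠ z in 𝓝 x, γ z s ∈ K)
    (huniq : ∀ γ' : ℝ → M, (IsMinimizingGeodesic g.toRiemannianMetric γ' x y ∧
      ∀ t ∈ Icc (0 : ℝ) 1, γ' t ∈ U) → EqOn γ' (γ x) (Icc 0 1)) :
    Tendsto (fun z ↦ γ z s) (𝓝 x) (𝓝 (γ x s)) := by
  -- By compactness it suffices to identify cluster points. The distances to the endpoints pass to
  -- the limit, and `eq_of_rdist_eq` leaves one candidate.
  refine hK.tendsto_nhds_of_unique_mapClusterPt hγK fun p hp hcl ↦ ?_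
  obtain ⟨𝒰, h𝒰, hlim⟩ := mapClusterPt_iff_ultrafilter.1 hcl
  have hid : Tendsto (fun z : M ↦ z) 𝒰 (𝓝 x) := h𝒰
  have hs : s ∈ Icc (0 : ℝ) 1 := ⟨hs0.le, hs1.le⟩
  have hc := continuous_rdist g
  have hxy : Tendsto (fun z ↦ rdist g.toRiemannianMetric z y) 𝒰
      (𝓝 (rdist g.toRiemannianMetric x y)) :=
    (hc.tendsto (x, y)).comp (hid.prodMk_nhds tendsto_const_nhds)
  have h1 : rdist g.toRiemannianMetric x p = s * rdist g.toRiemannianMetric x y := by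
    refine tendsto_nhds_unique_of_eventuallyEq
      ((hc.tendsto (x, p)).comp (hid.prodMk_nhds hlim)) (hxy.const_mul s) ?_
    filter_upwards [h𝒰 hγ] with z hz
    have := hz.2.2 0 (by simp) s hs
    rwa [hz.1, zero_sub, abs_neg, abs_of_pos hs0] at this
  have h2 : rdist g.toRiemannianMetric p y = (1 - s) * rdist g.toRiemannianMetric x y := by
    refine tendsto_nhds_unique_of_eventuallyEq
      ((hc.tendsto (p, y)).comp (hlim.prodMk_nhds tendsto_const_nhds))
      (hxy.const_mul (1 - s)) ?_
    filter_upwards [h𝒰 hγ] with z hz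
    have := hz.2.2 s hs 1 (by simp)
    rwa [hz.2.1, abs_sub_comm, abs_of_pos (by linarith)] at this
  exact (eq_of_rdist_eq hconv hx (hKU hp) hy hs0 hs1 h1 h2 huniq).symm

/-- In an open geodesically convex set, `K(·, y) = d(·, y)² / 2` is differentiable. -/
theorem mdifferentiableAt_quadPotential {U : Set M} (hU : IsOpen U)
    (hconv : GeodesicallyConvex g.toRiemannianMetric U) {x y : M} (hx : x ∈ U) (hy : y ∈ U) :
    MDifferentiableAt I 𝓘(ℝ, ℝ) (fun z ↦ quadPotential g.toRiemannianMetric z y) x := by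
  have : LocallyCompactSpace M := Manifold.locallyCompact_of_finiteDimensional I
  choose! γ hγ huniq using fun z (hz : z ∈ U) ↦ hconv z hz y hy
  obtain ⟨B, hsymm, hpos, C, hC, s, hs, hcmp⟩ := exists_rdist_chart_compare g x
  obtain ⟨C', hC', hbi⟩ := exists_rdist_bilipschitz g x
  obtain ⟨K, hK, hKsub, hKc⟩ := local_compact_nhds
    (inter_mem (inter_mem hs hbi) (inter_mem (hU.mem_nhds hx) (chart_source_mem_nhds H x)))
  obtain ⟨c, hc, hball⟩ := exists_rdist_lt_subset g hK
  set d := rdist g.toRiemannianMetric with hd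
  set φ := extChartAt I x with hφ
  have hcont : Continuous fun z ↦ d z y :=
    (continuous_rdist g).comp (continuous_id.prodMk continuous_const)
  set D := d x y + 1 with hD
  have hD0 : 0 < D := by have := rdist_nonneg g.toRiemannianMetric x y; positivity
  set V : Set M := {z | z ∈ K ∧ d x z < c / 2 ∧ d z y < D} with hV
  have hVx : V ∈ 𝓝 x := by
    filter_upwards [hK, eventually_rdist_lt g x (half_pos hc),
      hcont.continuousAt.eventually (Iio_mem_nhds (lt_add_one (d x y)))] with z h1 h2 h3
    exact ⟨h1, h2, h3⟩
  -- From a start within `c / 2` of `x`, the piece of geodesic up to time `s₀` travels at most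
  -- another `c / 2`, hence stays in the compact set `K`.
  obtain ⟨s₀, hs₀, hs₀1, hs₀c⟩ : ∃ s₀ : ℝ, 0 < s₀ ∧ s₀ < 1 ∧ s₀ * D ≤ c / 2 := by
    refine ⟨min (1 / 2) (c / 2 / D), by positivity,
      (min_le_left _ _).trans_lt (by norm_num), ?_⟩
    rw [← le_div_iff₀ hD0]
    exact min_le_right _ _
  have hVU : ∀ z ∈ V, z ∈ U := fun z hz ↦ (hKsub hz.1).2.1
  have hsrc : ∀ z ∈ K, φ.symm (φ z) = z := fun z hz ↦
    φ.left_inv (by simpa [hφ] using (hKsub hz).2.2)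
  have hstart : ∀ z ∈ V, ∀ t ∈ Icc (0 : ℝ) 1, d z (γ z t) = t * d z y := fun z hz t ht ↦ by
    have h1 := (hγ z (hVU z hz)).1.2.2 0 (by simp) t ht
    rwa [(hγ z (hVU z hz)).1.1, zero_sub, abs_neg, abs_of_nonneg ht.1] at h1
  have hend : ∀ z ∈ V, ∀ t ∈ Icc (0 : ℝ) 1, d (γ z t) y = (1 - t) * d z y := fun z hz t ht ↦ by
    have h1 := (hγ z (hVU z hz)).1.2.2 t ht 1 (by simp)
    rwa [(hγ z (hVU z hz)).1.2.1, abs_sub_comm, abs_of_nonneg (by linarith [ht.2])] at h1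
  have hdγ : ∀ z ∈ V, ∀ t ∈ Icc (0 : ℝ) s₀, d x (γ z t) ≤ d x z + t * D := fun z hz t ht ↦ by
    have h1 : d x (γ z t) ≤ d x z + d z (γ z t) := rdist_triangle g _ _ _
    rw [hstart z hz t ⟨ht.1, ht.2.trans hs₀1.le⟩] at h1
    have h2 : t * d z y ≤ t * D := mul_le_mul_of_nonneg_left hz.2.2.le ht.1
    linarith
  have hγK : ∀ z ∈ V, ∀ t ∈ Icc (0 : ℝ) s₀, γ z t ∈ K := fun z hz t ht ↦ by
    refine hball _ ((hdγ z hz t ht).trans_lt ?_)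
    have h1 : t * D ≤ s₀ * D := mul_le_mul_of_nonneg_right ht.2 hD0.le
    have h2 := hz.2.1
    linarith
  let σ : ℕ → ℝ := fun k ↦ s₀ * (1 / 2) ^ k
  have hσ0 : ∀ k, 0 < σ k := fun k ↦ by positivity
  have hσ1 : ∀ k, σ k ≤ s₀ := fun k ↦
    mul_le_of_le_one_right hs₀.le (pow_le_one₀ (by norm_num) (by norm_num))
  have hσI : ∀ k, σ k ∈ Icc (0 : ℝ) s₀ := fun k ↦ ⟨(hσ0 k).le, hσ1 k⟩
  have hσI' : ∀ k, σ k ∈ Icc (0 : ℝ) 1 := fun k ↦ ⟨(hσ0 k).le, (hσ1 k).trans hs₀1.le⟩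
  have htgt : φ.target ∈ 𝓝 (φ x) := extChartAt_target_mem_nhds x
  have hφx : φ.symm (φ x) = x := extChartAt_to_inv x
  have hKP : ∀ z ∈ K, ‖φ z - φ x‖ ≤ C' * d x z ∧ d x z ≤ C' * ‖φ z - φ x‖ :=
    fun z hz ↦ (hKsub hz).1.2
  have key : DifferentiableAt ℝ (fun u ↦ d (φ.symm u) y ^ 2) (φ x) := by
    refine differentiableAt_of_minimizers (B := B)
      (d2 := fun u v ↦ d (φ.symm u) (φ.symm v) ^ 2)
      (P := fun u k ↦ φ (γ (φ.symm u) (σ k))) (s := σ) (s₀ := s₀) (C := C)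
      (C' := C' * (C' + D)) (D := D ^ 2)
      (S := φ.target ∩ φ.symm ⁻¹' K) (S' := φ.target ∩ φ.symm ⁻¹' V)
      hsymm hpos hs₀ (fun k ↦ rfl) hC.le (by positivity) ?_ ?_ ?_ ?_ ?_ ?_ ?_ ?_ ?_ ?_ ?_
    · refine inter_mem htgt ?_
      exact extChartAt_preimage_mem_nhds hVx
    · exact fun u hu ↦ ⟨hu.1, hu.2.1⟩
    · intro u hu v hv
      have h1 := hcmp (φ.symm u) (hKsub hu.2).1.1 (φ.symm v) (hKsub hv.2).1.1
      rwa [φ.right_inv hu.1, φ.right_inv hv.1] at h1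
    · intro u hu k
      have h1 := hγK _ hu.2 _ (hσI k)
      refine ⟨φ.map_source ?_, ?_⟩
      · rw [hφ, extChartAt_source]; exact (hKsub h1).2.2
      · change φ.symm (φ _) ∈ K
        rwa [hsrc _ h1]
    · intro u hu k
      have h1 := hγK _ hu.2 _ (hσI k)
      have h2 := (hKP _ h1).1
      have h3 := hdγ _ hu.2 _ (hσI k)
      have h4 := (hKP _ hu.2.1).2
      rw [φ.right_inv hu.1] at h4
      refine h2.trans ?_
      rw [mul_assoc]
      refine mul_le_mul_of_nonneg_left ?_ hC'.le
      have h5 : 0 ≤ D * ‖u - φ x‖ := by positivity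
      have h6 : 0 ≤ C' * σ k := mul_nonneg hC'.le (hσ0 k).le
      linarith
    · exact fun u _ ↦ sq_nonneg _
    · exact fun u hu ↦ pow_le_pow_left₀ (rdist_nonneg _ _ _) hu.2.2.2.le 2
    · intro u hu k
      rw [hsrc _ (hγK _ hu.2 _ (hσI k)), hstart _ hu.2 _ (hσI' k), mul_pow]
    · intro u hu k
      rw [hsrc _ (hγK _ hu.2 _ (hσI k)), hsrc _ (hγK _ hu.2 _ (hσI (k + 1))), ← mul_pow]
      have h1 := (hγ _ (hVU _ hu.2)).1.2.2 _ (hσI' (k + 1)) _ (hσI' k)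
      have h2 : |σ (k + 1) - σ k| = σ (k + 1) := by
        have h3 : σ k = 2 * σ (k + 1) := by simp only [σ, pow_succ]; ring
        rw [h3, abs_of_nonpos (by linarith [hσ0 (k + 1)])]; ring
      rw [h2] at h1
      exact congrArg (· ^ 2) h1
    · intro u hu z hz k
      have hk := hσ0 k
      have hk1 : 0 < 1 - σ k := by linarith [hσ1 k]
      rw [hsrc _ (hγK _ hu.2 _ (hσI k))]
      have h1 : d (φ.symm z) y ≤ d (φ.symm z) (γ (φ.symm u) (σ k)) +
          (1 - σ k) * d (φ.symm u) y := by
        rw [← hend _ hu.2 _ (hσI' k)]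
        exact rdist_triangle g _ _ _
      set a := d (φ.symm z) (γ (φ.symm u) (σ k))
      set f := d (φ.symm u) y
      have h2 : d (φ.symm z) y ^ 2 ≤ (a + (1 - σ k) * f) ^ 2 :=
        pow_le_pow_left₀ (rdist_nonneg _ _ _) h1 2
      refine h2.trans ?_
      rw [div_add' _ _ _ hk.ne', le_div_iff₀ hk]
      -- Convexity of the square: `a + (1 - σ) f` is the convex combination of `a / σ` and `f` with
      -- weights `σ` and `1 - σ`.
      have h3 : 0 ≤ (1 - σ k) * (a - σ k * f) ^ 2 := mul_nonneg hk1.le (sq_nonneg _)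
      linarith
    · intro k
      have h1 : Tendsto (fun z ↦ γ z (σ k)) (𝓝 x) (𝓝 (γ x (σ k))) :=
        tendsto_minimizingGeodesic hconv hKc (fun z hz ↦ (hKsub hz).2.1) hx hy (hσ0 k)
          ((hσ1 k).trans_lt hs₀1) (by filter_upwards [hVx] with z hz using (hγ z (hVU z hz)).1)
          (by filter_upwards [hVx] with z hz using hγK z hz _ (hσI k)) (huniq x hx)
      have h2 : Tendsto φ.symm (𝓝 (φ x)) (𝓝 x) := by
        have := continuousAt_extChartAt_symm (I := I) x
        rwa [ContinuousAt, ← hφ, hφx] at this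
      have h3 : ContinuousAt φ (γ x (σ k)) := by
        refine continuousAt_extChartAt' ?_
        rw [extChartAt_source]
        exact (hKsub (hγK x (mem_of_mem_nhds hVx) _ (hσI k))).2.2
      simp only [hφx]
      exact h3.tendsto.comp (h1.comp h2)
  rw [mdifferentiableAt_iff]
  refine ⟨((hcont.pow 2).div_const 2).continuousAt, ?_⟩
  rw [I.range_eq_univ, differentiableWithinAt_univ]
  exact (key.mul_const (2 : ℝ)⁻¹).congr_of_eventuallyEq (.of_forall fun u ↦ div_eq_mul_inv _ _)

end Geodesic

/-! ### Reparametrization with bounded speed. -/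

section Speed

variable {E : Type*} [NormedAddCommGroup E] [NormedSpace ℝ E]
  {H : Type*} [TopologicalSpace H] {I : ModelWithCorners ℝ E H}
  {M : Type*} [TopologicalSpace M] [ChartedSpace H M]

theorem speed_comp (g : RiemannianMetric (fun x : M ↦ TangentSpace I x)) {γ : ℝ → M} {f : ℝ → ℝ}
    {t f' : ℝ} (hf : HasDerivAt f f' t) (hγ : MDifferentiableAt 𝓘(ℝ, ℝ) I γ (f t)) :
    speed g (γ ∘ f) t = |f'| * speed g γ (f t) := by
  have h1 : HasMFDerivAt 𝓘(ℝ, ℝ) 𝓘(ℝ, ℝ) f t ((1 : ℝ →L[ℝ] ℝ).smulRight f') :=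
    hasMFDerivAt_iff_hasFDerivAt.2 hf.hasFDerivAt
  have h2 := (hγ.hasMFDerivAt.comp t h1).mfderiv
  have h3 : mfderiv 𝓘(ℝ, ℝ) I (γ ∘ f) t (1 : ℝ) =
      f' • mfderiv 𝓘(ℝ, ℝ) I γ (f t) (1 : ℝ) := by
    rw [h2]
    let L : ℝ →L[ℝ] E := mfderiv 𝓘(ℝ, ℝ) I γ (f t)
    have h4 : L ((1 : ℝ) • f') = f' • L 1 := by
      rw [one_smul, ← L.map_smul, smul_eq_mul, mul_one]
    exact h4
  rw [speed, h3, gnorm_smul]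
  rfl

variable [IsManifold I ∞ M] (g : ContMDiffRiemannianMetric I ∞ E (fun x : M ↦ TangentSpace I x))

theorem continuous_speed {γ : ℝ → M} (hγ : ContMDiff 𝓘(ℝ, ℝ) I 1 γ) :
    Continuous (speed g.toRiemannianMetric γ) := by
  have : IsManifold I 1 M := .of_le (n := ∞) (by simp)
  let _ : RiemannianBundle (fun x : M ↦ TangentSpace I x) := ⟨g.toRiemannianMetric⟩
  have : IsContinuousRiemannianBundle E (fun x : M ↦ TangentSpace I x) :=
    ⟨g.inner, g.contMDiff.continuous, fun _ _ _ ↦ rfl⟩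
  have h1 : Continuous (tangentMap 𝓘(ℝ, ℝ) I γ) := hγ.continuous_tangentMap le_rfl
  have h2 : Continuous fun t : ℝ ↦ (⟨t, (1 : ℝ)⟩ : TangentBundle 𝓘(ℝ, ℝ) ℝ) := by
    have := (tangentBundleModelSpaceHomeomorph 𝓘(ℝ, ℝ)).symm.continuous.comp
      (Continuous.prodMk continuous_id continuous_const : Continuous fun t : ℝ ↦ (t, (1 : ℝ)))
    exact this
  have h3 : Continuous fun t : ℝ ↦ (⟨γ t, mfderiv 𝓘(ℝ, ℝ) I γ t (1 : ℝ)⟩ :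
      TotalSpace E (fun x : M ↦ TangentSpace I x)) := h1.comp h2
  exact (Continuous.inner_bundle h3 h3).sqrt

/-- A path of length less than `r` can be reparametrized so that its speed is at most `r`. -/
theorem exists_speed_le {x y : M} {r : ℝ} (h : redist g.toRiemannianMetric x y < ENNReal.ofReal r) :
    ∃ γ : ℝ → M, γ 0 = x ∧ γ 1 = y ∧ ContMDiff 𝓘(ℝ, ℝ) I 1 γ ∧
      ∀ t, speed g.toRiemannianMetric γ t ≤ r := by
  have hr : 0 < r := ENNReal.ofReal_pos.1 (zero_le.trans_lt h)
  obtain ⟨γ, h0, h1, hγ, hlen⟩ := exists_glength_lt _ h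
  set v := speed g.toRiemannianMetric γ with hv
  have hvc : Continuous v := continuous_speed g hγ
  have hv0 : ∀ t, 0 ≤ v t := fun t ↦ speed_nonneg _ _ _
  set L := ∫ t in (0 : ℝ)..1, v t with hL
  have hLlen : ENNReal.ofReal L = glength g.toRiemannianMetric γ 0 1 := by
    rw [hL, intervalIntegral.integral_of_le zero_le_one, ← integral_Icc_eq_integral_Ioc,
      ofReal_integral_eq_lintegral_ofReal hvc.continuousOn.integrableOn_Icc
        (.of_forall fun t ↦ hv0 t)]
    rfl
  have hLr : L < r := by
    rw [← hLlen] at hlen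
    exact (ENNReal.ofReal_lt_ofReal_iff hr).1 hlen
  set δ := r - L with hδ
  have hδ0 : 0 < δ := by linarith
  -- Adding `δ` keeps the density positive where the path stands still, so its primitive `Φ` has a
  -- `C^1` inverse. With `δ = r - L` the total mass is exactly `r`, and the new speed is `r * v / (v
  -- + δ) ≤ r`.
  let u : ℝ → ℝ := fun t ↦ v t + δ
  have huc : Continuous u := hvc.add continuous_const
  have hu0 : ∀ t, 0 < u t := fun t ↦ by have := hv0 t; positivity
  let Φ : ℝ → ℝ := fun t ↦ ∫ τ in (0 : ℝ)..t, u τ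
  have hΦ : ∀ t, HasDerivAt Φ (u t) t := fun t ↦
    intervalIntegral.integral_hasDerivAt_right (huc.intervalIntegrable _ _)
      (huc.stronglyMeasurableAtFilter _ _) huc.continuousAt
  have hΦmono : StrictMono Φ := strictMono_of_hasDerivAt_pos hΦ hu0
  have hΦ0 : Φ 0 = 0 := intervalIntegral.integral_same
  have hΦ1 : Φ 1 = r := by
    simp only [Φ, u]
    rw [intervalIntegral.integral_add (hvc.intervalIntegrable _ _) (by simp), ← hL]
    simp [hδ]
  have hΦc : Continuous Φ := continuous_iff_continuousAt.2 fun t ↦ (hΦ t).continuousAt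
  -- Growth at least linear with slope `δ` makes `Φ` onto the whole line.
  have hlin : Monotone fun t ↦ Φ t - δ * t := by
    have hd : ∀ t, HasDerivAt (fun t ↦ Φ t - δ * t) (v t) t := fun t ↦ by
      have h2 := (hΦ t).sub ((hasDerivAt_id t).const_mul δ)
      simp only [u, mul_one, add_sub_cancel_right] at h2
      exact h2
    refine monotone_of_deriv_nonneg (fun t ↦ (hd t).differentiableAt) fun t ↦ ?_
    rw [(hd t).deriv]
    exact hv0 t
  have hsurj : Function.Surjective Φ := by
    refine hΦc.surjective ?_ ?_
    · refine tendsto_atTop_mono' _ ?_ (tendsto_id.const_mul_atTop hδ0)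
      filter_upwards [eventually_ge_atTop 0] with t ht
      have := hlin ht
      simp only [hΦ0, mul_zero, sub_zero] at this
      simp only [id]
      linarith
    · refine tendsto_atBot_mono' _ ?_ (tendsto_id.const_mul_atBot hδ0)
      filter_upwards [eventually_le_atBot 0] with t ht
      have := hlin ht
      simp only [hΦ0, mul_zero, sub_zero] at this
      simp only [id]
      linarith
  let e : ℝ ≃ₜ ℝ := (hΦmono.orderIsoOfSurjective Φ hsurj).toHomeomorph
  have he : ∀ t, e t = Φ t := fun t ↦ rfl
  have hΦC : ContDiff ℝ 1 (e : ℝ → ℝ) := by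
    rw [contDiff_one_iff_deriv]
    refine ⟨fun t ↦ (hΦ t).differentiableAt, ?_⟩
    have : deriv (e : ℝ → ℝ) = u := funext fun t ↦ (hΦ t).deriv
    rw [this]
    exact huc
  have heC : ContDiff ℝ 1 (e.symm : ℝ → ℝ) :=
    e.contDiff_symm_deriv (fun t ↦ (hu0 t).ne') hΦ hΦC
  have heD : ∀ τ, HasDerivAt e.symm (u (e.symm τ))⁻¹ τ := fun τ ↦
    HasDerivAt.of_local_left_inverse e.symm.continuous.continuousAt (hΦ _) (hu0 _).ne'
      (.of_forall e.apply_symm_apply)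
  let f : ℝ → ℝ := fun τ ↦ e.symm (r * τ)
  have hfD : ∀ τ, HasDerivAt f ((u (f τ))⁻¹ * r) τ := fun τ ↦ by
    have h2 : HasDerivAt (fun τ : ℝ ↦ r * τ) r τ := by
      simpa using (hasDerivAt_id τ).const_mul r
    exact (heD (r * τ)).comp τ h2
  refine ⟨γ ∘ f, ?_, ?_, ?_, fun t ↦ ?_⟩
  · have : f 0 = 0 := by
      simp only [f, mul_zero]
      rw [e.symm_apply_eq, he, hΦ0]
    rw [Function.comp_apply, this, h0]
  · have : f 1 = 1 := by
      simp only [f, mul_one]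
      rw [e.symm_apply_eq, he, hΦ1]
    rw [Function.comp_apply, this, h1]
  · refine hγ.comp (contMDiff_iff_contDiff.2 ?_)
    exact heC.comp (contDiff_const.mul contDiff_id)
  · rw [speed_comp _ (hfD t) (hγ.mdifferentiableAt one_ne_zero), ← hv]
    have h2 := hu0 (f t)
    rw [abs_of_pos (by positivity), mul_assoc, inv_mul_le_iff₀ h2, mul_comm]
    gcongr
    simp only [u]
    linarith

end Speed

/-! ### Pythagoras' formula for the product distance. -/

section ProductDist

variable {E₁ : Type*} [NormedAddCommGroup E₁] [NormedSpace ℝ E₁]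
  {H₁ : Type*} [TopologicalSpace H₁] {I₁ : ModelWithCorners ℝ E₁ H₁}
  {M₁ : Type*} [TopologicalSpace M₁] [ChartedSpace H₁ M₁]
  {E₂ : Type*} [NormedAddCommGroup E₂] [NormedSpace ℝ E₂]
  {H₂ : Type*} [TopologicalSpace H₂] {I₂ : ModelWithCorners ℝ E₂ H₂}
  {M₂ : Type*} [TopologicalSpace M₂] [ChartedSpace H₂ M₂]

theorem speed_prodMk (g₁ : RiemannianMetric (fun x : M₁ ↦ TangentSpace I₁ x))
    (g₂ : RiemannianMetric (fun x : M₂ ↦ TangentSpace I₂ x)) {γ₁ : ℝ → M₁} {γ₂ : ℝ → M₂} {t : ℝ}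
    (h₁ : MDifferentiableAt 𝓘(ℝ, ℝ) I₁ γ₁ t) (h₂ : MDifferentiableAt 𝓘(ℝ, ℝ) I₂ γ₂ t) :
    speed (prodMetric g₁ g₂) (fun s ↦ (γ₁ s, γ₂ s)) t =
      √(speed g₁ γ₁ t ^ 2 + speed g₂ γ₂ t ^ 2) := by
  rw [speed, mfderiv_prodMk h₁ h₂, speed, speed, gnorm_sq, gnorm_sq]
  rfl

variable [IsManifold I₁ ∞ M₁] [IsManifold I₂ ∞ M₂] [ConnectedSpace M₁] [ConnectedSpace M₂]
  (g₁ : ContMDiffRiemannianMetric I₁ ∞ E₁ (fun x : M₁ ↦ TangentSpace I₁ x))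
  (g₂ : ContMDiffRiemannianMetric I₂ ∞ E₂ (fun x : M₂ ↦ TangentSpace I₂ x))

/-- The components are first reparametrized with uniformly bounded speeds: only then is the length
of the pair bounded by the root of the sum of the squares of the two lengths. -/
theorem redist_prod_le (p q : M₁ × M₂) :
    redist (prodMetric g₁.toRiemannianMetric g₂.toRiemannianMetric) p q ≤
      ENNReal.ofReal √(rdist g₁.toRiemannianMetric p.1 q.1 ^ 2 +
        rdist g₂.toRiemannianMetric p.2 q.2 ^ 2) := by
  set d₁ := rdist g₁.toRiemannianMetric p.1 q.1 with hd₁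
  set d₂ := rdist g₂.toRiemannianMetric p.2 q.2 with hd₂
  have h₁ : 0 ≤ d₁ := rdist_nonneg _ _ _
  have h₂ : 0 ≤ d₂ := rdist_nonneg _ _ _
  have key : ∀ δ : ℝ, 0 < δ → redist (prodMetric g₁.toRiemannianMetric g₂.toRiemannianMetric) p q ≤
      ENNReal.ofReal √((d₁ + δ) ^ 2 + (d₂ + δ) ^ 2) := by
    intro δ hδ
    obtain ⟨γ₁, a0, a1, a2, a3⟩ := exists_speed_le g₁ (x := p.1) (y := q.1) (r := d₁ + δ) (by
      rw [← ofReal_rdist]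
      exact (ENNReal.ofReal_lt_ofReal_iff (by positivity)).2 (by linarith))
    obtain ⟨γ₂, b0, b1, b2, b3⟩ := exists_speed_le g₂ (x := p.2) (y := q.2) (r := d₂ + δ) (by
      rw [← ofReal_rdist]
      exact (ENNReal.ofReal_lt_ofReal_iff (by positivity)).2 (by linarith))
    have hγ : ContMDiff 𝓘(ℝ, ℝ) (I₁.prod I₂) 1 fun s ↦ (γ₁ s, γ₂ s) := a2.prodMk b2
    have h3 := redist_le_glength (prodMetric g₁.toRiemannianMetric g₂.toRiemannianMetric)
      hγ.contMDiffOn (zero_le_one (α := ℝ))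
    rw [a0, a1, b0, b1] at h3
    refine h3.trans ?_
    calc glength (prodMetric g₁.toRiemannianMetric g₂.toRiemannianMetric)
          (fun s ↦ (γ₁ s, γ₂ s)) 0 1
        ≤ ∫⁻ t in Icc (0 : ℝ) 1, ENNReal.ofReal √((d₁ + δ) ^ 2 + (d₂ + δ) ^ 2) := by
          refine lintegral_mono fun t ↦ ENNReal.ofReal_le_ofReal ?_
          rw [speed_prodMk _ _ (a2.mdifferentiableAt one_ne_zero)
            (b2.mdifferentiableAt one_ne_zero)]
          have c1 := speed_nonneg g₁.toRiemannianMetric γ₁ t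
          have c2 := speed_nonneg g₂.toRiemannianMetric γ₂ t
          have c3 := a3 t
          have c4 := b3 t
          gcongr
      _ = _ := by simp
  have hlim : Tendsto (fun δ : ℝ ↦ ENNReal.ofReal √((d₁ + δ) ^ 2 + (d₂ + δ) ^ 2)) (𝓝[>] 0)
      (𝓝 (ENNReal.ofReal √(d₁ ^ 2 + d₂ ^ 2))) := by
    have hc : Continuous fun δ : ℝ ↦ ENNReal.ofReal √((d₁ + δ) ^ 2 + (d₂ + δ) ^ 2) :=
      ENNReal.continuous_ofReal.comp (by fun_prop)
    have := hc.tendsto 0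
    simp only [add_zero] at this
    exact this.mono_left nhdsWithin_le_nhds
  exact ge_of_tendsto hlim (by filter_upwards [self_mem_nhdsWithin] with δ hδ using key δ hδ)

theorem redist_prod_ne_top (p q : M₁ × M₂) :
    redist (prodMetric g₁.toRiemannianMetric g₂.toRiemannianMetric) p q ≠ ⊤ :=
  ((redist_prod_le g₁ g₂ p q).trans_lt ENNReal.ofReal_lt_top).ne

/-- Pythagoras' formula for the intrinsic distance of a product. -/
theorem rdist_prod_sq (p q : M₁ × M₂) :
    rdist (prodMetric g₁.toRiemannianMetric g₂.toRiemannianMetric) p q ^ 2 =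
      rdist g₁.toRiemannianMetric p.1 q.1 ^ 2 + rdist g₂.toRiemannianMetric p.2 q.2 ^ 2 := by
  set g := prodMetric g₁.toRiemannianMetric g₂.toRiemannianMetric with hg
  have hle := ENNReal.toReal_le_of_le_ofReal (Real.sqrt_nonneg _) (redist_prod_le g₁ g₂ p q)
  rw [← rdist_eq_toReal] at hle
  set d₁ := rdist g₁.toRiemannianMetric p.1 q.1 with hd₁
  set d₂ := rdist g₂.toRiemannianMetric p.2 q.2 with hd₂
  have h₁ : 0 ≤ d₁ := rdist_nonneg _ _ _
  have h₂ : 0 ≤ d₂ := rdist_nonneg _ _ _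
  have hd : 0 ≤ rdist g p q := rdist_nonneg _ _ _
  set m := √(d₁ ^ 2 + d₂ ^ 2) with hm
  have hm0 : 0 ≤ m := Real.sqrt_nonneg _
  have hmsq : m ^ 2 = d₁ ^ 2 + d₂ ^ 2 := Real.sq_sqrt (by positivity)
  suffices hge : m ≤ rdist g p q by
    rw [← hmsq, le_antisymm hle hge]
  -- Cauchy–Schwarz with the constant vector `(d₁, d₂)`: integrating `d₁ v₁ + d₂ v₂ ≤ m v` along a
  -- path of the product bounds `d₁² + d₂² = m²` by `m` times its length.
  have key : ∀ r, rdist g p q < r → d₁ ^ 2 + d₂ ^ 2 ≤ m * r := by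
    intro r hr
    have hr0 : 0 < r := hd.trans_lt hr
    obtain ⟨γ, c0, c1, hγ, hlen⟩ := exists_glength_lt g (x := p) (y := q)
      (r := ENNReal.ofReal r) (by
        rw [← ENNReal.ofReal_toReal (redist_prod_ne_top g₁ g₂ p q)]
        exact (ENNReal.ofReal_lt_ofReal_iff hr0).2 hr)
    have hγ₁ : ContMDiff 𝓘(ℝ, ℝ) I₁ 1 fun t ↦ (γ t).1 := contMDiff_fst.comp hγ
    have hγ₂ : ContMDiff 𝓘(ℝ, ℝ) I₂ 1 fun t ↦ (γ t).2 := contMDiff_snd.comp hγ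
    have e₁ := redist_le_glength g₁.toRiemannianMetric hγ₁.contMDiffOn (zero_le_one (α := ℝ))
    have e₂ := redist_le_glength g₂.toRiemannianMetric hγ₂.contMDiffOn (zero_le_one (α := ℝ))
    rw [c0, c1, ← ofReal_rdist] at e₁ e₂
    have hs : ∀ t, d₁ * speed g₁.toRiemannianMetric (fun t ↦ (γ t).1) t +
        d₂ * speed g₂.toRiemannianMetric (fun t ↦ (γ t).2) t ≤ m * speed g γ t := by
      intro t
      have h3 : speed g γ t = √(_ + _) := speed_prodMk g₁.toRiemannianMetric g₂.toRiemannianMetric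
        (hγ₁.mdifferentiableAt one_ne_zero) (hγ₂.mdifferentiableAt (x := t) one_ne_zero)
      rw [h3, hm, ← Real.sqrt_mul (by positivity)]
      refine Real.le_sqrt_of_sq_le ?_
      nlinarith [sq_nonneg (d₁ * speed g₂.toRiemannianMetric (fun t ↦ (γ t).2) t -
        d₂ * speed g₁.toRiemannianMetric (fun t ↦ (γ t).1) t)]
    have h3 : ENNReal.ofReal (d₁ ^ 2 + d₂ ^ 2) ≤ ENNReal.ofReal (m * r) := by
      calc ENNReal.ofReal (d₁ ^ 2 + d₂ ^ 2)
          = ENNReal.ofReal d₁ * ENNReal.ofReal d₁ + ENNReal.ofReal d₂ * ENNReal.ofReal d₂ := by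
            rw [ENNReal.ofReal_add (by positivity) (by positivity), pow_two, pow_two,
              ENNReal.ofReal_mul h₁, ENNReal.ofReal_mul h₂]
        _ ≤ ENNReal.ofReal d₁ * glength g₁.toRiemannianMetric (fun t ↦ (γ t).1) 0 1 +
            ENNReal.ofReal d₂ * glength g₂.toRiemannianMetric (fun t ↦ (γ t).2) 0 1 := by
          gcongr
        _ ≤ ∫⁻ t in Icc (0 : ℝ) 1, (ENNReal.ofReal d₁ * ENNReal.ofReal
              (speed g₁.toRiemannianMetric (fun t ↦ (γ t).1) t) +
            ENNReal.ofReal d₂ * ENNReal.ofReal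
              (speed g₂.toRiemannianMetric (fun t ↦ (γ t).2) t)) := by
          rw [glength, glength, ← lintegral_const_mul' _ _ ENNReal.ofReal_ne_top,
            ← lintegral_const_mul' _ _ ENNReal.ofReal_ne_top]
          -- Superadditivity of the lower integral holds without measurability of the speeds.
          exact le_lintegral_add _ _
        _ ≤ ∫⁻ t in Icc (0 : ℝ) 1, ENNReal.ofReal m * ENNReal.ofReal (speed g γ t) := by
          refine lintegral_mono fun t ↦ ?_
          rw [← ENNReal.ofReal_mul h₁, ← ENNReal.ofReal_mul h₂, ← ENNReal.ofReal_mul hm0,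
            ← ENNReal.ofReal_add (mul_nonneg h₁ (speed_nonneg _ _ _))
              (mul_nonneg h₂ (speed_nonneg _ _ _))]
          exact ENNReal.ofReal_le_ofReal (hs t)
        _ = ENNReal.ofReal m * glength g γ 0 1 :=
          lintegral_const_mul' _ _ ENNReal.ofReal_ne_top
        _ ≤ ENNReal.ofReal m * ENNReal.ofReal r := by gcongr
        _ = _ := (ENNReal.ofReal_mul hm0).symm
    exact (ENNReal.ofReal_le_ofReal_iff (by positivity)).1 h3
  rcases hm0.eq_or_lt with h0 | h0
  · rw [← h0]; exact hd
  refine le_of_forall_gt_imp_ge_of_dense fun r hr ↦ ?_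
  have := key r hr
  rw [← hmsq, pow_two] at this
  exact le_of_mul_le_mul_left this h0

theorem rdist_prod_le (p q : M₁ × M₂) :
    rdist (prodMetric g₁.toRiemannianMetric g₂.toRiemannianMetric) p q ≤
      rdist g₁.toRiemannianMetric p.1 q.1 + rdist g₂.toRiemannianMetric p.2 q.2 := by
  have h₁ := rdist_nonneg g₁.toRiemannianMetric p.1 q.1
  have h₂ := rdist_nonneg g₂.toRiemannianMetric p.2 q.2
  refine le_of_sq_le_sq ?_ (by positivity)
  rw [rdist_prod_sq]
  nlinarith

theorem rdist_fst_le (p q : M₁ × M₂) : rdist g₁.toRiemannianMetric p.1 q.1 ≤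
    rdist (prodMetric g₁.toRiemannianMetric g₂.toRiemannianMetric) p q := by
  refine le_of_sq_le_sq ?_ (rdist_nonneg _ _ _)
  rw [rdist_prod_sq]
  linarith [sq_nonneg (rdist g₂.toRiemannianMetric p.2 q.2)]

theorem rdist_snd_le (p q : M₁ × M₂) : rdist g₂.toRiemannianMetric p.2 q.2 ≤
    rdist (prodMetric g₁.toRiemannianMetric g₂.toRiemannianMetric) p q := by
  refine le_of_sq_le_sq ?_ (rdist_nonneg _ _ _)
  rw [rdist_prod_sq]
  linarith [sq_nonneg (rdist g₁.toRiemannianMetric p.1 q.1)]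

theorem continuous_rdist_prod : Continuous fun p : (M₁ × M₂) × (M₁ × M₂) ↦
    rdist (prodMetric g₁.toRiemannianMetric g₂.toRiemannianMetric) p.1 p.2 := by
  have h : (fun p : (M₁ × M₂) × (M₁ × M₂) ↦
      rdist (prodMetric g₁.toRiemannianMetric g₂.toRiemannianMetric) p.1 p.2) = fun p ↦
        √(rdist g₁.toRiemannianMetric p.1.1 p.2.1 ^ 2 +
          rdist g₂.toRiemannianMetric p.1.2 p.2.2 ^ 2) := by
    funext p
    rw [← rdist_prod_sq, Real.sqrt_sq (rdist_nonneg _ _ _)]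
  rw [h]
  have h₁ : Continuous fun p : (M₁ × M₂) × (M₁ × M₂) ↦
      rdist g₁.toRiemannianMetric p.1.1 p.2.1 :=
    (continuous_rdist g₁).comp (continuous_fst.fst.prodMk continuous_snd.fst)
  have h₂ : Continuous fun p : (M₁ × M₂) × (M₁ × M₂) ↦
      rdist g₂.toRiemannianMetric p.1.2 p.2.2 :=
    (continuous_rdist g₂).comp (continuous_fst.snd.prodMk continuous_snd.snd)
  exact ((h₁.pow 2).add (h₂.pow 2)).sqrt

end ProductDist

/-! ### Measurability and integrability of the gradient of the potential. -/

section Gradient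

/-- A positive definite form induces an injection into the dual, which is onto because the
dimensions agree. -/
theorem exists_bilin_eq {E : Type*} [NormedAddCommGroup E] [NormedSpace ℝ E] [FiniteDimensional ℝ E]
    {A : E →L[ℝ] E →L[ℝ] ℝ} (hA : ∀ v, v ≠ 0 → 0 < A v v) (L : E →L[ℝ] ℝ) :
    ∃ u, ∀ w, A u w = L w := by
  let B : E →ₗ[ℝ] Module.Dual ℝ E := (ContinuousLinearMap.coeLM ℝ).comp A.toLinearMap
  have hB : ∀ u w, B u w = A u w := fun u w ↦ rfl
  have hinj : Function.Injective B := by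
    rw [injective_iff_map_eq_zero]
    intro u hu
    by_contra hne
    have h1 := hA u hne
    rw [← hB, hu] at h1
    simp at h1
  have hsurj : Function.Surjective B :=
    (LinearMap.injective_iff_surjective_of_finrank_eq_finrank
      (Subspace.dual_finrank_eq (K := ℝ) (V := E)).symm).1 hinj
  obtain ⟨u, hu⟩ := hsurj L.toLinearMap
  exact ⟨u, fun w ↦ by rw [← hB, hu]; rfl⟩

variable {E : Type*} [NormedAddCommGroup E] [NormedSpace ℝ E] [FiniteDimensional ℝ E]
  {H : Type*} [TopologicalSpace H] {I : ModelWithCorners ℝ E H}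
  {M : Type*} [TopologicalSpace M] [ChartedSpace H M]

/-- The gradient, as an explicit linear function of the differential. -/
theorem exists_riemGrad_eq_sum (g : RiemannianMetric (fun x : M ↦ TangentSpace I x)) (x : M) :
    ∃ (n : ℕ) (b u : Fin n → E), ∀ (f : M → ℝ) (d : E → ℝ),
      (∀ w : E, d w = mfderiv I 𝓘(ℝ, ℝ) f x w) →
      ∃ G : E, G = riemGrad g f x ∧ G = ∑ i, d (b i) • u i := by
  let b := Module.finBasis ℝ E
  let A : E →L[ℝ] E →L[ℝ] ℝ := g.inner x
  have hA : ∀ v, v ≠ 0 → 0 < A v v := g.pos x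
  -- The `u i` represent the coordinate functionals, so a gradient is the combination of fixed
  -- vectors with the values `d (b i)` as coefficients. Integrability thus reduces to scalar
  -- differentials.
  choose u hu using fun i ↦ exists_bilin_eq hA (b.coord i).toContinuousLinearMap
  refine ⟨_, b, u, fun f d hd ↦ ⟨∑ i, d (b i) • u i, ?_, rfl⟩⟩
  refine eq_riemGrad g f x _ fun w ↦ ?_
  let L : E →L[ℝ] ℝ := mfderiv I 𝓘(ℝ, ℝ) f x
  have hL : ∀ w, L w = d w := fun w ↦ (hd w).symm
  have key : ∀ w : E, A (∑ i, d (b i) • u i) w = L w := by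
    intro w
    rw [map_sum, sum_apply]
    conv_rhs => rw [← b.sum_repr w, map_sum]
    refine Finset.sum_congr rfl fun i _ ↦ ?_
    rw [map_smul, smul_apply, hu, map_smul, hL, smul_eq_mul, smul_eq_mul, mul_comm]
    rfl
  exact key w

variable [I.Boundaryless]

omit [FiniteDimensional ℝ E] in
/-- The differential as the limit of difference quotients in the chart. -/
theorem tendsto_mfderiv {f : M → ℝ} {x : M} (hf : MDifferentiableAt I 𝓘(ℝ, ℝ) f x) (w : E) {d : ℝ}
    (hd : d = mfderiv I 𝓘(ℝ, ℝ) f x w) :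
    Tendsto (fun n : ℕ ↦ (n : ℝ) *
      (f ((extChartAt I x).symm (extChartAt I x x + (n : ℝ)⁻¹ • w)) - f x)) atTop (𝓝 d) := by
  have h1 := ((mdifferentiableAt_iff _ _).1 hf).2
  rw [I.range_eq_univ, differentiableWithinAt_univ] at h1
  have h2 : HasFDerivAt (f ∘ (extChartAt I x).symm)
      (fderiv ℝ (f ∘ (extChartAt I x).symm) (extChartAt I x x)) (extChartAt I x x) :=
    h1.hasFDerivAt
  have h3 : d = fderiv ℝ (f ∘ (extChartAt I x).symm) (extChartAt I x x) w := by
    rw [hd, hf.mfderiv, I.range_eq_univ, fderivWithin_univ]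
    rfl
  rw [h3]
  have h4 := h2.lim w (c := fun n : ℕ ↦ (n : ℝ)) (l := atTop) (by
    simpa using tendsto_natCast_atTop_atTop (R := ℝ))
  refine h4.congr fun n ↦ ?_
  rw [Function.comp_apply, Function.comp_apply, extChartAt_to_inv, smul_eq_mul]

variable [T2Space M] [ConnectedSpace M] [IsManifold I ∞ M]
  {g : ContMDiffRiemannianMetric I ∞ E (fun x : M ↦ TangentSpace I x)}

variable (g) in
-- By the triangle inequality, moving `x` by `δ` changes `d(x, y)² / 2` by at most `δ (d(x, y) +
-- δ)`, and `δ ≤ C ‖w‖ / n` in the difference quotient. The essential point is that the constant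
-- does not depend on `y`.
theorem exists_mfderiv_quadPotential_le (x : M) (w : E) :
    ∃ C, ∀ (y : M) (d : ℝ),
      MDifferentiableAt I 𝓘(ℝ, ℝ) (fun z ↦ quadPotential g.toRiemannianMetric z y) x →
      d = mfderiv I 𝓘(ℝ, ℝ) (fun z ↦ quadPotential g.toRiemannianMetric z y) x w →
      |d| ≤ C * rdist g.toRiemannianMetric x y := by
  obtain ⟨C, hC, hbi⟩ := exists_rdist_bilipschitz g x
  refine ⟨C * ‖w‖, fun y d hf hd ↦ ?_⟩
  have hlim := tendsto_mfderiv hf w hd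
  let z : ℕ → M := fun n ↦ (extChartAt I x).symm (extChartAt I x x + (n : ℝ)⁻¹ • w)
  have hin : Tendsto (fun n : ℕ ↦ extChartAt I x x + (n : ℝ)⁻¹ • w) atTop
      (𝓝 (extChartAt I x x)) := by
    have := ((tendsto_inv_atTop_nhds_zero_nat (𝕜 := ℝ)).smul_const w).const_add
      (extChartAt I x x)
    simpa using this
  have hz : Tendsto z atTop (𝓝 x) := by
    have := (continuousAt_extChartAt_symm (I := I) x).tendsto.comp hin
    rwa [extChartAt_to_inv] at this
  have hdz : Tendsto (fun n ↦ C * ‖w‖ * (rdist g.toRiemannianMetric x y +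
      rdist g.toRiemannianMetric x (z n))) atTop
      (𝓝 (C * ‖w‖ * (rdist g.toRiemannianMetric x y + 0))) := by
    refine (tendsto_const_nhds.add ?_).const_mul _
    have h1 : Tendsto (fun n ↦ rdist g.toRiemannianMetric x (z n)) atTop
        (𝓝 (rdist g.toRiemannianMetric x x)) :=
      ((continuous_rdist g).tendsto (x, x)).comp (tendsto_const_nhds.prodMk_nhds hz)
    rwa [rdist_self] at h1
  rw [add_zero] at hdz
  refine le_of_tendsto_of_tendsto hlim.abs hdz ?_
  filter_upwards [hz.eventually hbi, hin.eventually (extChartAt_target_mem_nhds x),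
    eventually_gt_atTop 0] with n hn hn' hn0
  have hn0' : (0 : ℝ) < n := Nat.cast_pos.2 hn0
  have h1 := hn.2
  have h2 : extChartAt I x (z n) = extChartAt I x x + (n : ℝ)⁻¹ • w :=
    (extChartAt I x).right_inv hn'
  rw [h2, add_sub_cancel_left, norm_smul, norm_inv, Real.norm_of_nonneg hn0'.le] at h1
  rw [abs_mul, abs_of_pos hn0']
  simp only [quadPotential]
  set a := rdist g.toRiemannianMetric (z n) y
  set b := rdist g.toRiemannianMetric x y
  set δ := rdist g.toRiemannianMetric x (z n)
  have ha : 0 ≤ a := rdist_nonneg _ _ _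
  have hb : 0 ≤ b := rdist_nonneg _ _ _
  have hδ : 0 ≤ δ := rdist_nonneg _ _ _
  have t1 : b ≤ δ + a := rdist_triangle g _ _ _
  have t2 : a ≤ δ + b := by
    have := rdist_triangle g (z n) x y
    rwa [rdist_comm _ (z n) x] at this
  change (n : ℝ) * |a ^ 2 / 2 - b ^ 2 / 2| ≤ _
  have h3 : |a ^ 2 / 2 - b ^ 2 / 2| ≤ δ * (b + δ) := by
    rw [abs_le]
    constructor <;> nlinarith
  have h4 : (n : ℝ) * δ ≤ C * ‖w‖ := by
    have := mul_le_mul_of_nonneg_left h1 hn0'.le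
    refine this.trans (le_of_eq ?_)
    field_simp
  calc (n : ℝ) * |a ^ 2 / 2 - b ^ 2 / 2| ≤ n * (δ * (b + δ)) := by gcongr
    _ = (n * δ) * (b + δ) := by ring
    _ ≤ C * ‖w‖ * (b + δ) := by gcongr

variable [MeasurableSpace M] [BorelSpace M]

/-- Measurability in `y` comes from the difference quotients, which are continuous in `y` and
converge pointwise; domination comes from linear growth and the first moment. -/
theorem integrable_mfderiv_quadPotential {U : Set M} (hU : IsOpen U)
    (hconv : GeodesicallyConvex g.toRiemannianMetric U) {ρ : ProbabilityMeasure U}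
    (hρ : HasFiniteFirstMoment g.toRiemannianMetric ρ) {x : M} (hx : x ∈ U) (w : E) {d : U → ℝ}
    (hd : ∀ y : U, d y = mfderiv I 𝓘(ℝ, ℝ) (fun z ↦ quadPotential g.toRiemannianMetric z y) x w) :
    Integrable d (ρ : Measure U) := by
  obtain ⟨C, hC⟩ := exists_mfderiv_quadPotential_le g x w
  have hdiff : ∀ y : U, MDifferentiableAt I 𝓘(ℝ, ℝ)
      (fun z ↦ quadPotential g.toRiemannianMetric z y) x := fun y ↦
    mdifferentiableAt_quadPotential hU hconv hx y.2
  have hmeas : Measurable d := by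
    refine measurable_of_tendsto_metrizable (f := fun (n : ℕ) (y : U) ↦ (n : ℝ) *
      (quadPotential g.toRiemannianMetric
        ((extChartAt I x).symm (extChartAt I x x + (n : ℝ)⁻¹ • w)) y -
        quadPotential g.toRiemannianMetric x y)) (fun n ↦ ?_) ?_
    · have h1 : ∀ z : M, Continuous fun y : U ↦ quadPotential g.toRiemannianMetric z y := fun z ↦
        (((continuous_rdist g).comp (continuous_const.prodMk continuous_subtype_val)).pow
          2).div_const 2
      exact (continuous_const.mul ((h1 _).sub (h1 _))).measurable
    · exact tendsto_pi_nhds.2 fun y ↦ tendsto_mfderiv (hdiff y) w (hd y)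
  refine ((hρ ⟨x, hx⟩).const_mul C).mono' hmeas.aestronglyMeasurable (.of_forall fun y ↦ ?_)
  exact hC y _ (hdiff y) (hd y)

theorem integrable_riemGrad {U : Set M} (hU : IsOpen U)
    (hconv : GeodesicallyConvex g.toRiemannianMetric U) {ρ : ProbabilityMeasure U}
    (hρ : HasFiniteFirstMoment g.toRiemannianMetric ρ) {x : M} (hx : x ∈ U) {F : U → E}
    (hF : ∀ y : U, F y = riemGrad g.toRiemannianMetric
      (fun z ↦ quadPotential g.toRiemannianMetric z y) x) :
    Integrable F (ρ : Measure U) := by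
  obtain ⟨n, b, u, hsum⟩ := exists_riemGrad_eq_sum g.toRiemannianMetric x
  let d : E → U → ℝ := fun w y ↦
    mfderiv I 𝓘(ℝ, ℝ) (fun z ↦ quadPotential g.toRiemannianMetric z y) x w
  have hFeq : F = fun y ↦ ∑ i, d (b i) y • u i := by
    funext y
    obtain ⟨G, hG1, hG2⟩ := hsum (fun z ↦ quadPotential g.toRiemannianMetric z y)
      (fun w ↦ d w y) fun w ↦ rfl
    rw [hF y, ← hG2]
    exact hG1.symm
  rw [hFeq]
  refine integrable_finsetSum _ fun i _ ↦ Integrable.smul_const ?_ _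
  exact integrable_mfderiv_quadPotential hU hconv hρ hx (b i) fun y ↦ rfl

end Gradient

/-! ### The velocity on a product splits into the velocities of the marginals. -/

section ProductVelocity

variable {E₁ : Type*} [NormedAddCommGroup E₁] [NormedSpace ℝ E₁] [FiniteDimensional ℝ E₁]
  {H₁ : Type*} [TopologicalSpace H₁] {I₁ : ModelWithCorners ℝ E₁ H₁} [I₁.Boundaryless]
  {M₁ : Type*} [TopologicalSpace M₁] [T2Space M₁] [ConnectedSpace M₁] [ChartedSpace H₁ M₁]
  [IsManifold I₁ ∞ M₁]
  {E₂ : Type*} [NormedAddCommGroup E₂] [NormedSpace ℝ E₂] [FiniteDimensional ℝ E₂]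
  {H₂ : Type*} [TopologicalSpace H₂] {I₂ : ModelWithCorners ℝ E₂ H₂} [I₂.Boundaryless]
  {M₂ : Type*} [TopologicalSpace M₂] [T2Space M₂] [ConnectedSpace M₂] [ChartedSpace H₂ M₂]
  [IsManifold I₂ ∞ M₂]
  {g₁ : ContMDiffRiemannianMetric I₁ ∞ E₁ (fun x : M₁ ↦ TangentSpace I₁ x)}
  {g₂ : ContMDiffRiemannianMetric I₂ ∞ E₂ (fun x : M₂ ↦ TangentSpace I₂ x)}

omit [FiniteDimensional ℝ E₁] [FiniteDimensional ℝ E₂] [I₁.Boundaryless] [I₂.Boundaryless]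
  [T2Space M₁] [T2Space M₂] in
theorem quadPotential_prod (p q : M₁ × M₂) :
    quadPotential (prodMetric g₁.toRiemannianMetric g₂.toRiemannianMetric) p q =
      quadPotential g₁.toRiemannianMetric p.1 q.1 +
        quadPotential g₂.toRiemannianMetric p.2 q.2 := by
  simp only [quadPotential, rdist_prod_sq]
  ring

omit [I₁.Boundaryless] [I₂.Boundaryless] [T2Space M₁] [T2Space M₂] in
-- Both differentiability hypotheses matter: if one summand failed, `mfderiv` of the sum would take
-- its default value `0` and the other component would be lost.
theorem riemGrad_quadPotential_prod {p q : M₁ × M₂}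
    (h₁ : MDifferentiableAt I₁ 𝓘(ℝ, ℝ) (fun z ↦ quadPotential g₁.toRiemannianMetric z q.1) p.1)
    (h₂ : MDifferentiableAt I₂ 𝓘(ℝ, ℝ) (fun z ↦ quadPotential g₂.toRiemannianMetric z q.2) p.2) :
    riemGrad (prodMetric g₁.toRiemannianMetric g₂.toRiemannianMetric)
        (fun z ↦ quadPotential (prodMetric g₁.toRiemannianMetric g₂.toRiemannianMetric) z q) p =
      (riemGrad g₁.toRiemannianMetric (fun z ↦ quadPotential g₁.toRiemannianMetric z q.1) p.1,
        riemGrad g₂.toRiemannianMetric (fun z ↦ quadPotential g₂.toRiemannianMetric z q.2) p.2) := by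
  let G : E₁ × E₂ :=
    (riemGrad g₁.toRiemannianMetric (fun z ↦ quadPotential g₁.toRiemannianMetric z q.1) p.1,
      riemGrad g₂.toRiemannianMetric (fun z ↦ quadPotential g₂.toRiemannianMetric z q.2) p.2)
  refine (eq_riemGrad (prodMetric g₁.toRiemannianMetric g₂.toRiemannianMetric)
    (fun z ↦ quadPotential (prodMetric g₁.toRiemannianMetric g₂.toRiemannianMetric) z q) p G
    fun w ↦ ?_).symm
  have hK : (fun z ↦ quadPotential (prodMetric g₁.toRiemannianMetric g₂.toRiemannianMetric) z q) =
      (fun z : M₁ × M₂ ↦ quadPotential g₁.toRiemannianMetric z.1 q.1) +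
        (fun z : M₁ × M₂ ↦ quadPotential g₂.toRiemannianMetric z.2 q.2) :=
    funext fun z ↦ quadPotential_prod z q
  have e₁ : HasMFDerivAt (I₁.prod I₂) 𝓘(ℝ, ℝ)
      (fun z : M₁ × M₂ ↦ quadPotential g₁.toRiemannianMetric z.1 q.1) p _ :=
    h₁.hasMFDerivAt.comp p (hasMFDerivAt_fst p)
  have e₂ : HasMFDerivAt (I₁.prod I₂) 𝓘(ℝ, ℝ)
      (fun z : M₁ × M₂ ↦ quadPotential g₂.toRiemannianMetric z.2 q.2) p _ :=
    h₂.hasMFDerivAt.comp p (hasMFDerivAt_snd p)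
  have e := (e₁.add e₂).mfderiv
  rw [hK, e]
  exact congrArg₂ (· + ·) (riemGrad_spec g₁.toRiemannianMetric _ _ w.1)
    (riemGrad_spec g₂.toRiemannianMetric _ _ w.2)

variable [MeasurableSpace M₁] [MeasurableSpace M₂] {U₁ : Set M₁} {U₂ : Set M₂}

/-- The first marginal of a measure on `U₁ × U₂`. -/
def fstMarginal (σ : ProbabilityMeasure (U₁ ×ˢ U₂ : Set (M₁ × M₂))) : ProbabilityMeasure U₁ :=
  σ.map (f := fun p ↦ ⟨p.1.1, p.2.1⟩) (Measurable.aemeasurable (by fun_prop))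

/-- The second marginal of a measure on `U₁ × U₂`. -/
def sndMarginal (σ : ProbabilityMeasure (U₁ ×ˢ U₂ : Set (M₁ × M₂))) : ProbabilityMeasure U₂ :=
  σ.map (f := fun p ↦ ⟨p.1.2, p.2.2⟩) (Measurable.aemeasurable (by fun_prop))

variable [BorelSpace M₁] [BorelSpace M₂]

/-- Each component of the gradient sees one coordinate of `q`, so its integral is an integral
against a marginal. Integrability of both components is needed to split the Bochner integral, which
would otherwise default to `0` as a whole. -/
theorem velocity_prod (hU₁ : IsOpen U₁) (hU₂ : IsOpen U₂)
    (hconv₁ : GeodesicallyConvex g₁.toRiemannianMetric U₁)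
    (hconv₂ : GeodesicallyConvex g₂.toRiemannianMetric U₂)
    {σ : ProbabilityMeasure (U₁ ×ˢ U₂ : Set (M₁ × M₂))}
    (hσ₁ : HasFiniteFirstMoment g₁.toRiemannianMetric (fstMarginal σ))
    (hσ₂ : HasFiniteFirstMoment g₂.toRiemannianMetric (sndMarginal σ))
    {p : M₁ × M₂} (hp : p ∈ U₁ ×ˢ U₂) :
    velocity (prodMetric g₁.toRiemannianMetric g₂.toRiemannianMetric) σ p =
      (velocity g₁.toRiemannianMetric (fstMarginal σ) p.1,
        velocity g₂.toRiemannianMetric (sndMarginal σ) p.2) := by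
  let F₁ : U₁ → E₁ := fun y ↦
    riemGrad g₁.toRiemannianMetric (fun z ↦ quadPotential g₁.toRiemannianMetric z y) p.1
  let F₂ : U₂ → E₂ := fun y ↦
    riemGrad g₂.toRiemannianMetric (fun z ↦ quadPotential g₂.toRiemannianMetric z y) p.2
  have hF₁ : Integrable F₁ (fstMarginal σ : Measure U₁) :=
    integrable_riemGrad hU₁ hconv₁ hσ₁ hp.1 fun y ↦ rfl
  have hF₂ : Integrable F₂ (sndMarginal σ : Measure U₂) :=
    integrable_riemGrad hU₂ hconv₂ hσ₂ hp.2 fun y ↦ rfl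
  let π₁ : (U₁ ×ˢ U₂ : Set (M₁ × M₂)) → U₁ := fun p ↦ ⟨p.1.1, p.2.1⟩
  let π₂ : (U₁ ×ˢ U₂ : Set (M₁ × M₂)) → U₂ := fun p ↦ ⟨p.1.2, p.2.2⟩
  have hπ₁ : Measurable π₁ := by fun_prop
  have hπ₂ : Measurable π₂ := by fun_prop
  have m₁ : (fstMarginal σ : Measure U₁) = (σ : Measure _).map π₁ := rfl
  have m₂ : (sndMarginal σ : Measure U₂) = (σ : Measure _).map π₂ := rfl
  let F : (U₁ ×ˢ U₂ : Set (M₁ × M₂)) → E₁ × E₂ := fun q ↦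
    riemGrad (prodMetric g₁.toRiemannianMetric g₂.toRiemannianMetric)
      (fun z ↦ quadPotential (prodMetric g₁.toRiemannianMetric g₂.toRiemannianMetric) z q) p
  have hF : F = fun q ↦ (F₁ (π₁ q), F₂ (π₂ q)) := funext fun q ↦
    riemGrad_quadPotential_prod (mdifferentiableAt_quadPotential hU₁ hconv₁ hp.1 q.2.1)
      (mdifferentiableAt_quadPotential hU₂ hconv₂ hp.2 q.2.2)
  have key : ∫ q, F q ∂(σ : Measure (U₁ ×ˢ U₂ : Set (M₁ × M₂))) =
      (∫ y, F₁ y ∂(fstMarginal σ : Measure U₁), ∫ y, F₂ y ∂(sndMarginal σ : Measure U₂)) := by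
    rw [hF]
    rw [m₁] at hF₁ ⊢
    rw [m₂] at hF₂ ⊢
    rw [integral_map hπ₁.aemeasurable hF₁.aestronglyMeasurable,
      integral_map hπ₂.aemeasurable hF₂.aestronglyMeasurable]
    exact integral_pair (hF₁.comp_measurable hπ₁) (hF₂.comp_measurable hπ₂)
  exact congrArg Neg.neg key

omit [FiniteDimensional ℝ E₁] [FiniteDimensional ℝ E₂] [I₁.Boundaryless] [I₂.Boundaryless]
  [T2Space M₁] [T2Space M₂] [BorelSpace M₂] in
theorem hasFiniteFirstMoment_fstMarginal {σ : ProbabilityMeasure (U₁ ×ˢ U₂ : Set (M₁ × M₂))}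
    (hσ : HasFiniteFirstMoment (prodMetric g₁.toRiemannianMetric g₂.toRiemannianMetric) σ) :
    HasFiniteFirstMoment g₁.toRiemannianMetric (fstMarginal σ) := by
  intro x₀
  obtain ⟨q⟩ : Nonempty (U₁ ×ˢ U₂ : Set (M₁ × M₂)) :=
    (σ : Measure (U₁ ×ˢ U₂ : Set (M₁ × M₂))).nonempty_of_neZero
  have hc : Continuous fun x : U₁ ↦ rdist g₁.toRiemannianMetric (x₀ : M₁) x :=
    (continuous_rdist g₁).comp (continuous_const.prodMk continuous_subtype_val)
  have hm : Measurable fun p : (U₁ ×ˢ U₂ : Set (M₁ × M₂)) ↦ (⟨p.1.1, p.2.1⟩ : U₁) := by fun_prop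
  change Integrable _ ((σ : Measure (U₁ ×ˢ U₂ : Set (M₁ × M₂))).map _)
  rw [integrable_map_measure hc.measurable.aestronglyMeasurable hm.aemeasurable]
  refine (hσ ⟨(x₀.1, q.1.2), x₀.2, q.2.2⟩).mono' (hc.measurable.comp hm).aestronglyMeasurable
    (.of_forall fun p ↦ ?_)
  refine (Real.norm_of_nonneg (rdist_nonneg _ _ _)).le.trans ?_
  exact rdist_fst_le g₁ g₂ (x₀.1, q.1.2) p.1

omit [FiniteDimensional ℝ E₁] [FiniteDimensional ℝ E₂] [I₁.Boundaryless] [I₂.Boundaryless]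
  [T2Space M₁] [T2Space M₂] [BorelSpace M₁] in
theorem hasFiniteFirstMoment_sndMarginal {σ : ProbabilityMeasure (U₁ ×ˢ U₂ : Set (M₁ × M₂))}
    (hσ : HasFiniteFirstMoment (prodMetric g₁.toRiemannianMetric g₂.toRiemannianMetric) σ) :
    HasFiniteFirstMoment g₂.toRiemannianMetric (sndMarginal σ) := by
  intro x₀
  obtain ⟨q⟩ : Nonempty (U₁ ×ˢ U₂ : Set (M₁ × M₂)) :=
    (σ : Measure (U₁ ×ˢ U₂ : Set (M₁ × M₂))).nonempty_of_neZero
  have hc : Continuous fun x : U₂ ↦ rdist g₂.toRiemannianMetric (x₀ : M₂) x :=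
    (continuous_rdist g₂).comp (continuous_const.prodMk continuous_subtype_val)
  have hm : Measurable fun p : (U₁ ×ˢ U₂ : Set (M₁ × M₂)) ↦ (⟨p.1.2, p.2.2⟩ : U₂) := by fun_prop
  change Integrable _ ((σ : Measure (U₁ ×ˢ U₂ : Set (M₁ × M₂))).map _)
  rw [integrable_map_measure hc.measurable.aestronglyMeasurable hm.aemeasurable]
  refine (hσ ⟨(q.1.1, x₀.1), q.2.1, x₀.2⟩).mono' (hc.measurable.comp hm).aestronglyMeasurable
    (.of_forall fun p ↦ ?_)
  refine (Real.norm_of_nonneg (rdist_nonneg _ _ _)).le.trans ?_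
  exact rdist_snd_le g₁ g₂ (q.1.1, x₀.1) p.1

end ProductVelocity

/-! ### Supports, marginals and measurability on rectangles. -/

section Rectangle

variable {M₁ M₂ : Type*} {U₁ : Set M₁} {U₂ : Set M₂}

/-- The first projection of the rectangle `U₁ × U₂`. -/
def rectFst (p : (U₁ ×ˢ U₂ : Set (M₁ × M₂))) : U₁ := ⟨p.1.1, p.2.1⟩

/-- The second projection of the rectangle `U₁ × U₂`. -/
def rectSnd (p : (U₁ ×ˢ U₂ : Set (M₁ × M₂))) : U₂ := ⟨p.1.2, p.2.2⟩

/-- The point of the rectangle `U₁ × U₂` with the given components. -/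
def rectMk (p : U₁ × U₂) : (U₁ ×ˢ U₂ : Set (M₁ × M₂)) := ⟨(p.1.1, p.2.1), p.1.2, p.2.2⟩

section Topology

variable [TopologicalSpace M₁] [TopologicalSpace M₂]

theorem continuous_rectFst : Continuous (rectFst : (U₁ ×ˢ U₂ : Set (M₁ × M₂)) → U₁) :=
  (continuous_fst.comp continuous_subtype_val).subtype_mk _

theorem continuous_rectSnd : Continuous (rectSnd : (U₁ ×ˢ U₂ : Set (M₁ × M₂)) → U₂) :=
  (continuous_snd.comp continuous_subtype_val).subtype_mk _

theorem continuous_rectMk : Continuous (rectMk : U₁ × U₂ → (U₁ ×ˢ U₂ : Set (M₁ × M₂))) :=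
  ((continuous_subtype_val.comp continuous_fst).prodMk
    (continuous_subtype_val.comp continuous_snd)).subtype_mk _

end Topology

variable [MeasurableSpace M₁] [MeasurableSpace M₂]

theorem measurable_rectFst : Measurable (rectFst : (U₁ ×ˢ U₂ : Set (M₁ × M₂)) → U₁) :=
  (measurable_fst.comp measurable_subtype_coe).subtype_mk

theorem measurable_rectSnd : Measurable (rectSnd : (U₁ ×ˢ U₂ : Set (M₁ × M₂)) → U₂) :=
  (measurable_snd.comp measurable_subtype_coe).subtype_mk

theorem measurable_rectMk : Measurable (rectMk : U₁ × U₂ → (U₁ ×ˢ U₂ : Set (M₁ × M₂))) :=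
  ((measurable_subtype_coe.comp measurable_fst).prodMk
    (measurable_subtype_coe.comp measurable_snd)).subtype_mk

theorem toMeasure_tensor (ρ₁ : ProbabilityMeasure U₁) (ρ₂ : ProbabilityMeasure U₂) :
    (tensor ρ₁ ρ₂ : Measure (U₁ ×ˢ U₂ : Set (M₁ × M₂))) =
      ((ρ₁ : Measure U₁).prod (ρ₂ : Measure U₂)).map rectMk := rfl

theorem toMeasure_fstMarginal (σ : ProbabilityMeasure (U₁ ×ˢ U₂ : Set (M₁ × M₂))) :
    (fstMarginal σ : Measure U₁) = (σ : Measure (U₁ ×ˢ U₂ : Set (M₁ × M₂))).map rectFst := rfl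

theorem toMeasure_sndMarginal (σ : ProbabilityMeasure (U₁ ×ˢ U₂ : Set (M₁ × M₂))) :
    (sndMarginal σ : Measure U₂) = (σ : Measure (U₁ ×ˢ U₂ : Set (M₁ × M₂))).map rectSnd := rfl

@[simp] theorem fstMarginal_tensor (ρ₁ : ProbabilityMeasure U₁) (ρ₂ : ProbabilityMeasure U₂) :
    fstMarginal (tensor ρ₁ ρ₂) = ρ₁ := by
  apply Subtype.ext
  change (fstMarginal (tensor ρ₁ ρ₂) : Measure U₁) = ρ₁
  rw [toMeasure_fstMarginal, toMeasure_tensor, Measure.map_map measurable_rectFst measurable_rectMk]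
  change ((ρ₁ : Measure U₁).prod (ρ₂ : Measure U₂)).map Prod.fst = ρ₁
  simp

@[simp] theorem sndMarginal_tensor (ρ₁ : ProbabilityMeasure U₁) (ρ₂ : ProbabilityMeasure U₂) :
    sndMarginal (tensor ρ₁ ρ₂) = ρ₂ := by
  apply Subtype.ext
  change (sndMarginal (tensor ρ₁ ρ₂) : Measure U₂) = ρ₂
  rw [toMeasure_sndMarginal, toMeasure_tensor, Measure.map_map measurable_rectSnd measurable_rectMk]
  change ((ρ₁ : Measure U₁).prod (ρ₂ : Measure U₂)).map Prod.snd = ρ₂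
  simp

/-- With `rectFst_mem_support` and `rectSnd_mem_support`, the support of a product measure is the
product of the supports, so starting points can be recombined coordinatewise. -/
theorem rectMk_mem_support_tensor [TopologicalSpace M₁] [TopologicalSpace M₂]
    {ρ₁ : ProbabilityMeasure U₁} {ρ₂ : ProbabilityMeasure U₂} {x : U₁} {y : U₂}
    (hx : x ∈ (ρ₁ : Measure U₁).support) (hy : y ∈ (ρ₂ : Measure U₂).support) :
    rectMk (x, y) ∈ (tensor ρ₁ ρ₂ : Measure (U₁ ×ˢ U₂ : Set (M₁ × M₂))).support := by
  rw [Measure.mem_support_iff_forall] at hx hy ⊢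
  intro N hN
  obtain ⟨A, hA, B, hB, hAB⟩ := mem_nhds_prod_iff.1
    (continuous_rectMk.continuousAt.preimage_mem_nhds hN)
  rw [toMeasure_tensor]
  calc 0 < (ρ₁ : Measure U₁) A * (ρ₂ : Measure U₂) B :=
        ENNReal.mul_pos (hx A hA).ne' (hy B hB).ne'
    _ = ((ρ₁ : Measure U₁).prod (ρ₂ : Measure U₂)) (A ×ˢ B) := (Measure.prod_prod _ _).symm
    _ ≤ ((ρ₁ : Measure U₁).prod (ρ₂ : Measure U₂)) (rectMk ⁻¹' N) := measure_mono hAB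
    _ ≤ _ := Measure.le_map_apply measurable_rectMk.aemeasurable _

theorem map_mem_support {X Y : Type*} [TopologicalSpace X] [TopologicalSpace Y]
    [MeasurableSpace X] [MeasurableSpace Y] {μ : Measure X} {f : X → Y} (hf : Continuous f)
    (hm : AEMeasurable f μ) {x : X} (hx : x ∈ μ.support) : f x ∈ (μ.map f).support := by
  rw [Measure.mem_support_iff_forall] at hx ⊢
  exact fun N hN ↦ (hx _ (hf.continuousAt.preimage_mem_nhds hN)).trans_le
    (Measure.le_map_apply hm _)

theorem rectFst_mem_support [TopologicalSpace M₁] [TopologicalSpace M₂]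
    {ρ₁ : ProbabilityMeasure U₁} {ρ₂ : ProbabilityMeasure U₂} {p : (U₁ ×ˢ U₂ : Set (M₁ × M₂))}
    (hp : p ∈ (tensor ρ₁ ρ₂ : Measure (U₁ ×ˢ U₂ : Set (M₁ × M₂))).support) :
    rectFst p ∈ (ρ₁ : Measure U₁).support := by
  have h := map_mem_support continuous_rectFst measurable_rectFst.aemeasurable hp
  rwa [← toMeasure_fstMarginal, fstMarginal_tensor] at h

theorem rectSnd_mem_support [TopologicalSpace M₁] [TopologicalSpace M₂]
    {ρ₁ : ProbabilityMeasure U₁} {ρ₂ : ProbabilityMeasure U₂} {p : (U₁ ×ˢ U₂ : Set (M₁ × M₂))}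
    (hp : p ∈ (tensor ρ₁ ρ₂ : Measure (U₁ ×ˢ U₂ : Set (M₁ × M₂))).support) :
    rectSnd p ∈ (ρ₂ : Measure U₂).support := by
  have h := map_mem_support continuous_rectSnd measurable_rectSnd.aemeasurable hp
  rwa [← toMeasure_sndMarginal, sndMarginal_tensor] at h

/-- Fubini: a measurable version on the product agrees with `f` almost everywhere on almost every
slice, and one such slice is a measurable version of `f`. -/
theorem aemeasurable_of_comp_fst {X Y Z : Type*} [MeasurableSpace X] [MeasurableSpace Y]
    [MeasurableSpace Z] {μ : Measure X} {ν : Measure Y} [SFinite μ] [SFinite ν] [NeZero ν]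
    {f : X → Z} (hf : AEMeasurable (fun p : X × Y ↦ f p.1) (μ.prod ν)) : AEMeasurable f μ := by
  obtain ⟨h, hh, he⟩ := hf
  rw [← Measure.prod_swap] at he
  have h1 : ∀ᵐ q ∂ν.prod μ, f q.2 = h (q.2, q.1) :=
    ae_of_ae_map measurable_swap.aemeasurable he
  obtain ⟨y, hy⟩ := (Measure.ae_ae_of_ae_prod h1).exists
  exact ⟨fun x ↦ h (x, y), hh.comp measurable_prodMk_right, hy⟩

theorem aemeasurable_of_comp_snd {X Y Z : Type*} [MeasurableSpace X] [MeasurableSpace Y]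
    [MeasurableSpace Z] {μ : Measure X} {ν : Measure Y} [SFinite μ] [SFinite ν] [NeZero μ]
    {f : Y → Z} (hf : AEMeasurable (fun p : X × Y ↦ f p.2) (μ.prod ν)) : AEMeasurable f ν := by
  obtain ⟨h, hh, he⟩ := hf
  obtain ⟨x, hx⟩ := (Measure.ae_ae_of_ae_prod he).exists
  exact ⟨fun y ↦ h (x, y), hh.comp measurable_prodMk_left, hx⟩

theorem map_prodMap_of_aemeasurable {X Y X' Y' : Type*} [MeasurableSpace X] [MeasurableSpace Y]
    [MeasurableSpace X'] [MeasurableSpace Y'] {μ : Measure X} {ν : Measure Y}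
    [IsProbabilityMeasure μ] [IsProbabilityMeasure ν]
    {f : X → X'} {g : Y → Y'} (hf : AEMeasurable f μ) (hg : AEMeasurable g ν) :
    (μ.prod ν).map (Prod.map f g) = (μ.map f).prod (ν.map g) := by
  rw [Measure.map_congr hf.ae_eq_mk, Measure.map_congr hg.ae_eq_mk,
    Measure.map_prod_map _ _ hf.measurable_mk hg.measurable_mk]
  refine Measure.map_congr ?_
  filter_upwards [Measure.quasiMeasurePreserving_fst.ae hf.ae_eq_mk,
    Measure.quasiMeasurePreserving_snd.ae hg.ae_eq_mk] with p h₁ h₂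
  exact Prod.ext h₁ h₂

end Rectangle

/-! ### Narrow continuity of tensor products and marginals. -/

section Narrow

variable {M₁ M₂ : Type*} [TopologicalSpace M₁] [TopologicalSpace M₂]
  [MeasurableSpace M₁] [MeasurableSpace M₂] [BorelSpace M₁] [BorelSpace M₂]
  [SecondCountableTopology M₁] [SecondCountableTopology M₂] {U₁ : Set M₁} {U₂ : Set M₂}

theorem continuous_tensor [TopologicalSpace.PseudoMetrizableSpace M₁]
    [TopologicalSpace.PseudoMetrizableSpace M₂] :
    Continuous fun p : ProbabilityMeasure U₁ × ProbabilityMeasure U₂ ↦ tensor p.1 p.2 :=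
  (ProbabilityMeasure.continuous_map continuous_rectMk).comp ProbabilityMeasure.continuous_prod

omit [SecondCountableTopology M₁] in
theorem continuous_fstMarginal :
    Continuous (fstMarginal : ProbabilityMeasure (U₁ ×ˢ U₂ : Set (M₁ × M₂)) → _) :=
  ProbabilityMeasure.continuous_map continuous_rectFst

omit [SecondCountableTopology M₁] in
theorem continuous_sndMarginal :
    Continuous (sndMarginal : ProbabilityMeasure (U₁ ×ˢ U₂ : Set (M₁ × M₂)) → _) :=
  ProbabilityMeasure.continuous_map continuous_rectSnd

end Narrow

/-! ### Wasserstein estimates for tensor products and marginals. -/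

section Wasserstein

variable {E₁ : Type*} [NormedAddCommGroup E₁] [NormedSpace ℝ E₁]
  {H₁ : Type*} [TopologicalSpace H₁] {I₁ : ModelWithCorners ℝ E₁ H₁}
  {M₁ : Type*} [TopologicalSpace M₁] [ConnectedSpace M₁] [ChartedSpace H₁ M₁]
  [IsManifold I₁ ∞ M₁] [MeasurableSpace M₁] [BorelSpace M₁] [SecondCountableTopology M₁]
  {E₂ : Type*} [NormedAddCommGroup E₂] [NormedSpace ℝ E₂]
  {H₂ : Type*} [TopologicalSpace H₂] {I₂ : ModelWithCorners ℝ E₂ H₂}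
  {M₂ : Type*} [TopologicalSpace M₂] [ConnectedSpace M₂] [ChartedSpace H₂ M₂]
  [IsManifold I₂ ∞ M₂] [MeasurableSpace M₂] [BorelSpace M₂] [SecondCountableTopology M₂]
  {g₁ : ContMDiffRiemannianMetric I₁ ∞ E₁ (fun x : M₁ ↦ TangentSpace I₁ x)}
  {g₂ : ContMDiffRiemannianMetric I₂ ∞ E₂ (fun x : M₂ ↦ TangentSpace I₂ x)}
  {U₁ : Set M₁} {U₂ : Set M₂}

theorem measurable_rdist :
    Measurable fun p : U₁ × U₁ ↦ rdist g₁.toRiemannianMetric (p.1 : M₁) p.2 :=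
  ((continuous_rdist g₁).comp ((continuous_subtype_val.comp continuous_fst).prodMk
    (continuous_subtype_val.comp continuous_snd))).measurable

theorem W1_le {E : Type*} [NormedAddCommGroup E] [NormedSpace ℝ E]
    {H : Type*} [TopologicalSpace H] {I : ModelWithCorners ℝ E H}
    {M : Type*} [TopologicalSpace M] [ChartedSpace H M] [MeasurableSpace M]
    (g : RiemannianMetric (fun x : M ↦ TangentSpace I x)) {U : Set M}
    {ρ σ : ProbabilityMeasure U} {η : Measure (U × U)}
    (h₁ : η.map Prod.fst = ρ) (h₂ : η.map Prod.snd = σ) :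
    W1 g ρ σ ≤ ∫⁻ p, ENNReal.ofReal (rdist g (p.1 : M) p.2) ∂η :=
  iInf₂_le η ⟨h₁, h₂⟩

theorem measurable_rdist_prod : Measurable fun p : (U₁ ×ˢ U₂ : Set (M₁ × M₂)) ×
      (U₁ ×ˢ U₂ : Set (M₁ × M₂)) ↦
    rdist (prodMetric g₁.toRiemannianMetric g₂.toRiemannianMetric) (p.1 : M₁ × M₂) p.2 :=
  ((continuous_rdist_prod g₁ g₂).comp ((continuous_subtype_val.comp continuous_fst).prodMk
    (continuous_subtype_val.comp continuous_snd))).measurable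

theorem hasFiniteFirstMoment_tensor {ρ₁ : ProbabilityMeasure U₁} {ρ₂ : ProbabilityMeasure U₂}
    (h₁ : HasFiniteFirstMoment g₁.toRiemannianMetric ρ₁)
    (h₂ : HasFiniteFirstMoment g₂.toRiemannianMetric ρ₂) :
    HasFiniteFirstMoment (prodMetric g₁.toRiemannianMetric g₂.toRiemannianMetric)
      (tensor ρ₁ ρ₂) := by
  intro x₀
  have hm : Measurable fun p : (U₁ ×ˢ U₂ : Set (M₁ × M₂)) ↦
      rdist (prodMetric g₁.toRiemannianMetric g₂.toRiemannianMetric) (x₀ : M₁ × M₂) p :=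
    measurable_rdist_prod.comp (measurable_const.prodMk measurable_id)
  rw [toMeasure_tensor,
    integrable_map_measure hm.aestronglyMeasurable measurable_rectMk.aemeasurable]
  refine (((h₁ (rectFst x₀)).comp_fst _).add ((h₂ (rectSnd x₀)).comp_snd _)).mono'
    (hm.comp measurable_rectMk).aestronglyMeasurable (.of_forall fun p ↦ ?_)
  refine (Real.norm_of_nonneg (rdist_nonneg _ _ _)).le.trans ?_
  exact rdist_prod_le g₁ g₂ x₀.1 (rectMk p).1

/-- The product of two plans, with its coordinates regrouped, is a plan between the tensor products,
and its cost is at most the sum by `rdist_prod_le`. -/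
theorem W1_tensor_le (ρ₁ σ₁ : ProbabilityMeasure U₁) (ρ₂ σ₂ : ProbabilityMeasure U₂) :
    W1 (prodMetric g₁.toRiemannianMetric g₂.toRiemannianMetric) (tensor ρ₁ ρ₂) (tensor σ₁ σ₂) ≤
      W1 g₁.toRiemannianMetric ρ₁ σ₁ + W1 g₂.toRiemannianMetric ρ₂ σ₂ := by
  simp_rw [W1.eq_def g₁.toRiemannianMetric, W1.eq_def g₂.toRiemannianMetric, ENNReal.iInf_add,
    ENNReal.add_iInf]
  refine le_iInf fun π₁ ↦ le_iInf fun hπ₁ ↦ le_iInf fun π₂ ↦ le_iInf fun hπ₂ ↦ ?_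
  have : IsProbabilityMeasure π₁ := ⟨by
    rw [← Set.preimage_univ (f := Prod.fst), ← Measure.map_apply measurable_fst .univ, hπ₁.1,
      measure_univ]⟩
  have : IsProbabilityMeasure π₂ := ⟨by
    rw [← Set.preimage_univ (f := Prod.fst), ← Measure.map_apply measurable_fst .univ, hπ₂.1,
      measure_univ]⟩
  let f : (U₁ × U₁) × (U₂ × U₂) →
      (U₁ ×ˢ U₂ : Set (M₁ × M₂)) × (U₁ ×ˢ U₂ : Set (M₁ × M₂)) :=
    fun q ↦ (rectMk (q.1.1, q.2.1), rectMk (q.1.2, q.2.2))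
  have hf : Measurable f :=
    (measurable_rectMk.comp (by fun_prop)).prodMk (measurable_rectMk.comp (by fun_prop))
  refine (W1_le _ (η := (π₁.prod π₂).map f) ?_ ?_).trans ?_
  · rw [Measure.map_map measurable_fst hf, toMeasure_tensor, ← hπ₁.1, ← hπ₂.1,
      Measure.map_prod_map _ _ measurable_fst measurable_fst,
      Measure.map_map measurable_rectMk (by fun_prop)]
    rfl
  · rw [Measure.map_map measurable_snd hf, toMeasure_tensor, ← hπ₁.2, ← hπ₂.2,
      Measure.map_prod_map _ _ measurable_snd measurable_snd,
      Measure.map_map measurable_rectMk (by fun_prop)]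
    rfl
  · rw [lintegral_map measurable_rdist_prod.ennreal_ofReal hf]
    have e₁ := (measurePreserving_fst (μ := π₁) (ν := π₂)).lintegral_comp
      (measurable_rdist (g₁ := g₁) (U₁ := U₁)).ennreal_ofReal
    have e₂ := (measurePreserving_snd (μ := π₁) (ν := π₂)).lintegral_comp
      (measurable_rdist (g₁ := g₂) (U₁ := U₂)).ennreal_ofReal
    rw [← e₁, ← e₂]
    refine (lintegral_mono fun q ↦ ?_).trans (lintegral_add_left
      ((measurable_rdist (g₁ := g₁) (U₁ := U₁)).ennreal_ofReal.comp measurable_fst) _).le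
    refine le_trans ?_ (ENNReal.ofReal_add (rdist_nonneg _ _ _) (rdist_nonneg _ _ _)).le
    exact ENNReal.ofReal_le_ofReal (rdist_prod_le g₁ g₂ (f q).1.1 (f q).2.1)

omit [BorelSpace M₂] [SecondCountableTopology M₂] in
-- The projection does not increase distances, so pushing a plan forward along it does not increase
-- the cost.
theorem W1_fstMarginal_le (σ τ : ProbabilityMeasure (U₁ ×ˢ U₂ : Set (M₁ × M₂))) :
    W1 g₁.toRiemannianMetric (fstMarginal σ) (fstMarginal τ) ≤
      W1 (prodMetric g₁.toRiemannianMetric g₂.toRiemannianMetric) σ τ := by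
  refine le_iInf₂ fun η hη ↦ ?_
  have hf := measurable_rectFst (U₁ := U₁) (U₂ := U₂)
  refine (W1_le _ (η := η.map (Prod.map rectFst rectFst)) ?_ ?_).trans ?_
  · rw [Measure.map_map measurable_fst (hf.prodMap hf), toMeasure_fstMarginal, ← hη.1,
      Measure.map_map hf measurable_fst]
    rfl
  · rw [Measure.map_map measurable_snd (hf.prodMap hf), toMeasure_fstMarginal, ← hη.2,
      Measure.map_map hf measurable_snd]
    rfl
  · rw [lintegral_map measurable_rdist.ennreal_ofReal (hf.prodMap hf)]
    exact lintegral_mono fun q ↦ ENNReal.ofReal_le_ofReal (rdist_fst_le g₁ g₂ q.1.1 q.2.1)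

omit [BorelSpace M₁] [SecondCountableTopology M₁] in
theorem W1_sndMarginal_le (σ τ : ProbabilityMeasure (U₁ ×ˢ U₂ : Set (M₁ × M₂))) :
    W1 g₂.toRiemannianMetric (sndMarginal σ) (sndMarginal τ) ≤
      W1 (prodMetric g₁.toRiemannianMetric g₂.toRiemannianMetric) σ τ := by
  refine le_iInf₂ fun η hη ↦ ?_
  have hf := measurable_rectSnd (U₁ := U₁) (U₂ := U₂)
  refine (W1_le _ (η := η.map (Prod.map rectSnd rectSnd)) ?_ ?_).trans ?_
  · rw [Measure.map_map measurable_fst (hf.prodMap hf), toMeasure_sndMarginal, ← hη.1,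
      Measure.map_map hf measurable_fst]
    rfl
  · rw [Measure.map_map measurable_snd (hf.prodMap hf), toMeasure_sndMarginal, ← hη.2,
      Measure.map_map hf measurable_snd]
    rfl
  · rw [lintegral_map measurable_rdist.ennreal_ofReal (hf.prodMap hf)]
    exact lintegral_mono fun q ↦ ENNReal.ofReal_le_ofReal (rdist_snd_le g₁ g₂ q.1.1 q.2.1)

end Wasserstein

/-! ### Stability of the two classes of curves. -/

section Curves

variable {E₁ : Type*} [NormedAddCommGroup E₁] [NormedSpace ℝ E₁]
  {H₁ : Type*} [TopologicalSpace H₁] {I₁ : ModelWithCorners ℝ E₁ H₁}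
  {M₁ : Type*} [TopologicalSpace M₁] [ConnectedSpace M₁] [ChartedSpace H₁ M₁]
  [IsManifold I₁ ∞ M₁] [MeasurableSpace M₁] [BorelSpace M₁] [SecondCountableTopology M₁]
  {E₂ : Type*} [NormedAddCommGroup E₂] [NormedSpace ℝ E₂]
  {H₂ : Type*} [TopologicalSpace H₂] {I₂ : ModelWithCorners ℝ E₂ H₂}
  {M₂ : Type*} [TopologicalSpace M₂] [ConnectedSpace M₂] [ChartedSpace H₂ M₂]
  [IsManifold I₂ ∞ M₂] [MeasurableSpace M₂] [BorelSpace M₂] [SecondCountableTopology M₂]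
  {g₁ : ContMDiffRiemannianMetric I₁ ∞ E₁ (fun x : M₁ ↦ TangentSpace I₁ x)}
  {g₂ : ContMDiffRiemannianMetric I₂ ∞ E₂ (fun x : M₂ ↦ TangentSpace I₂ x)}
  {U₁ : Set M₁} {U₂ : Set M₂} {T : EReal}

theorem tensor_mem_narrowCurves [TopologicalSpace.PseudoMetrizableSpace M₁]
    [TopologicalSpace.PseudoMetrizableSpace M₂] {ρ₁ : ℝ → ProbabilityMeasure U₁}
    {ρ₂ : ℝ → ProbabilityMeasure U₂} (h₁ : ρ₁ ∈ narrowCurves g₁.toRiemannianMetric U₁ T)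
    (h₂ : ρ₂ ∈ narrowCurves g₂.toRiemannianMetric U₂ T) :
    (fun t ↦ tensor (ρ₁ t) (ρ₂ t)) ∈
      narrowCurves (prodMetric g₁.toRiemannianMetric g₂.toRiemannianMetric) (U₁ ×ˢ U₂) T :=
  ⟨fun t ht ↦ hasFiniteFirstMoment_tensor (h₁.1 t ht) (h₂.1 t ht),
    continuous_tensor.comp_continuousOn (h₁.2.prodMk h₂.2)⟩

omit [SecondCountableTopology M₁] in
theorem fstMarginal_mem_narrowCurves {σ : ℝ → ProbabilityMeasure (U₁ ×ˢ U₂ : Set (M₁ × M₂))}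
    (h : σ ∈ narrowCurves (prodMetric g₁.toRiemannianMetric g₂.toRiemannianMetric) (U₁ ×ˢ U₂) T) :
    (fun t ↦ fstMarginal (σ t)) ∈ narrowCurves g₁.toRiemannianMetric U₁ T :=
  ⟨fun t ht ↦ hasFiniteFirstMoment_fstMarginal (h.1 t ht),
    continuous_fstMarginal.comp_continuousOn h.2⟩

omit [SecondCountableTopology M₁] in
theorem sndMarginal_mem_narrowCurves {σ : ℝ → ProbabilityMeasure (U₁ ×ˢ U₂ : Set (M₁ × M₂))}
    (h : σ ∈ narrowCurves (prodMetric g₁.toRiemannianMetric g₂.toRiemannianMetric) (U₁ ×ˢ U₂) T) :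
    (fun t ↦ sndMarginal (σ t)) ∈ narrowCurves g₂.toRiemannianMetric U₂ T :=
  ⟨fun t ht ↦ hasFiniteFirstMoment_sndMarginal (h.1 t ht),
    continuous_sndMarginal.comp_continuousOn h.2⟩

theorem tensor_mem_wassersteinCurves {ρ₁ : ℝ → ProbabilityMeasure U₁}
    {ρ₂ : ℝ → ProbabilityMeasure U₂} (h₁ : ρ₁ ∈ wassersteinCurves g₁.toRiemannianMetric U₁ T)
    (h₂ : ρ₂ ∈ wassersteinCurves g₂.toRiemannianMetric U₂ T) :
    (fun t ↦ tensor (ρ₁ t) (ρ₂ t)) ∈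
      wassersteinCurves (prodMetric g₁.toRiemannianMetric g₂.toRiemannianMetric) (U₁ ×ˢ U₂) T := by
  refine ⟨fun t ht ↦ hasFiniteFirstMoment_tensor (h₁.1 t ht) (h₂.1 t ht), fun t ht ↦ ?_⟩
  have h := (h₁.2 t ht).add (h₂.2 t ht)
  rw [add_zero] at h
  exact tendsto_of_tendsto_of_tendsto_of_le_of_le tendsto_const_nhds h (fun _ ↦ zero_le)
    fun s ↦ W1_tensor_le _ _ _ _

omit [BorelSpace M₂] [SecondCountableTopology M₂] in
theorem fstMarginal_mem_wassersteinCurves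
    {σ : ℝ → ProbabilityMeasure (U₁ ×ˢ U₂ : Set (M₁ × M₂))}
    (h : σ ∈ wassersteinCurves (prodMetric g₁.toRiemannianMetric g₂.toRiemannianMetric)
      (U₁ ×ˢ U₂) T) :
    (fun t ↦ fstMarginal (σ t)) ∈ wassersteinCurves g₁.toRiemannianMetric U₁ T :=
  ⟨fun t ht ↦ hasFiniteFirstMoment_fstMarginal (h.1 t ht), fun t ht ↦
    tendsto_of_tendsto_of_tendsto_of_le_of_le tendsto_const_nhds (h.2 t ht) (fun _ ↦ zero_le)
      fun _ ↦ W1_fstMarginal_le _ _⟩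

omit [BorelSpace M₁] [SecondCountableTopology M₁] in
theorem sndMarginal_mem_wassersteinCurves
    {σ : ℝ → ProbabilityMeasure (U₁ ×ˢ U₂ : Set (M₁ × M₂))}
    (h : σ ∈ wassersteinCurves (prodMetric g₁.toRiemannianMetric g₂.toRiemannianMetric)
      (U₁ ×ˢ U₂) T) :
    (fun t ↦ sndMarginal (σ t)) ∈ wassersteinCurves g₂.toRiemannianMetric U₂ T :=
  ⟨fun t ht ↦ hasFiniteFirstMoment_sndMarginal (h.1 t ht), fun t ht ↦
    tendsto_of_tendsto_of_tendsto_of_le_of_le tendsto_const_nhds (h.2 t ht) (fun _ ↦ zero_le)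
      fun _ ↦ W1_sndMarginal_le _ _⟩

end Curves

/-! ### Weak solutions in terms of single trajectories. -/

section Trajectory

variable {E : Type*} [NormedAddCommGroup E] [NormedSpace ℝ E]
  {H : Type*} [TopologicalSpace H] {I : ModelWithCorners ℝ E H}
  {M : Type*} [TopologicalSpace M] [ChartedSpace H M] [MeasurableSpace M]

/-- `γ` is a trajectory of the velocity field of `ρ` that starts from `x`. -/
def IsTrajectory (g : RiemannianMetric (fun x : M ↦ TangentSpace I x)) {U : Set M} (T : EReal)
    (ρ : ℝ → ProbabilityMeasure U) (x : U) (γ : ℝ → U) : Prop :=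
  γ 0 = x ∧ ∀ t ∈ timeInterval T,
    HasMFDerivWithinAt 𝓘(ℝ, ℝ) I (fun s ↦ (γ s : M)) (timeInterval T) t
      ((1 : ℝ →L[ℝ] ℝ).smulRight (velocity g (ρ t) (γ t : M)))

variable {g : RiemannianMetric (fun x : M ↦ TangentSpace I x)} {U : Set M} {T : EReal}
  {ρ σ : ℝ → ProbabilityMeasure U}

theorem IsTrajectory.congr {x : U} {γ : ℝ → U} (h : IsTrajectory g T ρ x γ)
    (hρσ : EqOn ρ σ (timeInterval T)) : IsTrajectory g T σ x γ :=
  ⟨h.1, fun t ht ↦ hρσ ht ▸ h.2 t ht⟩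

/-- No regularity in `x` is part of a flow map, so it may be altered at one starting point.
Uniqueness of the flow map is thus uniqueness of each trajectory. -/
theorem isWeakSolution_iff : IsWeakSolution g T ρ ↔ ∃ Ψ : U → ℝ → U,
    (∀ x ∈ (ρ 0 : Measure U).support, IsTrajectory g T ρ x (Ψ x) ∧
      ∀ γ, IsTrajectory g T ρ x γ → EqOn γ (Ψ x) (timeInterval T)) ∧
    ∀ t ∈ timeInterval T,
      AEMeasurable (fun x ↦ Ψ x t) (ρ 0 : Measure U) ∧
      (ρ t : Measure U) = (ρ 0 : Measure U).map fun x ↦ Ψ x t := by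
  constructor
  · rintro ⟨Ψ, hΨ, huniq, hpush⟩
    refine ⟨Ψ, fun x hx ↦ ⟨hΨ x hx, fun γ hγ t ht ↦ ?_⟩, hpush⟩
    classical
    have h : IsFlowMap g T ρ (ρ 0 : Measure U).support (Function.update Ψ x γ) := by
      intro y hy
      change IsTrajectory g T ρ y (Function.update Ψ x γ y)
      rcases eq_or_ne y x with rfl | hne
      · rwa [Function.update_self]
      · rw [Function.update_of_ne hne]
        exact hΨ y hy
    have h1 := huniq _ h x hx t ht
    rwa [Function.update_self] at h1
  · rintro ⟨Ψ, hΨ, hpush⟩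
    exact ⟨Ψ, fun x hx ↦ (hΨ x hx).1, fun Ψ' hΨ' x hx t ht ↦ (hΨ x hx).2 _ (hΨ' x hx) ht, hpush⟩

end Trajectory

/-! ### Decoupling of trajectories. -/

section ProductTrajectory

variable {E₁ : Type*} [NormedAddCommGroup E₁] [NormedSpace ℝ E₁] [FiniteDimensional ℝ E₁]
  {H₁ : Type*} [TopologicalSpace H₁] {I₁ : ModelWithCorners ℝ E₁ H₁} [I₁.Boundaryless]
  {M₁ : Type*} [TopologicalSpace M₁] [T2Space M₁] [ConnectedSpace M₁] [ChartedSpace H₁ M₁]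
  [IsManifold I₁ ∞ M₁] [MeasurableSpace M₁] [BorelSpace M₁]
  {E₂ : Type*} [NormedAddCommGroup E₂] [NormedSpace ℝ E₂] [FiniteDimensional ℝ E₂]
  {H₂ : Type*} [TopologicalSpace H₂] {I₂ : ModelWithCorners ℝ E₂ H₂} [I₂.Boundaryless]
  {M₂ : Type*} [TopologicalSpace M₂] [T2Space M₂] [ConnectedSpace M₂] [ChartedSpace H₂ M₂]
  [IsManifold I₂ ∞ M₂] [MeasurableSpace M₂] [BorelSpace M₂]
  {g₁ : ContMDiffRiemannianMetric I₁ ∞ E₁ (fun x : M₁ ↦ TangentSpace I₁ x)}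
  {g₂ : ContMDiffRiemannianMetric I₂ ∞ E₂ (fun x : M₂ ↦ TangentSpace I₂ x)}
  {U₁ : Set M₁} {U₂ : Set M₂} {T : EReal}

/-- The ODE form of `velocity_prod`. As `σ` need not be a tensor product, it applies to arbitrary
competitors in the uniqueness proof. -/
theorem isTrajectory_prod_iff (hU₁ : IsOpen U₁) (hU₂ : IsOpen U₂)
    (hconv₁ : GeodesicallyConvex g₁.toRiemannianMetric U₁)
    (hconv₂ : GeodesicallyConvex g₂.toRiemannianMetric U₂)
    {σ : ℝ → ProbabilityMeasure (U₁ ×ˢ U₂ : Set (M₁ × M₂))}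
    (hσ₁ : ∀ t ∈ timeInterval T, HasFiniteFirstMoment g₁.toRiemannianMetric (fstMarginal (σ t)))
    (hσ₂ : ∀ t ∈ timeInterval T, HasFiniteFirstMoment g₂.toRiemannianMetric (sndMarginal (σ t)))
    {p : (U₁ ×ˢ U₂ : Set (M₁ × M₂))} {γ : ℝ → (U₁ ×ˢ U₂ : Set (M₁ × M₂))} :
    IsTrajectory (prodMetric g₁.toRiemannianMetric g₂.toRiemannianMetric) T σ p γ ↔
      IsTrajectory g₁.toRiemannianMetric T (fun t ↦ fstMarginal (σ t)) (rectFst p)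
        (fun t ↦ rectFst (γ t)) ∧
      IsTrajectory g₂.toRiemannianMetric T (fun t ↦ sndMarginal (σ t)) (rectSnd p)
        (fun t ↦ rectSnd (γ t)) := by
  constructor
  · rintro ⟨h0, h⟩
    have key : ∀ t ∈ timeInterval T,
        HasMFDerivWithinAt 𝓘(ℝ, ℝ) (I₁.prod I₂) (fun s ↦ (γ s : M₁ × M₂)) (timeInterval T) t
          ((1 : ℝ →L[ℝ] ℝ).smulRight
            ((velocity g₁.toRiemannianMetric (fstMarginal (σ t)) (γ t).1.1,
              velocity g₂.toRiemannianMetric (sndMarginal (σ t)) (γ t).1.2) : E₁ × E₂)) := by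
      intro t ht
      have h1 := h t ht
      rwa [velocity_prod hU₁ hU₂ hconv₁ hconv₂ (hσ₁ t ht) (hσ₂ t ht) (γ t).2] at h1
    refine ⟨⟨congrArg rectFst h0, fun t ht ↦ ?_⟩, ⟨congrArg rectSnd h0, fun t ht ↦ ?_⟩⟩
    · exact (hasMFDerivAt_fst (γ t : M₁ × M₂)).comp_hasMFDerivWithinAt t (key t ht)
    · exact (hasMFDerivAt_snd (γ t : M₁ × M₂)).comp_hasMFDerivWithinAt t (key t ht)
  · rintro ⟨⟨h0₁, h₁⟩, ⟨h0₂, h₂⟩⟩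
    refine ⟨?_, fun t ht ↦ ?_⟩
    · exact congrArg₂ (fun x y ↦ rectMk (x, y)) h0₁ h0₂
    · rw [velocity_prod hU₁ hU₂ hconv₁ hconv₂ (hσ₁ t ht) (hσ₂ t ht) (γ t).2]
      exact (h₁ t ht).prodMk (h₂ t ht)

end ProductTrajectory

/-! ### Existence and uniqueness for the product model. -/

section WellPosedness

variable {E₁ : Type*} [NormedAddCommGroup E₁] [NormedSpace ℝ E₁] [FiniteDimensional ℝ E₁]
  {H₁ : Type*} [TopologicalSpace H₁] {I₁ : ModelWithCorners ℝ E₁ H₁} [I₁.Boundaryless]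
  {M₁ : Type*} [TopologicalSpace M₁] [T2Space M₁] [SecondCountableTopology M₁]
  [ConnectedSpace M₁] [ChartedSpace H₁ M₁]
  [IsManifold I₁ ∞ M₁] [MeasurableSpace M₁] [BorelSpace M₁]
  {E₂ : Type*} [NormedAddCommGroup E₂] [NormedSpace ℝ E₂] [FiniteDimensional ℝ E₂]
  {H₂ : Type*} [TopologicalSpace H₂] {I₂ : ModelWithCorners ℝ E₂ H₂} [I₂.Boundaryless]
  {M₂ : Type*} [TopologicalSpace M₂] [T2Space M₂] [SecondCountableTopology M₂]
  [ConnectedSpace M₂] [ChartedSpace H₂ M₂]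
  [IsManifold I₂ ∞ M₂] [MeasurableSpace M₂] [BorelSpace M₂]
  {g₁ : ContMDiffRiemannianMetric I₁ ∞ E₁ (fun x : M₁ ↦ TangentSpace I₁ x)}
  {g₂ : ContMDiffRiemannianMetric I₂ ∞ E₂ (fun x : M₂ ↦ TangentSpace I₂ x)}
  {U₁ : Set M₁} {U₂ : Set M₂} {T : EReal}

omit [SecondCountableTopology M₁] [SecondCountableTopology M₂] in
/-- The tensor product of weak solutions is a weak solution: its flow map is the product of the
two flow maps. -/
theorem isWeakSolution_tensor (hU₁ : IsOpen U₁) (hU₂ : IsOpen U₂)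
    (hconv₁ : GeodesicallyConvex g₁.toRiemannianMetric U₁)
    (hconv₂ : GeodesicallyConvex g₂.toRiemannianMetric U₂)
    {ρ₁ : ℝ → ProbabilityMeasure U₁} {ρ₂ : ℝ → ProbabilityMeasure U₂}
    (hm₁ : ∀ t ∈ timeInterval T, HasFiniteFirstMoment g₁.toRiemannianMetric (ρ₁ t))
    (hm₂ : ∀ t ∈ timeInterval T, HasFiniteFirstMoment g₂.toRiemannianMetric (ρ₂ t))
    (h₁ : IsWeakSolution g₁.toRiemannianMetric T ρ₁)
    (h₂ : IsWeakSolution g₂.toRiemannianMetric T ρ₂) :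
    IsWeakSolution (prodMetric g₁.toRiemannianMetric g₂.toRiemannianMetric) T
      (fun t ↦ tensor (ρ₁ t) (ρ₂ t)) := by
  obtain ⟨Ψ₁, hΨ₁, hp₁⟩ := isWeakSolution_iff.1 h₁
  obtain ⟨Ψ₂, hΨ₂, hp₂⟩ := isWeakSolution_iff.1 h₂
  have key : ∀ p γ, IsTrajectory (prodMetric g₁.toRiemannianMetric g₂.toRiemannianMetric) T
      (fun t ↦ tensor (ρ₁ t) (ρ₂ t)) p γ ↔
      IsTrajectory g₁.toRiemannianMetric T ρ₁ (rectFst p) (fun t ↦ rectFst (γ t)) ∧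
      IsTrajectory g₂.toRiemannianMetric T ρ₂ (rectSnd p) (fun t ↦ rectSnd (γ t)) := by
    intro p γ
    have h := isTrajectory_prod_iff hU₁ hU₂ hconv₁ hconv₂ (T := T) (g₁ := g₁) (g₂ := g₂)
      (σ := fun t ↦ tensor (ρ₁ t) (ρ₂ t)) (p := p) (γ := γ)
      (fun t ht ↦ by simpa using hm₁ t ht) (fun t ht ↦ by simpa using hm₂ t ht)
    simpa only [fstMarginal_tensor, sndMarginal_tensor] using h
  refine isWeakSolution_iff.2 ⟨fun p t ↦ rectMk (Ψ₁ (rectFst p) t, Ψ₂ (rectSnd p) t), ?_, ?_⟩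
  · intro p hp
    have q₁ := hΨ₁ _ (rectFst_mem_support hp)
    have q₂ := hΨ₂ _ (rectSnd_mem_support hp)
    refine ⟨(key _ _).2 ⟨q₁.1, q₂.1⟩, fun γ hγ t ht ↦ ?_⟩
    have hγ' := (key _ _).1 hγ
    exact congrArg₂ (fun x y ↦ rectMk (x, y)) (q₁.2 _ hγ'.1 ht) (q₂.2 _ hγ'.2 ht)
  · intro t ht
    obtain ⟨a₁, e₁⟩ := hp₁ t ht
    obtain ⟨a₂, e₂⟩ := hp₂ t ht
    have a : AEMeasurable (Prod.map (fun x ↦ Ψ₁ x t) fun y ↦ Ψ₂ y t)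
        ((ρ₁ 0 : Measure U₁).prod (ρ₂ 0 : Measure U₂)) := by
      refine AEMeasurable.prodMk ?_ ?_
      · exact a₁.comp_quasiMeasurePreserving Measure.quasiMeasurePreserving_fst
      · exact a₂.comp_quasiMeasurePreserving Measure.quasiMeasurePreserving_snd
    -- `κ` inverts `rectMk`, so the push-forward can be computed on the genuine product `U₁ × U₂`.
    let κ : (U₁ ×ˢ U₂ : Set (M₁ × M₂)) → U₁ × U₂ := fun p ↦ (rectFst p, rectSnd p)
    have hκ : Measurable κ := measurable_rectFst.prodMk measurable_rectSnd
    have hκmap : (tensor (ρ₁ 0) (ρ₂ 0) : Measure (U₁ ×ˢ U₂ : Set (M₁ × M₂))).map κ =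
        (ρ₁ 0 : Measure U₁).prod (ρ₂ 0 : Measure U₂) := by
      rw [toMeasure_tensor, Measure.map_map hκ measurable_rectMk]
      exact Measure.map_id
    rw [← hκmap] at a
    refine ⟨measurable_rectMk.comp_aemeasurable (a.comp_measurable hκ), ?_⟩
    have e : (tensor (ρ₁ 0) (ρ₂ 0) : Measure (U₁ ×ˢ U₂ : Set (M₁ × M₂))).map
        (rectMk ∘ Prod.map (fun x ↦ Ψ₁ x t) (fun y ↦ Ψ₂ y t) ∘ κ) =
        tensor (ρ₁ t) (ρ₂ t) := by
      rw [← AEMeasurable.map_map_of_aemeasurable measurable_rectMk.aemeasurable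
        (a.comp_measurable hκ), ← AEMeasurable.map_map_of_aemeasurable a hκ.aemeasurable, hκmap,
        map_prodMap_of_aemeasurable a₁ a₂, ← e₁, ← e₂, toMeasure_tensor]
    exact e.symm

/-- The product form of the datum is what makes the initial support a rectangle. Freezing the second
starting coordinate at `y₀` then defines a flow on the first factor. -/
theorem isWeakSolution_fstMarginal (hU₁ : IsOpen U₁) (hU₂ : IsOpen U₂)
    (hconv₁ : GeodesicallyConvex g₁.toRiemannianMetric U₁)
    (hconv₂ : GeodesicallyConvex g₂.toRiemannianMetric U₂)
    {σ : ℝ → ProbabilityMeasure (U₁ ×ˢ U₂ : Set (M₁ × M₂))}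
    (hσ₁ : ∀ t ∈ timeInterval T, HasFiniteFirstMoment g₁.toRiemannianMetric (fstMarginal (σ t)))
    (hσ₂ : ∀ t ∈ timeInterval T, HasFiniteFirstMoment g₂.toRiemannianMetric (sndMarginal (σ t)))
    {ν₁ : ProbabilityMeasure U₁} {ν₂ : ProbabilityMeasure U₂} (h0 : σ 0 = tensor ν₁ ν₂)
    (h : IsWeakSolution (prodMetric g₁.toRiemannianMetric g₂.toRiemannianMetric) T σ) :
    IsWeakSolution g₁.toRiemannianMetric T (fun t ↦ fstMarginal (σ t)) := by
  obtain ⟨Φ, hΦ, hp⟩ := isWeakSolution_iff.1 h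
  rw [h0] at hΦ
  obtain ⟨y₀, hy₀⟩ := Measure.nonempty_support (μ := (ν₂ : Measure U₂)) (NeZero.ne _)
  have key := fun p γ ↦ isTrajectory_prod_iff hU₁ hU₂ hconv₁ hconv₂ hσ₁ hσ₂ (p := p) (γ := γ)
  have hfst : ∀ p ∈ (tensor ν₁ ν₂ : Measure (U₁ ×ˢ U₂ : Set (M₁ × M₂))).support,
      ∀ t ∈ timeInterval T, rectFst (Φ p t) = rectFst (Φ (rectMk (rectFst p, y₀)) t) := by
    intro p hp t ht
    have q := hΦ p hp
    have q₀ := hΦ _ (rectMk_mem_support_tensor (rectFst_mem_support hp) hy₀)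
    -- The spliced curve starts at `p` and both components are trajectories, so it is the trajectory
    -- from `p`. Hence the first component does not depend on the second starting coordinate.
    have q' := q.2 (fun s ↦ rectMk (rectFst (Φ (rectMk (rectFst p, y₀)) s), rectSnd (Φ p s)))
      ((key _ _).2 ⟨((key _ _).1 q₀.1).1, ((key _ _).1 q.1).2⟩) ht
    exact (congrArg rectFst q').symm
  refine isWeakSolution_iff.2 ⟨fun x t ↦ rectFst (Φ (rectMk (x, y₀)) t), ?_, ?_⟩
  · intro x hx
    rw [h0, fstMarginal_tensor] at hx
    have q := hΦ _ (rectMk_mem_support_tensor hx hy₀)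
    refine ⟨((key _ _).1 q.1).1, fun γ hγ t ht ↦ ?_⟩
    -- A competing trajectory on the first factor, paired with the existing second component, is a
    -- trajectory of `σ`; uniqueness on the product decides.
    have q' := q.2 (fun s ↦ rectMk (γ s, rectSnd (Φ (rectMk (x, y₀)) s)))
      ((key _ _).2 ⟨hγ, ((key _ _).1 q.1).2⟩) ht
    exact congrArg rectFst q'
  · intro t ht
    obtain ⟨a, e⟩ := hp t ht
    have hae : (fun p ↦ rectFst (Φ p t)) =ᵐ[(σ 0 : Measure (U₁ ×ˢ U₂ : Set (M₁ × M₂)))]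
        (fun x ↦ rectFst (Φ (rectMk (x, y₀)) t)) ∘ rectFst := by
      rw [h0]
      filter_upwards [Measure.support_mem_ae] with p hp
      exact hfst p hp t ht
    have a' := (measurable_rectFst.comp_aemeasurable a).congr hae
    -- The slice at `y₀` may be null. Measurability comes from the whole product, on which the first
    -- component agrees almost everywhere with its value at `y₀`.
    have a₁ : AEMeasurable (fun x ↦ rectFst (Φ (rectMk (x, y₀)) t)) (ν₁ : Measure U₁) := by
      rw [h0, toMeasure_tensor] at a'
      exact aemeasurable_of_comp_fst (a'.comp_measurable measurable_rectMk)
    have hmarg : (fstMarginal (σ 0) : Measure U₁) = ν₁ := by rw [h0, fstMarginal_tensor]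
    rw [← hmarg] at a₁
    refine ⟨a₁, ?_⟩
    rw [toMeasure_fstMarginal, e, AEMeasurable.map_map_of_aemeasurable
      measurable_rectFst.aemeasurable a]
    exact (Measure.map_congr hae).trans
      (AEMeasurable.map_map_of_aemeasurable a₁ measurable_rectFst.aemeasurable).symm

theorem isWeakSolution_sndMarginal (hU₁ : IsOpen U₁) (hU₂ : IsOpen U₂)
    (hconv₁ : GeodesicallyConvex g₁.toRiemannianMetric U₁)
    (hconv₂ : GeodesicallyConvex g₂.toRiemannianMetric U₂)
    {σ : ℝ → ProbabilityMeasure (U₁ ×ˢ U₂ : Set (M₁ × M₂))}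
    (hσ₁ : ∀ t ∈ timeInterval T, HasFiniteFirstMoment g₁.toRiemannianMetric (fstMarginal (σ t)))
    (hσ₂ : ∀ t ∈ timeInterval T, HasFiniteFirstMoment g₂.toRiemannianMetric (sndMarginal (σ t)))
    {ν₁ : ProbabilityMeasure U₁} {ν₂ : ProbabilityMeasure U₂} (h0 : σ 0 = tensor ν₁ ν₂)
    (h : IsWeakSolution (prodMetric g₁.toRiemannianMetric g₂.toRiemannianMetric) T σ) :
    IsWeakSolution g₂.toRiemannianMetric T (fun t ↦ sndMarginal (σ t)) := by
  obtain ⟨Φ, hΦ, hp⟩ := isWeakSolution_iff.1 h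
  rw [h0] at hΦ
  obtain ⟨x₀, hx₀⟩ := Measure.nonempty_support (μ := (ν₁ : Measure U₁)) (NeZero.ne _)
  have key := fun p γ ↦ isTrajectory_prod_iff hU₁ hU₂ hconv₁ hconv₂ hσ₁ hσ₂ (p := p) (γ := γ)
  have hsnd : ∀ p ∈ (tensor ν₁ ν₂ : Measure (U₁ ×ˢ U₂ : Set (M₁ × M₂))).support,
      ∀ t ∈ timeInterval T, rectSnd (Φ p t) = rectSnd (Φ (rectMk (x₀, rectSnd p)) t) := by
    intro p hp t ht
    have q := hΦ p hp
    have q₀ := hΦ _ (rectMk_mem_support_tensor hx₀ (rectSnd_mem_support hp))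
    have q' := q.2 (fun s ↦ rectMk (rectFst (Φ p s), rectSnd (Φ (rectMk (x₀, rectSnd p)) s)))
      ((key _ _).2 ⟨((key _ _).1 q.1).1, ((key _ _).1 q₀.1).2⟩) ht
    exact (congrArg rectSnd q').symm
  refine isWeakSolution_iff.2 ⟨fun y t ↦ rectSnd (Φ (rectMk (x₀, y)) t), ?_, ?_⟩
  · intro y hy
    rw [h0, sndMarginal_tensor] at hy
    have q := hΦ _ (rectMk_mem_support_tensor hx₀ hy)
    refine ⟨((key _ _).1 q.1).2, fun γ hγ t ht ↦ ?_⟩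
    have q' := q.2 (fun s ↦ rectMk (rectFst (Φ (rectMk (x₀, y)) s), γ s))
      ((key _ _).2 ⟨((key _ _).1 q.1).1, hγ⟩) ht
    exact congrArg rectSnd q'
  · intro t ht
    obtain ⟨a, e⟩ := hp t ht
    have hae : (fun p ↦ rectSnd (Φ p t)) =ᵐ[(σ 0 : Measure (U₁ ×ˢ U₂ : Set (M₁ × M₂)))]
        (fun y ↦ rectSnd (Φ (rectMk (x₀, y)) t)) ∘ rectSnd := by
      rw [h0]
      filter_upwards [Measure.support_mem_ae] with p hp
      exact hsnd p hp t ht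
    have a' := (measurable_rectSnd.comp_aemeasurable a).congr hae
    have a₂ : AEMeasurable (fun y ↦ rectSnd (Φ (rectMk (x₀, y)) t)) (ν₂ : Measure U₂) := by
      rw [h0, toMeasure_tensor] at a'
      exact aemeasurable_of_comp_snd (a'.comp_measurable measurable_rectMk)
    have hmarg : (sndMarginal (σ 0) : Measure U₂) = ν₂ := by rw [h0, sndMarginal_tensor]
    rw [← hmarg] at a₂
    refine ⟨a₂, ?_⟩
    rw [toMeasure_sndMarginal, e, AEMeasurable.map_map_of_aemeasurable
      measurable_rectSnd.aemeasurable a]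
    exact (Measure.map_congr hae).trans
      (AEMeasurable.map_map_of_aemeasurable a₂ measurable_rectSnd.aemeasurable).symm

/-- Well-posedness of the product model, for classes of curves that are stable under tensor
products and marginals. -/
theorem isUniqueWeakSolution_tensor (hU₁ : IsOpen U₁) (hU₂ : IsOpen U₂)
    (hconv₁ : GeodesicallyConvex g₁.toRiemannianMetric U₁)
    (hconv₂ : GeodesicallyConvex g₂.toRiemannianMetric U₂)
    {C₁ : Set (ℝ → ProbabilityMeasure U₁)} {C₂ : Set (ℝ → ProbabilityMeasure U₂)}
    {C : Set (ℝ → ProbabilityMeasure (U₁ ×ˢ U₂ : Set (M₁ × M₂)))}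
    (hC₁ : ∀ ρ ∈ C₁, ∀ t ∈ timeInterval T, HasFiniteFirstMoment g₁.toRiemannianMetric (ρ t))
    (hC₂ : ∀ ρ ∈ C₂, ∀ t ∈ timeInterval T, HasFiniteFirstMoment g₂.toRiemannianMetric (ρ t))
    (hC : ∀ ρ₁ ∈ C₁, ∀ ρ₂ ∈ C₂, (fun t ↦ tensor (ρ₁ t) (ρ₂ t)) ∈ C)
    (hfst : ∀ σ ∈ C, (fun t ↦ fstMarginal (σ t)) ∈ C₁)
    (hsnd : ∀ σ ∈ C, (fun t ↦ sndMarginal (σ t)) ∈ C₂)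
    {ρ₁ : ℝ → ProbabilityMeasure U₁} {ρ₂ : ℝ → ProbabilityMeasure U₂}
    (h₁ : IsUniqueWeakSolution g₁.toRiemannianMetric T C₁ ρ₁)
    (h₂ : IsUniqueWeakSolution g₂.toRiemannianMetric T C₂ ρ₂) :
    IsUniqueWeakSolution (prodMetric g₁.toRiemannianMetric g₂.toRiemannianMetric) T C
      (fun t ↦ tensor (ρ₁ t) (ρ₂ t)) := by
  have hμ := isWeakSolution_tensor hU₁ hU₂ hconv₁ hconv₂ (hC₁ _ h₁.1) (hC₂ _ h₂.1) h₁.2.1 h₂.2.1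
  refine ⟨hC _ h₁.1 _ h₂.1, hμ, fun σ hσC hσ h0 ↦ ?_⟩
  have m₁ := hC₁ _ (hfst σ hσC)
  have m₂ := hC₂ _ (hsnd σ hσC)
  -- Equal marginals do not yet give `σ t = tensor (ρ₁ t) (ρ₂ t)`, but they give equal velocity
  -- fields; the product form comes back through the common flow.
  have e₁ : EqOn (fun t ↦ fstMarginal (σ t)) ρ₁ (timeInterval T) :=
    h₁.2.2 _ (hfst σ hσC) (isWeakSolution_fstMarginal hU₁ hU₂ hconv₁ hconv₂ m₁ m₂ h0 hσ)
      (by rw [h0, fstMarginal_tensor])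
  have e₂ : EqOn (fun t ↦ sndMarginal (σ t)) ρ₂ (timeInterval T) :=
    h₂.2.2 _ (hsnd σ hσC) (isWeakSolution_sndMarginal hU₁ hU₂ hconv₁ hconv₂ m₁ m₂ h0 hσ)
      (by rw [h0, sndMarginal_tensor])
  obtain ⟨Φ, hΦ, hpΦ⟩ := isWeakSolution_iff.1 hσ
  obtain ⟨Ψ, hΨ, hpΨ⟩ := isWeakSolution_iff.1 hμ
  intro t ht
  apply Subtype.ext
  change (σ t : Measure (U₁ ×ˢ U₂ : Set (M₁ × M₂))) =
    (tensor (ρ₁ t) (ρ₂ t) : Measure (U₁ ×ˢ U₂ : Set (M₁ × M₂)))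
  rw [(hpΦ t ht).2, (hpΨ t ht).2, h0]
  refine Measure.map_congr ?_
  filter_upwards [Measure.support_mem_ae] with p hp
  -- The trajectory of `σ` from `p` decouples, its components may be read with `ρ₁` and `ρ₂`, and so
  -- it is a trajectory of the tensor product.
  refine (hΨ p hp).2 (Φ p) ?_ ht
  rw [h0] at hΦ
  have q := (isTrajectory_prod_iff hU₁ hU₂ hconv₁ hconv₂ m₁ m₂).1 (hΦ p hp).1
  refine (isTrajectory_prod_iff hU₁ hU₂ hconv₁ hconv₂ ?_ ?_).2 ⟨q.1.congr ?_, q.2.congr ?_⟩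
  · simpa using hC₁ _ h₁.1
  · simpa using hC₂ _ h₂.1
  · simpa using e₁
  · simpa using e₂

end WellPosedness

end Aggregation

end

theorem mainTheorem9
    {E₁ : Type*} [NormedAddCommGroup E₁] [NormedSpace ℝ E₁] [FiniteDimensional ℝ E₁]
    {H₁ : Type*} [TopologicalSpace H₁] {I₁ : ModelWithCorners ℝ E₁ H₁} [I₁.Boundaryless]
    {M₁ : Type*} [TopologicalSpace M₁] [T2Space M₁] [SecondCountableTopology M₁]
    [ConnectedSpace M₁] [ChartedSpace H₁ M₁] [IsManifold I₁ ∞ M₁]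
    [MeasurableSpace M₁] [BorelSpace M₁]
    {E₂ : Type*} [NormedAddCommGroup E₂] [NormedSpace ℝ E₂] [FiniteDimensional ℝ E₂]
    {H₂ : Type*} [TopologicalSpace H₂] {I₂ : ModelWithCorners ℝ E₂ H₂} [I₂.Boundaryless]
    {M₂ : Type*} [TopologicalSpace M₂] [T2Space M₂] [SecondCountableTopology M₂]
    [ConnectedSpace M₂] [ChartedSpace H₂ M₂] [IsManifold I₂ ∞ M₂]
    [MeasurableSpace M₂] [BorelSpace M₂]
    (g₁ : ContMDiffRiemannianMetric I₁ ∞ E₁ (fun x : M₁ ↦ TangentSpace I₁ x))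
    (g₂ : ContMDiffRiemannianMetric I₂ ∞ E₂ (fun x : M₂ ↦ TangentSpace I₂ x))
    (hcomplete₁ : Aggregation.IsCompleteMetric g₁.toRiemannianMetric)
    (hcomplete₂ : Aggregation.IsCompleteMetric g₂.toRiemannianMetric)
    (U₁ : Set M₁) (U₂ : Set M₂) (hU₁ : IsOpen U₁) (hU₂ : IsOpen U₂)
    (hconvex₁ : Aggregation.GeodesicallyConvex g₁.toRiemannianMetric U₁)
    (hconvex₂ : Aggregation.GeodesicallyConvex g₂.toRiemannianMetric U₂)
    (T : EReal) (hT : 0 < T)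
    (ρ₁ : ℝ → ProbabilityMeasure U₁) (ρ₂ : ℝ → ProbabilityMeasure U₂) :
    (Aggregation.IsUniqueWeakSolution g₁.toRiemannianMetric T
        (Aggregation.narrowCurves g₁.toRiemannianMetric U₁ T) ρ₁ →
      Aggregation.IsUniqueWeakSolution g₂.toRiemannianMetric T
        (Aggregation.narrowCurves g₂.toRiemannianMetric U₂ T) ρ₂ →
      Aggregation.IsUniqueWeakSolution
        (Aggregation.prodMetric g₁.toRiemannianMetric g₂.toRiemannianMetric) T
        (Aggregation.narrowCurves
          (Aggregation.prodMetric g₁.toRiemannianMetric g₂.toRiemannianMetric) (U₁ ×ˢ U₂) T)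
        (fun t ↦ Aggregation.tensor (ρ₁ t) (ρ₂ t))) ∧
    (Aggregation.IsUniqueWeakSolution g₁.toRiemannianMetric T
        (Aggregation.wassersteinCurves g₁.toRiemannianMetric U₁ T) ρ₁ →
      Aggregation.IsUniqueWeakSolution g₂.toRiemannianMetric T
        (Aggregation.wassersteinCurves g₂.toRiemannianMetric U₂ T) ρ₂ →
      Aggregation.IsUniqueWeakSolution
        (Aggregation.prodMetric g₁.toRiemannianMetric g₂.toRiemannianMetric) T
        (Aggregation.wassersteinCurves
          (Aggregation.prodMetric g₁.toRiemannianMetric g₂.toRiemannianMetric) (U₁ ×ˢ U₂) T)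
        (fun t ↦ Aggregation.tensor (ρ₁ t) (ρ₂ t))) := by
  -- Locally compact, Hausdorff and second countable spaces are metrizable, as the narrow continuity
  -- of the tensor product requires.
  have := I₁.locallyCompactSpace
  have := I₂.locallyCompactSpace
  have := ChartedSpace.locallyCompactSpace H₁ M₁
  have := ChartedSpace.locallyCompactSpace H₂ M₂
  constructor
  · exact fun h₁ h₂ ↦ Aggregation.isUniqueWeakSolution_tensor hU₁ hU₂ hconvex₁ hconvex₂
      (fun _ h ↦ h.1) (fun _ h ↦ h.1)
      (fun _ k₁ _ k₂ ↦ Aggregation.tensor_mem_narrowCurves k₁ k₂)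
      (fun _ k ↦ Aggregation.fstMarginal_mem_narrowCurves k)
      (fun _ k ↦ Aggregation.sndMarginal_mem_narrowCurves k) h₁ h₂
  · exact fun h₁ h₂ ↦ Aggregation.isUniqueWeakSolution_tensor hU₁ hU₂ hconvex₁ hconvex₂
      (fun _ h ↦ h.1) (fun _ h ↦ h.1)
      (fun _ k₁ _ k₂ ↦ Aggregation.tensor_mem_wassersteinCurves k₁ k₂)
      (fun _ k ↦ Aggregation.fstMarginal_mem_wassersteinCurves k)
      (fun _ k ↦ Aggregation.sndMarginal_mem_wassersteinCurves k) h₁ h₂
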